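/- **Setting.** Let $T\subseteq\mathbb R_+^d\times\mathbb R_+$ be a freely disposable technology (if $(x,y)\in T$, $x'\ge x$ componentwise and $0\le y'\le y$, then $(x',y')\in T$), and let $\phi(x)=\sup\{y:(x,y)\in T\}$ be its production frontier. Let $(X_i,Y_i)_{i\ge1}$ be i.i.d. with values in $T$ almost surely. Fix $x$ with $p_0=P(X_1\le x)>0$ and put $F(y)=P(Y_1\le y\mid X_1\le x)$. Outputs that are feasible at $x$ are approached by observable ones: $P(X_1\le x,\,Y_1>y')>0$ whenever $(x,y)\in T$ and $y'<y$ (so that $\phi(x)=\sup\{y\ge 0: F(y)<1\}$). Suppose that $z_1=\sup\{z:F(z)<1\}<\infty$ and that, for some $\xi_0<0$ and all $v>0$, $\frac{1-F(z_1-vz)}{1-F(z_1-z)}\to v^{-1/\xi_0}$ as $z\downarrow0$. **First-stage estimators.** For $\tau\in(0,1)$ let $\hat q_n(\tau)$ be any measurable minimizer over $q$ of $\sum_{i=1}^n(\tau-\mathbf 1\{Y_i-q\le0\})(Y_i-q)\mathbf 1\{X_i\le x\}$. Let $L\ge1$, $k_0,k_1,\dots,k_L>0$ and $m>1$ be such that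 none of $k_0p_0,\ mk_0p_0,\ k_1p_0,\dots,k_Lp_0$ is an integer and $mk_0p_0>k_0p_0+1$. For $k,p>0$ let $h_p(k)=\lceil kp\rceil$ (for $kp\notin\mathbb Z$, the unique integer in $[kp,kp+1]$) and suppose that $h_{p_0}(k_0),h_{p_0}(mk_0),h_{p_0}(k_1),\dots,h_{p_0}(k_L)$ are pairwise distinct. Put $\hat\alpha_n=\big(\hat q_n(1-k_0/n)-\hat q_n(1-mk_0/n)\big)^{-1}$. Let $(\hat\xi_n,\hat p_n)$ be random variables converging to $(\xi_0,p_0)$ in probability. **Limit experiment.** Let $\mathcal E_1,\mathcal E_2,\dots$ be i.i.d. standard exponential. For $\xi<0$ and $p>0$ let $Z_\infty(k)=-\big(\sum_{i=1}^{h_p(k)}\mathcal E_i/p\big)^{-\xi}$ and $\tilde Z_\infty(k)=Z_\infty(k)/(Z_\infty(k_0)-Z_\infty(mk_0))$. For all $\xi<0$, $p>0$ at which the integers $h_p(\cdot)$ above are pairwise distinct, let $f(\cdot;\xi,p)\ge0$ be a joint density of $(\tilde Z_\infty(k_1),\dots,\tilde Z_\infty(k_L))$ on $\mathbb R^L$.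 Suppose that $f(\cdot;\xi,p)$ is continuous on $\mathbb R^L$ for all $(\xi,p)$ in a neighbourhood of $(\xi_0,p_0)$, and that $(z,\xi,p)\mapsto f(z;\xi,p)$ is continuous at $(z,\xi_0,p_0)$ for every $z\in\mathbb R^L$. **Bayesian estimators.** Let $\pi\ge0$ be a bounded measurable prior density (possibly improper) that is continuous at $\phi(x)$, with $\phi(x)$ in the interior of $U=\{\pi>0\}$. For $\tau\in(0,1)$ let $\tilde\rho_\tau(u)=(\mathbf 1\{u>0\}-\tau)u$, and let $\hat q^{BE}_n(\tau)$ be any measurable minimizer over $q$ (for all large $n$, almost surely) of the $[0,\infty]$-valued average risk $$\int_U\tilde\rho_\tau\big(\hat\alpha_n(q-\bar q)\big)\,\frac{f\big(\hat\alpha_n(\hat q_n(1-\tfrac{k_1}n)-\bar q),\dots,\hat\alpha_n(\hat q_n(1-\tfrac{k_L}n)-\bar q);\hat\xi_n,\hat p_n\big)\,\pi(\bar q)}{\int_U f\big(\hat\alpha_n(\hat q_n(1-\tfrac{k_1}n)-q'),\dots,\hat\alpha_n(\hat q_n(1-\tfrac{k_L}n)-q');\hat\xi_n,\hat p_n\big)\,\pi(q')\,dq'}\,d\bar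 q .$$ **Limits.** Let $0<\tau'<\tau''<1$. For $\tau\in\{0.5,\tau',\tau''\}$ suppose that, with probability one, the function $$z\mapsto\int_{\mathbb R}\tilde\rho_\tau(z-v)\,\frac{f(\tilde Z_\infty(k_1)-v,\dots,\tilde Z_\infty(k_L)-v;\xi_0,p_0)}{\int_{\mathbb R}f(\tilde Z_\infty(k_1)-v',\dots,\tilde Z_\infty(k_L)-v';\xi_0,p_0)\,dv'}\,dv$$ (with $\tilde Z_\infty$ taken at $(\xi_0,p_0)$) is finite on a nonempty open set and has a unique minimizer, the random variable $Z^{BE}_\infty(\tau)$, and suppose that $Z_\infty^{BE}(\tau)$ is continuously distributed at zero, i.e. $P(Z^{BE}_\infty(\tau)=0)=0$. **Conclusion.** As $n\to\infty$, $$P\big(\phi(x)\le\hat q_n^{BE}(0.5)\big)\to 0.5\qquad\text{and}\qquad P\big(\phi(x)\in[\hat q_n^{BE}(\tau'),\hat q_n^{BE}(\tau'')]\big)\to\tau''-\tau'.$$ -/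

import Mathlib

open MeasureTheory Filter Topology Set
open scoped ENNReal

namespace FrontierABC

noncomputable section

/-! ### Technology, frontier and the conditional distribution -/

/-- The technology `T ⊆ ℝ₊ᵈ × ℝ₊` is freely disposable: more inputs or less output stay feasible
(the order on inputs is componentwise). -/
def FreeDisposal {d : ℕ} (T : Set ((Fin d → ℝ) × ℝ)) : Prop :=
  ∀ x x' : Fin d → ℝ, ∀ y y' : ℝ, (x, y) ∈ T → x ≤ x' → 0 ≤ y' → y' ≤ y → (x', y') ∈ T

/-- The production frontier `φ(x) = sup {y | (x, y) ∈ T}`. -/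
def prodFrontier {d : ℕ} (T : Set ((Fin d → ℝ) × ℝ)) (x : Fin d → ℝ) : ℝ :=
  sSup {y | (x, y) ∈ T}

/-- `F(y/x) = P(Y ≤ y | X ≤ x)`. -/
def condDist {d : ℕ} {Ω : Type*} [MeasurableSpace Ω] (P : Measure Ω)
    (X : Ω → Fin d → ℝ) (Y : Ω → ℝ) (x : Fin d → ℝ) (y : ℝ) : ℝ :=
  (ProbabilityTheory.cond P {ω | X ω ≤ x}).real {ω | Y ω ≤ y}

/-- The CDF `F` has a finite right end point `z₁ = sup {z | F z < 1}` and belongs to the domain of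
attraction of the type III extreme value distributions with index `ξ < 0`:
`(1 - F(z₁ - v z)) / (1 - F(z₁ - z)) → v ^ (-1/ξ)` as `z ↓ 0`, for every `v > 0`. -/
def InTypeIIIDomain (F : ℝ → ℝ) (ξ : ℝ) : Prop :=
  ξ < 0 ∧ BddAbove {z | F z < 1} ∧
    ∀ v : ℝ, 0 < v →
      Tendsto (fun z : ℝ => (1 - F (sSup {z | F z < 1} - v * z)) / (1 - F (sSup {z | F z < 1} - z)))
        (𝓝[>] 0) (𝓝 (v ^ (-1 / ξ)))

/-! ### Extreme quantile estimators -/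

/-- The check function `ρ_τ(u) = (τ - 1{u ≤ 0}) u`. -/
def check (τ u : ℝ) : ℝ := (τ - if u ≤ 0 then 1 else 0) * u

/-- The sample objective `∑_{i < n} ρ_τ(Y_i - q) 1{X_i ≤ x}`. -/
def quantileObjective {d : ℕ} {Ω : Type*} (X : ℕ → Ω → Fin d → ℝ) (Y : ℕ → Ω → ℝ)
    (x : Fin d → ℝ) (n : ℕ) (τ : ℝ) (ω : Ω) (q : ℝ) : ℝ :=
  ∑ i ∈ Finset.range n, {ω' | X i ω' ≤ x}.indicator (fun ω' => check τ (Y i ω' - q)) ω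

/-- `qhat n τ` is an estimator (a random variable) that minimises the sample objective at sample
size `n` and quantile index `τ ∈ (0, 1)`. -/
def IsQuantileEstimator {d : ℕ} {Ω : Type*} [MeasurableSpace Ω] (P : Measure Ω)
    (X : ℕ → Ω → Fin d → ℝ) (Y : ℕ → Ω → ℝ) (x : Fin d → ℝ) (qhat : ℕ → ℝ → Ω → ℝ) : Prop :=
  ∀ n : ℕ, ∀ τ : ℝ, 0 < τ → τ < 1 → Measurable (qhat n τ) ∧
    ∀ᵐ ω ∂P, ∀ q : ℝ,
      quantileObjective X Y x n τ ω (qhat n τ ω) ≤ quantileObjective X Y x n τ ω q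

/-- The feasible normalising factor `α̂ₙ = 1 / (q̂ₙ(1 - k₀/n) - q̂ₙ(1 - m k₀/n))`. -/
def alphaHat {Ω : Type*} (qhat : ℕ → ℝ → Ω → ℝ) (k₀ m : ℝ) (n : ℕ) (ω : Ω) : ℝ :=
  (qhat n (1 - k₀ / n) ω - qhat n (1 - m * k₀ / n) ω)⁻¹

/-! ### The limit experiment -/

/-- `h(k)`: the integer in `[k p, k p + 1]`, which is unique when `k p` is not an integer. -/
def rank (k p : ℝ) : ℕ := ⌈k * p⌉₊

/-- `h(k₀), h(m k₀), h(k₁), …, h(k_L)` are pairwise distinct. -/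
def DistinctRanks {L : ℕ} (k₀ m : ℝ) (k : Fin L → ℝ) (p : ℝ) : Prop :=
  rank k₀ p ≠ rank (m * k₀) p ∧
    (∀ l, rank (k l) p ≠ rank k₀ p ∧ rank (k l) p ≠ rank (m * k₀) p) ∧
    Function.Injective fun l => rank (k l) p

/-- `Z_∞(k) = -(∑_{i ≤ h(k)} E_i / p) ^ (-ξ)`. -/
def Zlim {Ω' : Type*} (E : ℕ → Ω' → ℝ) (ξ p k : ℝ) (ω : Ω') : ℝ :=
  -(((∑ i ∈ Finset.range (rank k p), E i ω) / p) ^ (-ξ))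

/-- The vector of `Z_∞(k_l) / (Z_∞(k₀) - Z_∞(m k₀))`, `l = 1, …, L`. -/
def Ztilde {Ω' : Type*} {L : ℕ} (E : ℕ → Ω' → ℝ) (k₀ m : ℝ) (k : Fin L → ℝ) (ξ p : ℝ)
    (ω : Ω') : Fin L → ℝ :=
  fun l => Zlim E ξ p (k l) ω / (Zlim E ξ p k₀ ω - Zlim E ξ p (m * k₀) ω)

/-- `E` is an i.i.d. sequence of standard exponential random variables. -/
def IsIIDExponential {Ω' : Type*} [MeasurableSpace Ω'] (P' : Measure Ω') (E : ℕ → Ω' → ℝ) : Prop :=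
  (∀ i, Measurable (E i)) ∧ ProbabilityTheory.iIndepFun E P' ∧
    ∀ i, P'.map (E i) = ProbabilityTheory.expMeasure 1

/-- `f ξ p` is a joint probability density (with respect to Lebesgue measure on `ℝᴸ`) of the limit
vector with parameters `(ξ, p)`, for all parameters at which the ranks are distinct. -/
def IsLimitDensity {Ω' : Type*} [MeasurableSpace Ω'] {L : ℕ} (P' : Measure Ω') (E : ℕ → Ω' → ℝ)
    (k₀ m : ℝ) (k : Fin L → ℝ) (f : ℝ → ℝ → (Fin L → ℝ) → ℝ) : Prop :=
  ∀ ξ p : ℝ, ξ < 0 → 0 < p → DistinctRanks k₀ m k p →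
    Measurable (f ξ p) ∧ (∀ z, 0 ≤ f ξ p z) ∧
      P'.map (Ztilde E k₀ m k ξ p) = volume.withDensity fun z => ENNReal.ofReal (f ξ p z)

/-! ### Bayesian estimators -/

/-- The loss `(1{u > 0} - τ) u`. -/
def bayesLoss (τ u : ℝ) : ℝ := ((if 0 < u then 1 else 0) - τ) * u

/-- The average risk of the value `q` under the loss `u ↦ bayesLoss τ (a u)`, for first-stage
estimates `w`, normalising factor `a`, approximate likelihood `g` and prior `π` with support `U`:
`∫_U loss(a (q - r)) g(a (w₁ - r), …, a (w_L - r)) π(r) / (∫_U g(a (w - r')) π(r') dr') dr`,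
with values in `[0, ∞]`. -/
def averageRisk {L : ℕ} (τ a : ℝ) (w : Fin L → ℝ) (g : (Fin L → ℝ) → ℝ) (π : ℝ → ℝ) (q : ℝ) :
    ℝ≥0∞ :=
  ∫⁻ r in Function.support π,
    ENNReal.ofReal (bayesLoss τ (a * (q - r))) *
      (ENNReal.ofReal (g (fun l => a * (w l - r)) * π r) /
        ∫⁻ r' in Function.support π, ENNReal.ofReal (g (fun l => a * (w l - r')) * π r'))

/-- `qBE` is a (measurable) Bayesian estimator under the loss with index `τ`: for all large `n`,
almost surely, it minimises the average risk formed from the estimates `q̂ₙ(1 - k_l/n)`, the factor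
`α̂ₙ` and the likelihood `f(·; ξ̂ₙ, p̂ₙ)`. -/
def IsBayesEstimator {Ω : Type*} [MeasurableSpace Ω] {L : ℕ} (P : Measure Ω)
    (qhat : ℕ → ℝ → Ω → ℝ) (k₀ m : ℝ) (k : Fin L → ℝ) (f : ℝ → ℝ → (Fin L → ℝ) → ℝ)
    (ξhat phat : ℕ → Ω → ℝ) (π : ℝ → ℝ) (τ : ℝ) (qBE : ℕ → Ω → ℝ) : Prop :=
  (∀ n, Measurable (qBE n)) ∧
    ∀ᶠ n : ℕ in atTop, ∀ᵐ ω ∂P, ∀ q : ℝ,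
      averageRisk τ (alphaHat qhat k₀ m n ω) (fun l => qhat n (1 - k l / n) ω)
          (f (ξhat n ω) (phat n ω)) π (qBE n ω) ≤
        averageRisk τ (alphaHat qhat k₀ m n ω) (fun l => qhat n (1 - k l / n) ω)
          (f (ξhat n ω) (phat n ω)) π q

/-- The limit objective
`Q_∞(z; w) = ∫ loss(z - v) g(w₁ - v, …, w_L - v) / (∫ g(w - v') dv') dv ∈ [0, ∞]`. -/
def limitRisk {L : ℕ} (τ : ℝ) (g : (Fin L → ℝ) → ℝ) (w : Fin L → ℝ) (z : ℝ) : ℝ≥0∞ :=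
  ∫⁻ v : ℝ, ENNReal.ofReal (bayesLoss τ (z - v)) *
    (ENNReal.ofReal (g fun l => w l - v) / ∫⁻ v' : ℝ, ENNReal.ofReal (g fun l => w l - v'))

/-- With probability one, the limit objective at the limit vector `W` is finite on a nonempty open
set and uniquely minimised at the random variable `Z`. -/
def IsUniqueLimitArgmin {Ω' : Type*} [MeasurableSpace Ω'] {L : ℕ} (P' : Measure Ω') (τ : ℝ)
    (g : (Fin L → ℝ) → ℝ) (W : Ω' → Fin L → ℝ) (Z : Ω' → ℝ) : Prop :=
  Measurable Z ∧ ∀ᵐ ω ∂P',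
    (∃ O : Set ℝ, IsOpen O ∧ O.Nonempty ∧ ∀ z ∈ O, limitRisk τ g (W ω) z < ∞) ∧
      ∀ z : ℝ, z ≠ Z ω → limitRisk τ g (W ω) (Z ω) < limitRisk τ g (W ω) z

end

end FrontierABC

/-!
The Bayesian estimator is a posterior quantile. For a loss of the form `(1{u > 0} - τ) u`, moving a
minimiser `q` of the average risk slightly to the left or to the right shows that the posterior gives at
most mass `τ` to `(-∞, q)` and at least mass `τ` to `(-∞, q]`. Hence `φ ≤ q` forces the posterior
probability `G_n` of the parameters below the frontier value `φ = φ(x)` to be at most `τ`, and `q ≤ φ`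
forces it to be at least `τ` (`averageRisk_minimiser`, `State.IsGood.minimiser`). It therefore suffices to
show that `G_n` is asymptotically uniform on `[0, 1]`, and no convergence of the minimisers themselves has
to be established.

*First stage.* With probability tending to one, the extreme quantile estimators are order statistics of the
gaps `φ - Y_i` in the subsample `X_i ≤ x`. Regular variation of the tail and a Poisson limit theorem for
order statistics of triangular arrays show that the scaled and transformed smallest gaps converge in
distribution to partial sums of exponential variables (`tendstoInDistribution_orderStat`,
`exists_tendstoInDistribution_firstStage`).

*Posterior masses.* In the local parameter `v`, with `q = φ + v / α̂_n`, the posterior density at `v` is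
proportional to `f (W_n - v) π (φ + v / α̂_n)`, where `W_n` is the vector of normalised first-stage errors. The
prior becomes flat, and by dominated convergence the masses converge to integrals of `f (w - v)`
(`IsRegularFamily.tendsto_lintegral_localDensity`). An integrable bound comes from an estimate of the order
`v ^ (-L - κ)` of the limit densities along the negative diagonal
(`IsIIDExponential.exists_density_le`), which holds because the joint law of the partial sums is dominated
by a product of exponential laws. The posterior also needs a finite first moment, so that the minimal risk
is finite. For `L ≥ 2` this is contained in the same estimate. For `L = 1` it is the integrability of a
ratio of powers of partial sums; finiteness of the limit risk gives it at `ξ₀`, and the set of exponents for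
which it holds is open (`IsIIDExponential.eventually_lintegral_power_ratio_lt_top`).

*Uniformity.* Under the density `f` of the limit vector `w`, the limit
`∫_{v < 0} f (w - v) dv / ∫ f (w - v) dv` of `G_n` is uniformly distributed: on each line in the direction
`(1, …, 1)` it is the survival function of the conditional law of `w`, and the probability integral
transform applies (`setLIntegral_le_of_diagonal`, `measure_diagonalMass_mem_Icc_le`). The portmanteau
theorem, applied to the closure of the set of states whose posterior probability lies in `[α, β]`, bounds the
limes superior of `P(G_n ∈ [α, β])` by `β - α`
(`eventually_measureReal_lt_of_posterior`). The complementary events satisfy the analogous bounds, and these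
add up to one, which gives the limits.
-/

namespace FrontierABC

/-! ### Minimisers of the asymmetric linear loss are quantiles -/

theorem measurable_bayesLoss (τ : ℝ) : Measurable (bayesLoss τ) := by
  unfold bayesLoss
  exact ((Measurable.ite measurableSet_Ioi measurable_const measurable_const).sub_const τ).mul
    measurable_id

theorem bayesLoss_nonneg {τ : ℝ} (h0 : 0 ≤ τ) (h1 : τ ≤ 1) (u : ℝ) : 0 ≤ bayesLoss τ u := by
  unfold bayesLoss
  split_ifs with h
  · exact mul_nonneg (by linarith) h.le
  · exact mul_nonneg_of_nonpos_of_nonpos (by linarith) (by linarith)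

/-- If `q` minimises the expected loss `q ↦ ∫ bayesLoss τ (a (q - r)) μ(dr)` and has finite loss,
then `μ` gives at most the proportion `τ` of its mass to `(-∞, q₀)` when `q₀ < q`. -/
theorem measure_Iio_le_of_minimiser {μ : Measure ℝ} {τ a q q₀ : ℝ} (hτ0 : 0 ≤ τ) (hτ1 : τ ≤ 1)
    (ha : 0 < a) (hfin : ∫⁻ r, ENNReal.ofReal (bayesLoss τ (a * (q - r))) ∂μ ≠ ∞)
    (hmin : ∫⁻ r, ENNReal.ofReal (bayesLoss τ (a * (q - r))) ∂μ ≤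
      ∫⁻ r, ENNReal.ofReal (bayesLoss τ (a * (q₀ - r))) ∂μ) (hq : q₀ < q) :
    μ (Iio q₀) ≤ ENNReal.ofReal τ * μ univ := by
  have hmeas : ∀ q' : ℝ, Measurable fun r => ENNReal.ofReal (bayesLoss τ (a * (q' - r))) :=
    fun q' => ((measurable_bayesLoss τ).comp (by fun_prop)).ennreal_ofReal
  have hc : 0 < a * (q - q₀) := mul_pos ha (sub_pos.2 hq)
  have key : ∫⁻ r, ENNReal.ofReal (bayesLoss τ (a * (q₀ - r))) ∂μ +
      ENNReal.ofReal (a * (q - q₀)) * μ (Iio q₀) ≤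
      ∫⁻ r, ENNReal.ofReal (bayesLoss τ (a * (q - r))) ∂μ +
        ENNReal.ofReal (τ * (a * (q - q₀))) * μ univ := by
    rw [← lintegral_indicator_const measurableSet_Iio, ← lintegral_add_left (hmeas q₀),
      ← lintegral_const, ← lintegral_add_left (hmeas q)]
    refine lintegral_mono fun r => ?_
    rw [← ENNReal.ofReal_add (bayesLoss_nonneg hτ0 hτ1 _) (by positivity)]
    by_cases hr : r < q₀
    · rw [indicator_of_mem (by exact hr), ← ENNReal.ofReal_add (bayesLoss_nonneg hτ0 hτ1 _) hc.le]
      refine ENNReal.ofReal_le_ofReal ?_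
      have h1 : 0 < a * (q₀ - r) := mul_pos ha (sub_pos.2 hr)
      have h2 : 0 < a * (q - r) := mul_pos ha (by linarith)
      simp only [bayesLoss, h1, h2, if_true]
      linarith
    · rw [indicator_of_notMem (by exact hr), add_zero]
      refine ENNReal.ofReal_le_ofReal ?_
      have h1 : ¬ 0 < a * (q₀ - r) := not_lt.2 (mul_nonpos_of_nonneg_of_nonpos ha.le (by linarith))
      simp only [bayesLoss, h1, if_false]
      split_ifs with h2 <;> linarith
  have key2 : ENNReal.ofReal (a * (q - q₀)) * μ (Iio q₀) ≤
      ENNReal.ofReal (τ * (a * (q - q₀))) * μ univ :=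
    (ENNReal.add_le_add_iff_left hfin).1 ((add_le_add_left hmin _).trans key)
  rw [mul_comm τ, ENNReal.ofReal_mul hc.le, mul_assoc] at key2
  exact (ENNReal.mul_le_mul_iff_right (ENNReal.ofReal_pos.2 hc).ne' ENNReal.ofReal_ne_top).1 key2

/-- If `q` minimises the expected loss `q ↦ ∫ bayesLoss τ (a (q - r)) μ(dr)` and has finite loss,
then `μ` gives at least the proportion `τ` of its mass to `(-∞, q₀)` when `q < q₀`. -/
theorem le_measure_Iio_of_minimiser {μ : Measure ℝ} {τ a q q₀ : ℝ} (hτ0 : 0 ≤ τ) (hτ1 : τ ≤ 1)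
    (ha : 0 < a) (hfin : ∫⁻ r, ENNReal.ofReal (bayesLoss τ (a * (q - r))) ∂μ ≠ ∞)
    (hmin : ∫⁻ r, ENNReal.ofReal (bayesLoss τ (a * (q - r))) ∂μ ≤
      ∫⁻ r, ENNReal.ofReal (bayesLoss τ (a * (q₀ - r))) ∂μ) (hq : q < q₀) :
    ENNReal.ofReal τ * μ univ ≤ μ (Iio q₀) := by
  have hmeas : ∀ q' : ℝ, Measurable fun r => ENNReal.ofReal (bayesLoss τ (a * (q' - r))) :=
    fun q' => ((measurable_bayesLoss τ).comp (by fun_prop)).ennreal_ofReal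
  have hc : 0 < a * (q₀ - q) := mul_pos ha (sub_pos.2 hq)
  have key : ∫⁻ r, ENNReal.ofReal (bayesLoss τ (a * (q₀ - r))) ∂μ +
      ENNReal.ofReal (τ * (a * (q₀ - q))) * μ univ ≤
      ∫⁻ r, ENNReal.ofReal (bayesLoss τ (a * (q - r))) ∂μ +
        ENNReal.ofReal (a * (q₀ - q)) * μ (Iio q₀) := by
    rw [← lintegral_indicator_const measurableSet_Iio, ← lintegral_add_left (hmeas q),
      ← lintegral_const, ← lintegral_add_left (hmeas q₀)]
    refine lintegral_mono fun r => ?_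
    rw [← ENNReal.ofReal_add (bayesLoss_nonneg hτ0 hτ1 _) (by positivity)]
    by_cases hr : r < q₀
    · rw [indicator_of_mem (by exact hr), ← ENNReal.ofReal_add (bayesLoss_nonneg hτ0 hτ1 _) hc.le]
      refine ENNReal.ofReal_le_ofReal ?_
      have h1 : 0 < a * (q₀ - r) := mul_pos ha (sub_pos.2 hr)
      simp only [bayesLoss, h1, if_true]
      split_ifs with h2 <;> linarith
    · rw [indicator_of_notMem (by exact hr), add_zero]
      refine ENNReal.ofReal_le_ofReal ?_
      have h1 : ¬ 0 < a * (q₀ - r) := not_lt.2 (mul_nonpos_of_nonneg_of_nonpos ha.le (by linarith))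
      have h2 : ¬ 0 < a * (q - r) := not_lt.2 (mul_nonpos_of_nonneg_of_nonpos ha.le (by linarith))
      simp only [bayesLoss, h1, h2, if_false]
      linarith
  have key2 : ENNReal.ofReal (τ * (a * (q₀ - q))) * μ univ ≤
      ENNReal.ofReal (a * (q₀ - q)) * μ (Iio q₀) :=
    (ENNReal.add_le_add_iff_left hfin).1 ((add_le_add_left hmin _).trans key)
  rw [mul_comm τ, ENNReal.ofReal_mul hc.le, mul_assoc] at key2
  exact (ENNReal.mul_le_mul_iff_right (ENNReal.ofReal_pos.2 hc).ne' ENNReal.ofReal_ne_top).1 key2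

/-- A global minimiser `q` of the expected loss is a `τ`-quantile: lower half. -/
theorem measure_Iio_minimiser_le {μ : Measure ℝ} {τ a q : ℝ} (hτ0 : 0 ≤ τ) (hτ1 : τ ≤ 1)
    (ha : 0 < a) (hfin : ∫⁻ r, ENNReal.ofReal (bayesLoss τ (a * (q - r))) ∂μ ≠ ∞)
    (hmin : ∀ q', ∫⁻ r, ENNReal.ofReal (bayesLoss τ (a * (q - r))) ∂μ ≤
      ∫⁻ r, ENNReal.ofReal (bayesLoss τ (a * (q' - r))) ∂μ) :
    μ (Iio q) ≤ ENNReal.ofReal τ * μ univ := by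
  obtain ⟨u, hu, hlt, hlim⟩ := exists_seq_strictMono_tendsto q
  have hU : Iio q = ⋃ n, Iio (u n) := by
    ext y
    simp only [mem_Iio, mem_iUnion]
    exact ⟨fun h => (hlim.eventually (lt_mem_nhds h)).exists, fun ⟨n, h⟩ => h.trans (hlt n)⟩
  rw [hU, (monotone_nat_of_le_succ fun n => Iio_subset_Iio (hu.monotone n.le_succ)).measure_iUnion]
  exact iSup_le fun n => measure_Iio_le_of_minimiser hτ0 hτ1 ha hfin (hmin _) (hlt n)

/-- A global minimiser `q` of the expected loss is a `τ`-quantile: upper half. -/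
theorem le_measure_Iic_minimiser {μ : Measure ℝ} [IsFiniteMeasure μ] {τ a q : ℝ} (hτ0 : 0 ≤ τ)
    (hτ1 : τ ≤ 1) (ha : 0 < a) (hfin : ∫⁻ r, ENNReal.ofReal (bayesLoss τ (a * (q - r))) ∂μ ≠ ∞)
    (hmin : ∀ q', ∫⁻ r, ENNReal.ofReal (bayesLoss τ (a * (q - r))) ∂μ ≤
      ∫⁻ r, ENNReal.ofReal (bayesLoss τ (a * (q' - r))) ∂μ) :
    ENNReal.ofReal τ * μ univ ≤ μ (Iic q) := by
  obtain ⟨u, hu, hlt, hlim⟩ := exists_seq_strictAnti_tendsto q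
  have hU : Iic q = ⋂ n, Iio (u n) := by
    ext y
    simp only [mem_Iic, mem_iInter, mem_Iio]
    exact ⟨fun h n => h.trans_lt (hlt n), fun h => ge_of_tendsto' hlim fun n => (h n).le⟩
  rw [hU, Antitone.measure_iInter (fun _ _ h => Iio_subset_Iio (hu.antitone h))
      (fun n => measurableSet_Iio.nullMeasurableSet) ⟨0, measure_ne_top _ _⟩]
  exact le_iInf fun n => le_measure_Iio_of_minimiser hτ0 hτ1 ha hfin (hmin _) (hlt n)

/-! ### Order statistics of an i.i.d. sample -/

/-- The number of the first `n` terms of `v` that are at most `u`. -/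
noncomputable def countLE (n : ℕ) (v : ℕ → ℝ) (u : ℝ) : ℕ := {i ∈ Finset.range n | v i ≤ u}.card

/-- The number of the first `n` terms of `v` that are smaller than `u`. -/
noncomputable def countLT (n : ℕ) (v : ℕ → ℝ) (u : ℝ) : ℕ := {i ∈ Finset.range n | v i < u}.card

/-- The `(j + 1)`-st smallest of the first `n` terms of `v`, with the value `0` for `n ≤ j`. -/
noncomputable def orderStat (n : ℕ) (v : ℕ → ℝ) (j : ℕ) : ℝ :=
  if h : j < n then v (Tuple.sort (fun i : Fin n => v i) ⟨j, h⟩) else 0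

/-- Properties of the sample can be counted along the sorted sample. -/
theorem card_filter_sort (n : ℕ) (v : ℕ → ℝ) (p : ℝ → Prop) [DecidablePred p] :
    (Finset.univ.filter fun i : Fin n =>
      p (((fun i : Fin n => v i) ∘ Tuple.sort fun i : Fin n => v i) i)).card =
      {i ∈ Finset.range n | p (v i)}.card := by
  refine Finset.card_bij (fun i _ => (Tuple.sort (fun i : Fin n => v i) i : ℕ)) ?_ ?_ ?_
  · intro i hi
    simpa using hi
  · intro i _ j _ h
    exact (Tuple.sort fun i : Fin n => v i).injective (Fin.ext h)
  · intro i hi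
    obtain ⟨h1, h2⟩ := Finset.mem_filter.1 hi
    refine ⟨(Tuple.sort fun i : Fin n => v i).symm ⟨i, Finset.mem_range.1 h1⟩, ?_, ?_⟩ <;> simp [h2]

theorem orderStat_le_iff {n : ℕ} {v : ℕ → ℝ} {j : ℕ} (hj : j < n) (u : ℝ) :
    orderStat n v j ≤ u ↔ j < countLE n v u := by
  have h := Tuple.lt_card_le_iff_apply_le_of_monotone (j := ⟨j, hj⟩) (a := u)
    (Tuple.monotone_sort fun i : Fin n => v i)
  have h2 := card_filter_sort n v (fun y => y ≤ u)
  rw [orderStat, dif_pos hj, countLE]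
  rw [← h2]
  exact h.symm

theorem lt_orderStat_iff {n : ℕ} {v : ℕ → ℝ} {j : ℕ} (hj : j < n) (u : ℝ) :
    u < orderStat n v j ↔ countLE n v u ≤ j := by
  rw [← not_le, orderStat_le_iff hj, not_lt]

theorem orderStat_lt_iff {n : ℕ} {v : ℕ → ℝ} {j : ℕ} (hj : j < n) (u : ℝ) :
    orderStat n v j < u ↔ j < countLT n v u := by
  have h := Tuple.lt_card_lt_iff_apply_lt_of_monotone (j := ⟨j, hj⟩) (a := u)
    (Tuple.monotone_sort fun i : Fin n => v i)
  have h2 := card_filter_sort n v (fun y => y < u)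
  rw [orderStat, dif_pos hj, countLT]
  rw [← h2]
  exact h.symm

theorem eq_orderStat {n : ℕ} {v : ℕ → ℝ} {j : ℕ} (hj : j < n) {u : ℝ}
    (h1 : countLT n v u ≤ j) (h2 : j < countLE n v u) : u = orderStat n v j :=
  le_antisymm (not_lt.1 fun h => absurd ((orderStat_lt_iff hj u).1 h) h1.not_gt)
    ((orderStat_le_iff hj u).2 h2)

theorem orderStat_mono {n : ℕ} {v : ℕ → ℝ} {i j : ℕ} (hij : i ≤ j) (hj : j < n) :
    orderStat n v i ≤ orderStat n v j := by
  rw [orderStat, orderStat, dif_pos hj, dif_pos (hij.trans_lt hj)]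
  exact Tuple.monotone_sort (fun i : Fin n => v i) (by exact hij)

/-- Order statistics commute with monotone transformations of the sample. -/
theorem orderStat_comp_monotone {n : ℕ} {v : ℕ → ℝ} {g : ℝ → ℝ} (hg : Monotone g) {j : ℕ}
    (hj : j < n) : orderStat n (fun i => g (v i)) j = g (orderStat n v j) := by
  refine (eq_orderStat hj ?_ ?_).symm
  · have h : countLT n v (orderStat n v j) ≤ j := not_lt.1 fun h =>
      lt_irrefl _ ((orderStat_lt_iff hj _).2 h)
    refine le_trans (Finset.card_le_card fun i hi => ?_) h
    simp only [Finset.mem_filter] at hi ⊢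
    exact ⟨hi.1, lt_of_not_ge fun h' => absurd hi.2 (hg h').not_gt⟩
  · have h : j < countLE n v (orderStat n v j) := (orderStat_le_iff hj _).1 le_rfl
    refine lt_of_lt_of_le h (Finset.card_le_card fun i hi => ?_)
    simp only [Finset.mem_filter] at hi ⊢
    exact ⟨hi.1, hg hi.2⟩

theorem measurable_countLE {Ω : Type*} [MeasurableSpace Ω] {V : ℕ → Ω → ℝ}
    (hV : ∀ i, Measurable (V i)) (n : ℕ) (u : ℝ) :
    Measurable fun ω => countLE n (fun i => V i ω) u := by
  have : (fun ω => countLE n (fun i => V i ω) u) =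
      fun ω => ∑ i ∈ Finset.range n, if V i ω ≤ u then 1 else 0 := by
    funext ω
    rw [countLE, Finset.card_filter]
  rw [this]
  exact Finset.measurable_sum _ fun i _ =>
    Measurable.ite (measurableSet_le (hV i) measurable_const) measurable_const measurable_const

theorem measurable_orderStat {Ω : Type*} [MeasurableSpace Ω] {V : ℕ → Ω → ℝ}
    (hV : ∀ i, Measurable (V i)) (n j : ℕ) :
    Measurable fun ω => orderStat n (fun i => V i ω) j := by
  by_cases hj : j < n
  · refine measurable_of_Iic fun u => ?_
    have : (fun ω => orderStat n (fun i => V i ω) j) ⁻¹' Iic u =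
        (fun ω => countLE n (fun i => V i ω) u) ⁻¹' Ioi j := by
      ext ω
      simp [orderStat_le_iff hj]
    rw [this]
    exact measurable_countLE hV n u measurableSet_Ioi
  · simp only [orderStat, dif_neg hj]
    exact measurable_const

/-- For disjoint sets `I₁, …, I_ℓ, J`, the probability that an i.i.d. sample of size `n` has exactly
one point in each `I_j` and its other points in `J`. -/
theorem measure_exists_embedding {Ω : Type*} [MeasurableSpace Ω] {P : Measure Ω}
    {n ℓ : ℕ} {V : Fin n → Ω → ℝ} (hV : ∀ i, Measurable (V i))
    (hind : ProbabilityTheory.iIndepFun V P) {μ : Measure ℝ} (hlaw : ∀ i, P.map (V i) = μ)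
    {I : Fin ℓ → Set ℝ} (hI : ∀ j, MeasurableSet (I j)) {J : Set ℝ} (hJ : MeasurableSet J)
    (hdisj : Pairwise fun i j => Disjoint (I i) (I j)) (hIJ : ∀ j, Disjoint (I j) J) :
    P {ω | ∃ σ : Fin ℓ ↪ Fin n, (∀ j, V (σ j) ω ∈ I j) ∧ ∀ i, i ∉ Set.range σ → V i ω ∈ J} =
      n.descFactorial ℓ * ((∏ j, μ (I j)) * μ J ^ (n - ℓ)) := by
  classical
  set A : (Fin ℓ ↪ Fin n) → Set Ω := fun σ =>
    {ω | (∀ j, V (σ j) ω ∈ I j) ∧ ∀ i, i ∉ Set.range σ → V i ω ∈ J} with hA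
  set S : (Fin ℓ ↪ Fin n) → Fin n → Set ℝ := fun σ i =>
    {y | (∀ j, σ j = i → y ∈ I j) ∧ (i ∉ Set.range σ → y ∈ J)} with hS
  have hSrange : ∀ (σ : Fin ℓ ↪ Fin n) (j), S σ (σ j) = I j := by
    intro σ j
    ext y
    simp [hS]
  have hScompl : ∀ (σ : Fin ℓ ↪ Fin n) (i), i ∉ Set.range σ → S σ i = J := by
    intro σ i hi
    ext y
    refine ⟨fun h => h.2 hi, fun h => ⟨fun j hj => absurd ⟨j, hj⟩ hi, fun _ => h⟩⟩
  have hSmeas : ∀ σ i, MeasurableSet (S σ i) := by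
    intro σ i
    by_cases hi : i ∈ Set.range σ
    · obtain ⟨j, rfl⟩ := hi
      rw [hSrange]; exact hI j
    · rw [hScompl σ i hi]; exact hJ
  have hAS : ∀ σ, A σ = ⋂ i ∈ (Finset.univ : Finset (Fin n)), V i ⁻¹' S σ i := by
    intro σ
    ext ω
    simp only [hA, hS, mem_ofPred_eq, Finset.mem_univ, iInter_true, mem_iInter, mem_preimage]
    refine ⟨fun h i => ⟨fun j hj => hj ▸ h.1 j, h.2 i⟩, fun h => ⟨fun j => (h (σ j)).1 j rfl,
      fun i => (h i).2⟩⟩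
  have hPA : ∀ σ, P (A σ) = (∏ j, μ (I j)) * μ J ^ (n - ℓ) := by
    intro σ
    rw [hAS, hind.measure_inter_preimage_eq_mul Finset.univ fun i _ => hSmeas σ i]
    have h1 : ∀ i, P (V i ⁻¹' S σ i) = μ (S σ i) := fun i => by
      rw [← hlaw i, Measure.map_apply (hV i) (hSmeas σ i)]
    simp_rw [h1]
    rw [← Finset.prod_mul_prod_compl (Finset.univ.map σ), Finset.prod_map]
    congr 1
    · exact Finset.prod_congr rfl fun j _ => by rw [hSrange]
    · rw [Finset.prod_congr rfl fun i hi => by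
        rw [hScompl σ i (by simpa using hi)], Finset.prod_const, Finset.card_compl,
        Finset.card_map]
      simp
  have hset : {ω | ∃ σ : Fin ℓ ↪ Fin n, (∀ j, V (σ j) ω ∈ I j) ∧
      ∀ i, i ∉ Set.range σ → V i ω ∈ J} = ⋃ σ, A σ := by
    ext ω; simp [hA]
  have hdis : Pairwise (Function.onFun Disjoint A) := by
    intro σ σ' hne
    refine Set.disjoint_left.2 fun ω h h' => hne ?_
    ext1 j
    by_cases hj : σ j ∈ Set.range σ'
    · obtain ⟨j', hj'⟩ := hj
      by_cases hjj : j' = j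
      · rw [← hj', hjj]
      · refine absurd (h.1 j) (Set.disjoint_left.1 (hdisj hjj) ?_)
        rw [← hj']; exact h'.1 j'
    · exact absurd (h'.2 _ hj) (Set.disjoint_left.1 (hIJ j) (h.1 j))
  rw [hset, measure_iUnion hdis fun σ => by
    rw [hAS]; exact Finset.measurableSet_biInter _ fun i _ => hV i (hSmeas σ i)]
  simp_rw [hPA]
  rw [tsum_fintype, Finset.sum_const, Finset.card_univ, Fintype.card_embedding_eq]
  simp

/-! ### Order statistics of a triangular array -/

/-- A sample has its `ℓ` smallest points in the ordered disjoint intervals `(c_j, d_j]` and its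
other points beyond `u` if and only if some injection selects one point from each interval and
leaves all others beyond `u`. -/
theorem orderStat_mem_Ioc_iff {n ℓ : ℕ} (hn : ℓ < n) {v : ℕ → ℝ} {c d : Fin ℓ → ℝ} {u : ℝ}
    (hcd : ∀ j, c j < d j) (hsep : ∀ i j, i < j → d i ≤ c j) (hu : ∀ j, d j ≤ u) :
    ((∀ j : Fin ℓ, orderStat n v j ∈ Ioc (c j) (d j)) ∧ u < orderStat n v ℓ) ↔
      ∃ σ : Fin ℓ ↪ Fin n, (∀ j, v (σ j) ∈ Ioc (c j) (d j)) ∧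
        ∀ i, i ∉ Set.range σ → v i ∈ Ioi u := by
  set s := Tuple.sort fun i : Fin n => v i with hs
  have hos : ∀ j (hj : j < n), orderStat n v j = v (s ⟨j, hj⟩) := fun j hj => by
    rw [orderStat, dif_pos hj]
  constructor
  · rintro ⟨h1, h2⟩
    refine ⟨⟨fun j => s ⟨j, j.2.trans hn⟩, fun i j h => ?_⟩, fun j => ?_, fun i hi => ?_⟩
    · have := s.injective h
      simpa [Fin.ext_iff] using this
    · have := h1 j
      rwa [hos j (j.2.trans hn)] at this
    · have h3 : ℓ ≤ (s.symm i : ℕ) := by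
        by_contra hlt
        exact hi ⟨⟨s.symm i, not_le.1 hlt⟩, s.apply_symm_apply i⟩
      refine h2.trans_le ((orderStat_mono h3 (s.symm i).2).trans_eq ?_)
      rw [hos _ (s.symm i).2]
      simp
  · rintro ⟨σ, h1, h2⟩
    have hcmono : ∀ i j : Fin ℓ, i ≤ j → c i ≤ c j := by
      intro i j hij
      rcases hij.eq_or_lt with rfl | h
      · exact le_rfl
      · exact (hcd i).le.trans (hsep i j h)
    have hdmono : ∀ i j : Fin ℓ, i ≤ j → d i ≤ d j := by
      intro i j hij
      rcases hij.eq_or_lt with rfl | h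
      · exact le_rfl
      · exact (hsep i j h).trans (hcd j).le
    have hupper : ∀ (k : ℕ) (y : ℝ), y ≤ u → (∀ j : Fin ℓ, k ≤ j → y ≤ c j) →
        countLE n v y ≤ k := by
      intro k y hy hk
      have hsub : {i ∈ Finset.range n | v i ≤ y} ⊆
          (Finset.univ.filter fun j : Fin ℓ => (j : ℕ) < k).image fun j => (σ j : ℕ) := by
        intro i hi
        obtain ⟨hin, hiy⟩ := Finset.mem_filter.1 hi
        rw [Finset.mem_range] at hin
        by_cases hr : (⟨i, hin⟩ : Fin n) ∈ Set.range σ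
        · obtain ⟨j, hj⟩ := hr
          refine Finset.mem_image.2 ⟨j, Finset.mem_filter.2 ⟨Finset.mem_univ _, ?_⟩, by rw [hj]⟩
          by_contra hjk
          have h3 := (h1 j).1
          rw [hj] at h3
          exact absurd (hiy.trans (hk j (not_lt.1 hjk))) h3.not_ge
        · exact absurd (hiy.trans hy) (not_le.2 (h2 _ hr))
      refine (Finset.card_le_card hsub).trans (Finset.card_image_le.trans ?_)
      have : ((Finset.univ.filter fun j : Fin ℓ => (j : ℕ) < k).map Fin.valEmbedding) ⊆
          Finset.range k := by
        intro j hj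
        obtain ⟨j', hj', rfl⟩ := Finset.mem_map.1 hj
        simpa using hj'
      simpa using Finset.card_le_card this
    refine ⟨fun j => ⟨?_, ?_⟩, ?_⟩
    · rw [lt_orderStat_iff (j.2.trans hn)]
      exact hupper j _ ((hcd j).le.trans (hu j)) fun j' hj' => hcmono _ _ hj'
    · rw [orderStat_le_iff (j.2.trans hn)]
      have hsub : (Finset.Iic j).image (fun j => (σ j : ℕ)) ⊆
          {i ∈ Finset.range n | v i ≤ d j} := by
        intro i hi
        obtain ⟨j', hj', rfl⟩ := Finset.mem_image.1 hi
        rw [Finset.mem_Iic] at hj'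
        refine Finset.mem_filter.2 ⟨Finset.mem_range.2 (σ j').2, (h1 j').2.trans (hdmono _ _ hj')⟩
      have := Finset.card_le_card hsub
      rw [Finset.card_image_of_injective _ (fun a b h => σ.injective (Fin.ext h)),
        Fin.card_Iic] at this
      exact this
    · rw [lt_orderStat_iff hn]
      exact hupper ℓ u le_rfl fun j hj => absurd j.2 hj.not_gt

/-- Limit of the probability that the `ℓ` smallest points of row `n` of a triangular array lie in
given ordered intervals and all other points beyond `u`. -/
theorem tendsto_measure_orderStat {Ω : Type*} [MeasurableSpace Ω] {P : Measure Ω}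
    {V : ℕ → ℕ → Ω → ℝ} (hV : ∀ n i, Measurable (V n i))
    (hind : ∀ n, ProbabilityTheory.iIndepFun (V n) P) {ν : ℕ → Measure ℝ}
    [∀ n, IsProbabilityMeasure (ν n)] (hlaw : ∀ n i, P.map (V n i) = ν n)
    (hlim : ∀ γ : ℝ, 0 < γ → Tendsto (fun n : ℕ => (n : ℝ) * (ν n).real (Iic γ)) atTop (𝓝 γ))
    {ℓ : ℕ} {c d : Fin ℓ → ℝ} {u : ℝ} (hc : ∀ j, 0 < c j) (hu0 : 0 < u)
    (hcd : ∀ j, c j < d j) (hsep : ∀ i j, i < j → d i ≤ c j) (hu : ∀ j, d j ≤ u) :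
    Tendsto (fun n => P.real {ω | (∀ j : Fin ℓ,
      orderStat n (fun i => V n i ω) j ∈ Ioc (c j) (d j)) ∧ u < orderStat n (fun i => V n i ω) ℓ})
      atTop (𝓝 ((∏ j, (d j - c j)) * Real.exp (-u))) := by
  have hval : ∀ n, ℓ < n → P.real {ω | (∀ j : Fin ℓ,
      orderStat n (fun i => V n i ω) j ∈ Ioc (c j) (d j)) ∧ u < orderStat n (fun i => V n i ω) ℓ} =
      n.descFactorial ℓ * ((∏ j, (ν n).real (Ioc (c j) (d j))) * (ν n).real (Ioi u) ^ (n - ℓ)) := by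
    intro n hn
    have hdisj : ∀ i j : Fin ℓ, i < j → Disjoint (Ioc (c i) (d i)) (Ioc (c j) (d j)) :=
      fun i j h => Set.disjoint_left.2 fun y hy hy' =>
        absurd (hy.2.trans (hsep i j h)) hy'.1.not_ge
    have h := measure_exists_embedding (P := P) (V := fun i : Fin n => V n i) (fun i => hV n i)
      ((hind n).precomp Fin.val_injective) (μ := ν n) (fun i => hlaw n i)
      (I := fun j => Ioc (c j) (d j)) (fun j => measurableSet_Ioc) (J := Ioi u) measurableSet_Ioi
      (fun i j hij => (lt_or_gt_of_ne hij).elim (hdisj i j) fun h => (hdisj j i h).symm)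
      (fun j => Set.disjoint_left.2 fun y hy hy' => absurd (hy.2.trans (hu j)) (not_le.2 hy'))
    simp_rw [orderStat_mem_Ioc_iff hn hcd hsep hu]
    rw [measureReal_def, h]
    simp [measureReal_def, ENNReal.toReal_prod]
  set p : ℕ → ℝ := fun n => (ν n).real (Iic u) with hp
  have hpoi := ProbabilityTheory.tendsto_choose_mul_pow_of_tendsto_mul_atTop (p := p) ℓ
    (hlim u hu0)
  have hprod : Tendsto (fun n : ℕ => ∏ j, ((n * (ν n).real (Ioc (c j) (d j))) / (n * p n))) atTop
      (𝓝 (∏ j, ((d j - c j) / u))) := by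
    refine tendsto_finsetProd _ fun j _ => Tendsto.div ?_ (hlim u hu0) hu0.ne'
    have h1 := (hlim (d j) ((hc j).trans (hcd j))).sub (hlim (c j) (hc j))
    refine h1.congr fun n => ?_
    rw [← mul_sub, ← Iic_sdiff_Iic, measureReal_sdiff (Iic_subset_Iic.2 (hcd j).le)
      measurableSet_Iic]
  have hmul := (hpoi.mul hprod).const_mul (ℓ.factorial : ℝ)
  have hlimval : (ℓ.factorial : ℝ) * (Real.exp (-u) * u ^ ℓ / ℓ.factorial *
      ∏ j, ((d j - c j) / u)) = (∏ j, (d j - c j)) * Real.exp (-u) := by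
    rw [Finset.prod_div_distrib, Finset.prod_const, Finset.card_univ, Fintype.card_fin]
    have h1 : (ℓ.factorial : ℝ) ≠ 0 := by exact_mod_cast ℓ.factorial_ne_zero
    field_simp
  rw [hlimval] at hmul
  refine hmul.congr' ?_
  filter_upwards [eventually_gt_atTop ℓ, (hlim u hu0).eventually (lt_mem_nhds hu0)] with n hn hnp
  rw [hval n hn]
  have hn0 : (0 : ℝ) < n := by exact_mod_cast (Nat.zero_le ℓ).trans_lt hn
  have hp0 : 0 < p n := pos_of_mul_pos_right hnp hn0.le
  have hcompl : (ν n).real (Ioi u) = 1 - p n := by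
    rw [← compl_Iic, probReal_compl_eq_one_sub measurableSet_Iic]
  rw [hcompl, Nat.descFactorial_eq_factorial_mul_choose]
  have hq : ∏ j, ((n * (ν n).real (Ioc (c j) (d j))) / (n * p n)) =
      (∏ j, (ν n).real (Ioc (c j) (d j))) / p n ^ ℓ := by
    rw [Finset.prod_congr rfl fun j _ => mul_div_mul_left _ _ hn0.ne', Finset.prod_div_distrib,
      Finset.prod_const, Finset.card_univ, Fintype.card_fin]
  rw [hq]
  push_cast
  field_simp

/-- Convergence along a π-system implies weak convergence, if the π-system contains arbitrarily
small neighbourhoods of the points of a set that carries the limit measure. -/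
theorem tendsto_of_piSystem_of_carrier {E : Type*} [MeasurableSpace E] [TopologicalSpace E]
    [SecondCountableTopology E] [OpensMeasurableSpace E] {S : Set (Set E)} (hS : IsPiSystem S)
    (hmeas : ∀ s ∈ S, MeasurableSet s) {μ : ℕ → ProbabilityMeasure E} {ν : ProbabilityMeasure E}
    {C : Set E} (hC : (ν : Measure E) Cᶜ = 0)
    (hnhds : ∀ u : Set E, IsOpen u → ∀ x ∈ u ∩ C, ∃ s ∈ S, s ∈ 𝓝 x ∧ s ⊆ u)
    (hlim : ∀ s ∈ S, Tendsto (fun i => μ i s) atTop (𝓝 (ν s))) :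
    Tendsto μ atTop (𝓝 ν) := by
  refine tendsto_of_forall_isOpen_le_liminf fun G hG => ?_
  refine (le_liminf_iff (isCoboundedUnder_ge_of_le (x := 1) atTop (by simp))
    (by isBoundedDefault)).2 fun r hr => ?_
  have hex : ∀ x : ↥(G ∩ C), ∃ s ∈ S, s ∈ 𝓝 (x : E) ∧ s ⊆ G := fun x => hnhds G hG x x.2
  choose s hsS hsnhds hsG using hex
  obtain ⟨T, hTc, hT⟩ := TopologicalSpace.isOpen_iUnion_countable (fun i => interior (s i))
    fun i => isOpen_interior
  have hcov : G ∩ C ⊆ ⋃ i ∈ T, s i := by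
    intro y hy
    have : y ∈ ⋃ i, interior (s i) := mem_iUnion.2
      ⟨⟨y, hy⟩, mem_interior_iff_mem_nhds.2 (hsnhds ⟨y, hy⟩)⟩
    rw [← hT] at this
    exact iUnion₂_mono (fun i _ => interior_subset) this
  have hle : ν G ≤ ν (⋃ i ∈ T, s i) := by
    rw [← ENNReal.coe_le_coe, ProbabilityMeasure.ennreal_coeFn_eq_coeFn_toMeasure,
      ProbabilityMeasure.ennreal_coeFn_eq_coeFn_toMeasure,
      ← measure_inter_conull (s := G) (t := C) hC]
    exact measure_mono hcov
  have hTne : T.Nonempty := by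
    by_contra h
    rw [not_nonempty_iff_eq_empty] at h
    have hr' := hr.trans_le hle
    simp [h] at hr'
  obtain ⟨f, hf⟩ := hTc.exists_eq_range hTne
  have hU : ⋃ i ∈ T, s i = ⋃ n, s (f n) := by rw [hf, biUnion_range]
  rw [hU] at hle
  have hacc : Tendsto (fun i => ν (accumulate (fun n => s (f n)) i)) atTop
      (𝓝 (ν (⋃ n, s (f n)))) :=
    (ENNReal.tendsto_toNNReal_iff (by simp) (by simp)).2 tendsto_measure_iUnion_accumulate
  obtain ⟨n, hn⟩ := ((tendsto_order.1 hacc).1 r (hr.trans_le hle)).exists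
  classical
  set t : Finset (Set E) := (Finset.range (n + 1)).image fun k => s (f k) with ht
  have htS : ∀ a ∈ t, a ∈ S := fun a ha => by
    obtain ⟨k, -, rfl⟩ := Finset.mem_image.1 ha
    exact hsS _
  have hlim' := hS.tendsto_probabilityMeasure_biUnion htS hmeas hlim
  have heq : ⋃ a ∈ t, a = accumulate (fun n => s (f n)) n := by
    ext y
    simp [ht, accumulate_def]
  rw [heq] at hlim'
  filter_upwards [(tendsto_order.1 hlim').1 r hn] with i hi
  refine hi.trans_le (ProbabilityMeasure.apply_mono _ ?_)
  intro y hy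
  simp only [accumulate_def, mem_iUnion] at hy
  obtain ⟨k, -, hk⟩ := hy
  exact hsG _ hk

/-- The `ℓ + 1` smallest points of row `n` of a triangular array with `n P(V_{n,0} ≤ γ) → γ` converge
in distribution to any random vector with strictly increasing positive coordinates whose law on
ordered boxes is that of the first points of a unit rate Poisson process. -/
theorem tendstoInDistribution_orderStat {Ω : Type*} [MeasurableSpace Ω] {P : Measure Ω}
    [IsProbabilityMeasure P]
    {V : ℕ → ℕ → Ω → ℝ} (hV : ∀ n i, Measurable (V n i))
    (hind : ∀ n, ProbabilityTheory.iIndepFun (V n) P) {ν : ℕ → Measure ℝ}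
    [∀ n, IsProbabilityMeasure (ν n)] (hlaw : ∀ n i, P.map (V n i) = ν n)
    (hlim : ∀ γ : ℝ, 0 < γ → Tendsto (fun n : ℕ => (n : ℝ) * (ν n).real (Iic γ)) atTop (𝓝 γ))
    {ℓ : ℕ} {Ω' : Type*} [MeasurableSpace Ω'] {P' : Measure Ω'} [IsProbabilityMeasure P']
    {Γ : Ω' → Fin (ℓ + 1) → ℝ} (hΓ : Measurable Γ)
    (hcone : ∀ᵐ ω ∂P', (∀ j, 0 < Γ ω j) ∧ StrictMono (Γ ω))
    (hbox : ∀ c d : Fin (ℓ + 1) → ℝ, (∀ j, 0 < c j) → (∀ j, c j < d j) →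
      (∀ i j, i < j → d i ≤ c j) → P'.real {ω | ∀ j, Γ ω j ∈ Ioc (c j) (d j)} =
        (∏ j : Fin ℓ, (d j.castSucc - c j.castSucc)) *
          (Real.exp (-c (Fin.last ℓ)) - Real.exp (-d (Fin.last ℓ)))) :
    TendstoInDistribution (fun n ω (j : Fin (ℓ + 1)) => orderStat n (fun i => V n i ω) j) atTop Γ
      (fun _ => P) P' := by
  have hO : ∀ n, Measurable fun ω (j : Fin (ℓ + 1)) => orderStat n (fun i => V n i ω) j :=
    fun n => measurable_pi_lambda _ fun j => measurable_orderStat (hV n) n j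
  refine ⟨fun n => (hO n).aemeasurable, hΓ.aemeasurable, ?_⟩
  set S : Set (Set (Fin (ℓ + 1) → ℝ)) := {s | ∃ c d : Fin (ℓ + 1) → ℝ, (∀ j, 0 < c j) ∧
    (∀ j, c j < d j) ∧ (∀ i j, i < j → d i ≤ c j) ∧ s = {x | ∀ j, x j ∈ Ioc (c j) (d j)}} with hS
  have hSmeas : ∀ s ∈ S, MeasurableSet s := by
    rintro s ⟨c, d, -, -, -, rfl⟩
    rw [ofPred_forall]
    exact MeasurableSet.iInter fun j => measurable_pi_apply j measurableSet_Ioc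
  refine tendsto_of_piSystem_of_carrier (S := S) (C := {x | (∀ j, 0 < x j) ∧ StrictMono x}) ?_
    hSmeas ?_ ?_ ?_
  · rintro s ⟨c, d, hc, hcd, hsep, rfl⟩ t ⟨c', d', hc', hcd', hsep', rfl⟩ ⟨x, hx, hx'⟩
    refine ⟨fun j => max (c j) (c' j), fun j => min (d j) (d' j), fun j => lt_max_of_lt_left (hc j),
      fun j => ?_, fun i j hij => ?_, ?_⟩
    · exact (max_lt (hx j).1 (hx' j).1).trans_le (le_min (hx j).2 (hx' j).2)
    · exact (min_le_left _ _).trans ((hsep i j hij).trans (le_max_left _ _))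
    · ext y
      simp only [mem_inter_iff, mem_ofPred_eq, mem_Ioc, max_lt_iff, le_min_iff]
      exact ⟨fun h j => ⟨⟨(h.1 j).1, (h.2 j).1⟩, (h.1 j).2, (h.2 j).2⟩,
        fun h => ⟨fun j => ⟨(h j).1.1, (h j).2.1⟩, fun j => ⟨(h j).1.2, (h j).2.2⟩⟩⟩
  · refine (ae_map_iff hΓ.aemeasurable ?_).2 hcone
    have h1 : MeasurableSet {x : Fin (ℓ + 1) → ℝ | ∀ j, 0 < x j} := by
      rw [ofPred_forall]
      exact MeasurableSet.iInter fun j => measurableSet_lt measurable_const (measurable_pi_apply j)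
    have h2 : MeasurableSet {x : Fin (ℓ + 1) → ℝ | ∀ i j, i < j → x i < x j} := by
      simp_rw [ofPred_forall]
      exact MeasurableSet.iInter fun i => MeasurableSet.iInter fun j => MeasurableSet.iInter fun _ =>
        measurableSet_lt (measurable_pi_apply i) (measurable_pi_apply j)
    exact h1.inter h2
  · rintro u hu x ⟨hxu, hx0, hxm⟩
    obtain ⟨ε, hε, hball⟩ := Metric.isOpen_iff.1 hu x hxu
    have hev : ∀ᶠ δ : ℝ in 𝓝[>] 0, 0 < δ ∧ δ < ε ∧ (∀ j, δ < x j) ∧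
        ∀ i j, i < j → 2 * δ < x j - x i := by
      have hsmall : ∀ y : ℝ, 0 < y → ∀ᶠ δ : ℝ in 𝓝[>] 0, δ < y := fun y hy =>
        nhdsWithin_le_nhds (gt_mem_nhds hy)
      refine (eventually_mem_nhdsWithin).and ((hsmall ε hε).and ((eventually_all.2 fun j =>
        hsmall _ (hx0 j)).and (eventually_all.2 fun i => eventually_all.2 fun j => ?_)))
      by_cases hij : i < j
      · filter_upwards [hsmall ((x j - x i) / 2) (by linarith [hxm hij])] with δ hδ _
        linarith
      · exact Eventually.of_forall fun δ h => absurd h hij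
    obtain ⟨δ, hδ0, hδε, hδx, hδg⟩ := hev.exists
    refine ⟨{y | ∀ j, y j ∈ Ioc (x j - δ) (x j + δ)}, ⟨fun j => x j - δ, fun j => x j + δ,
      fun j => sub_pos.2 (hδx j), fun j => by linarith, fun i j hij => ?_, rfl⟩, ?_, ?_⟩
    · linarith [hδg i j hij]
    · refine mem_of_superset (Metric.ball_mem_nhds x hδ0) fun y hy j => ?_
      have := (dist_le_pi_dist y x j).trans_lt hy
      rw [Real.dist_eq, abs_lt] at this
      exact ⟨by linarith, by linarith⟩
    · intro y hy
      refine hball ?_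
      rw [Metric.mem_ball]
      refine lt_of_le_of_lt ((dist_pi_le_iff hδ0.le).2 fun j => ?_) hδε
      rw [Real.dist_eq, abs_le]
      exact ⟨by linarith [(hy j).1], by linarith [(hy j).2]⟩
  · rintro s ⟨c, d, hc, hcd, hsep, rfl⟩
    have hs := hSmeas _ ⟨c, d, hc, hcd, hsep, rfl⟩
    rw [← NNReal.tendsto_coe]
    change Tendsto (fun n => (P.map fun ω (j : Fin (ℓ + 1)) =>
      orderStat n (fun i => V n i ω) j).real _) atTop (𝓝 ((P'.map Γ).real _))
    rw [map_measureReal_apply hΓ hs]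
    simp_rw [map_measureReal_apply (hO _) hs]
    change Tendsto (fun n => P.real {ω | ∀ j : Fin (ℓ + 1),
      orderStat n (fun i => V n i ω) j ∈ Ioc (c j) (d j)}) atTop
      (𝓝 (P'.real {ω | ∀ j, Γ ω j ∈ Ioc (c j) (d j)}))
    rw [hbox c d hc hcd hsep, mul_sub]
    have hlt : ∀ i : Fin ℓ, d i.castSucc ≤ c (Fin.last ℓ) := fun i =>
      hsep _ _ (Fin.castSucc_lt_last i)
    have key : ∀ u : ℝ, c (Fin.last ℓ) ≤ u → Tendsto (fun n => P.real {ω | (∀ j : Fin ℓ,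
        orderStat n (fun i => V n i ω) j ∈ Ioc (c j.castSucc) (d j.castSucc)) ∧
          u < orderStat n (fun i => V n i ω) ℓ}) atTop
        (𝓝 ((∏ j : Fin ℓ, (d j.castSucc - c j.castSucc)) * Real.exp (-u))) := fun u hu =>
      tendsto_measure_orderStat hV hind hlaw hlim (fun j => hc _) ((hc _).trans_le hu)
        (fun j => hcd _) (fun i j hij => hsep _ _ (Fin.castSucc_lt_castSucc_iff.2 hij))
        fun j => (hlt j).trans hu
    refine ((key _ le_rfl).sub (key _ (hcd _).le)).congr fun n => ?_
    rw [← measureReal_sdiff]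
    · congr 1
      ext ω
      simp only [Set.mem_sdiff, mem_ofPred_eq, not_and, not_lt, mem_Ioc]
      constructor
      · rintro ⟨⟨h1, h2⟩, h3⟩ j
        rcases Fin.eq_castSucc_or_eq_last j with ⟨i, rfl⟩ | rfl
        · exact h1 i
        · exact ⟨h2, h3 h1⟩
      · intro h
        exact ⟨⟨fun j => h j.castSucc, (h (Fin.last ℓ)).1⟩, fun _ => (h (Fin.last ℓ)).2⟩
    · exact fun ω h => ⟨h.1, (hcd _).trans h.2⟩
    · refine MeasurableSet.inter (s₁ := {ω | ∀ j : Fin ℓ, _}) ?_ ?_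
      · rw [ofPred_forall]
        exact MeasurableSet.iInter fun j => measurable_orderStat (hV n) n j measurableSet_Ioc
      · exact measurable_orderStat (hV n) n ℓ measurableSet_Ioi

/-! ### Partial sums of exponential variables -/

theorem lintegral_pi_prod : ∀ {n : ℕ} (μ : Fin n → Measure ℝ) [∀ i, SigmaFinite (μ i)]
    {g : Fin n → ℝ → ℝ≥0∞} (_ : ∀ i, Measurable (g i)),
    ∫⁻ x, ∏ i, g i (x i) ∂Measure.pi μ = ∏ i, ∫⁻ y, g i y ∂μ i
  | 0, μ, _, g, _ => by simp
  | n + 1, μ, _, g, hg => by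
    have h := measurePreserving_piFinSuccAbove μ 0
    have h2 := h.symm.lintegral_comp (f := fun x => ∏ i, g i (x i))
      (Finset.measurable_prod _ fun i _ => (hg i).comp (measurable_pi_apply i))
    have ih := lintegral_pi_prod (fun j : Fin n => μ j.succ) (g := fun j : Fin n => g j.succ)
      fun j : Fin n => hg j.succ
    rw [← h2, Fin.prod_univ_succ, ← ih]
    have h3 : ∀ a : ℝ × (Fin n → ℝ), ∏ i, g i ((MeasurableEquiv.piFinSuccAbove (fun _ => ℝ) 0).symm
        a i) = g 0 a.1 * ∏ i : Fin n, g i.succ (a.2 i) := by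
      intro a
      rw [Fin.prod_univ_succ]
      rfl
    simp_rw [h3]
    exact lintegral_prod_mul (hg 0).aemeasurable (Finset.measurable_prod _ fun i _ =>
      (hg (Fin.succ i)).comp (measurable_pi_apply i)).aemeasurable

/-- A product of measures with densities has the product of the densities as density. -/
theorem pi_withDensity {n : ℕ} {g : Fin n → ℝ → ℝ≥0∞} (hg : ∀ i, Measurable (g i))
    [∀ i, SigmaFinite ((volume : Measure ℝ).withDensity (g i))] :
    Measure.pi (fun i => (volume : Measure ℝ).withDensity (g i)) =
      (volume : Measure (Fin n → ℝ)).withDensity fun x => ∏ i, g i (x i) := by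
  refine Measure.pi_eq fun s hs => ?_
  rw [withDensity_apply _ (MeasurableSet.univ_pi hs), ← lintegral_indicator (MeasurableSet.univ_pi hs)]
  have h : (univ.pi s).indicator (fun x : Fin n → ℝ => ∏ i, g i (x i)) =
      fun x => ∏ i, (s i).indicator (g i) (x i) := by
    funext x
    by_cases hx : x ∈ univ.pi s
    · rw [indicator_of_mem hx]
      exact Finset.prod_congr rfl fun i _ => (indicator_of_mem (hx i (mem_univ i)) _).symm
    · rw [indicator_of_notMem hx]
      simp only [mem_univ_pi, not_forall] at hx
      obtain ⟨i, hi⟩ := hx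
      exact (Finset.prod_eq_zero (Finset.mem_univ i) (indicator_of_notMem hi _)).symm
  rw [h, volume_pi, lintegral_pi_prod _ fun i => (hg i).indicator (hs i)]
  refine Finset.prod_congr rfl fun i _ => ?_
  rw [withDensity_apply _ (hs i), lintegral_indicator (hs i)]

theorem measurable_exponentialPDF (r : ℝ) :
    Measurable (ProbabilityTheory.exponentialPDF r) :=
  (ProbabilityTheory.measurable_exponentialPDFReal r).ennreal_ofReal

theorem expMeasure_eq_withDensity (r : ℝ) : ProbabilityTheory.expMeasure r =
    volume.withDensity (ProbabilityTheory.exponentialPDF r) := rfl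

theorem ae_expMeasure_pos (r : ℝ) : ∀ᵐ y ∂ProbabilityTheory.expMeasure r, 0 < y := by
  rw [ae_iff, expMeasure_eq_withDensity]
  have : {a : ℝ | ¬ 0 < a} = Iic 0 := by ext; simp
  rw [this, withDensity_apply _ measurableSet_Iic, setLIntegral_congr Iio_ae_eq_Iic.symm]
  exact ProbabilityTheory.lintegral_exponentialPDF_of_nonpos le_rfl

/-- The `ℓ + 1` first partial sums of a sequence. -/
def partialSums (ℓ : ℕ) (e : ℕ → ℝ) (j : Fin (ℓ + 1)) : ℝ := ∑ i ∈ Finset.range (j + 1), e i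

/-- The joint density `exp (-γ_ℓ)` of the first `ℓ + 1` points of a unit rate Poisson process, on
the cone `0 ≤ γ₀ ≤ γ₁ ≤ … ≤ γ_ℓ`. -/
noncomputable def gammaDensity (ℓ : ℕ) : (Fin (ℓ + 1) → ℝ) → ℝ≥0∞ :=
  {γ | 0 ≤ γ 0 ∧ Monotone γ}.indicator fun γ => ENNReal.ofReal (Real.exp (-γ (Fin.last ℓ)))

theorem map_cum_volume (ℓ : ℕ) : (volume : Measure (Fin (ℓ + 1) → ℝ)).map
    (fun e => partialSums ℓ fun i => e (Fin.ofNat (ℓ + 1) i)) = volume := by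
  set M : Matrix (Fin (ℓ + 1)) (Fin (ℓ + 1)) ℝ := fun i j => if j ≤ i then 1 else 0 with hM
  have hdet : M.det = 1 := by
    rw [Matrix.det_of_isLowerTriangular]
    · simp [hM]
    · intro i j hij
      exact if_neg (not_le.2 hij)
  have h := Real.map_matrix_volume_pi_eq_smul_volume_pi (M := M) (by rw [hdet]; exact one_ne_zero)
  rw [hdet] at h
  simp only [inv_one, abs_one, ENNReal.ofReal_one, one_smul] at h
  rw [← h]
  congr 1
  funext e i
  rw [Matrix.toLin'_apply, Matrix.mulVec, dotProduct, partialSums]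
  have h1 : ∑ j : Fin (ℓ + 1), M i j * e j =
      ∑ j : Fin (ℓ + 1), (fun k : ℕ => if k ≤ i then e (Fin.ofNat (ℓ + 1) k) else 0) j := by
    refine Finset.sum_congr rfl fun j _ => ?_
    by_cases hij : j ≤ i
    · simp [hM, hij]
    · simp [hM, hij]
  rw [h1, Fin.sum_univ_eq_sum_range
    (fun k : ℕ => if k ≤ i then e (Fin.ofNat (ℓ + 1) k) else 0) (ℓ + 1), ← Finset.sum_filter]
  refine Finset.sum_congr ?_ fun _ _ => rfl
  ext k
  simp only [Finset.mem_range, Finset.mem_filter]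
  have := i.2
  omega

theorem gammaDensity_cum (ℓ : ℕ) (e : Fin (ℓ + 1) → ℝ) :
    gammaDensity ℓ (partialSums ℓ fun i => e (Fin.ofNat (ℓ + 1) i)) =
      ∏ i, ProbabilityTheory.exponentialPDF 1 (e i) := by
  set γ := partialSums ℓ fun i => e (Fin.ofNat (ℓ + 1) i) with hγ
  have h0 : γ 0 = e 0 := by simp [hγ, partialSums]
  have hsucc : ∀ i : Fin ℓ, γ i.succ = γ i.castSucc + e i.succ := by
    intro i
    simp only [hγ, partialSums, Fin.val_succ, Fin.val_castSucc]
    rw [Finset.sum_range_succ _ ((i : ℕ) + 1)]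
    congr 2
    ext
    simp [Fin.ofNat]
  have hlast : γ (Fin.last ℓ) = ∑ i, e i := by
    simp only [hγ, partialSums, Fin.val_last]
    rw [← Fin.sum_univ_eq_sum_range fun i => e (Fin.ofNat (ℓ + 1) i)]
    simp
  have hcone : (0 ≤ γ 0 ∧ Monotone γ) ↔ ∀ i, 0 ≤ e i := by
    rw [Fin.forall_fin_succ, h0, Fin.monotone_iff_le_succ]
    simp [hsucc]
  by_cases h : ∀ i, 0 ≤ e i
  · rw [gammaDensity, indicator_of_mem (by exact hcone.2 h), hlast]
    have h1 : ∀ i, ProbabilityTheory.exponentialPDF 1 (e i) = ENNReal.ofReal (Real.exp (-e i)) :=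
      fun i => by rw [ProbabilityTheory.exponentialPDF_of_nonneg (h i)]; simp
    simp_rw [h1]
    rw [← ENNReal.ofReal_prod_of_nonneg fun i _ => (Real.exp_pos _).le, ← Real.exp_sum,
      Finset.sum_neg_distrib]
  · rw [gammaDensity, indicator_of_notMem (by exact fun hc => h (hcone.1 hc))]
    rw [not_forall] at h
    obtain ⟨i, hi⟩ := h
    exact (Finset.prod_eq_zero (Finset.mem_univ i)
      (ProbabilityTheory.exponentialPDF_of_neg (not_le.1 hi))).symm

theorem measurable_cum (ℓ : ℕ) : Measurable fun e : Fin (ℓ + 1) → ℝ =>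
    partialSums ℓ fun i => e (Fin.ofNat (ℓ + 1) i) :=
  measurable_pi_lambda _ fun _ => Finset.measurable_sum _ fun _ _ => measurable_pi_apply _

theorem measurable_gammaDensity (ℓ : ℕ) : Measurable (gammaDensity ℓ) := by
  refine Measurable.indicator (by fun_prop) ?_
  refine IsClosed.measurableSet (IsClosed.inter (isClosed_le continuous_const
    (continuous_apply 0)) ?_)
  exact isClosed_monotone

section Exponential

variable {Ω' : Type*} [MeasurableSpace Ω'] {P' : Measure Ω'}
  {E : ℕ → Ω' → ℝ}

theorem IsIIDExponential.map_eq_pi [IsProbabilityMeasure P'] (hE : IsIIDExponential P' E) (n : ℕ) :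
    P'.map (fun ω (i : Fin n) => E i ω) =
      Measure.pi fun _ : Fin n => ProbabilityTheory.expMeasure 1 := by
  have h := (ProbabilityTheory.iIndepFun_iff_map_fun_eq_pi_map
    (f := fun (i : Fin n) => E i) fun i => (hE.1 i).aemeasurable).1
      (hE.2.1.precomp Fin.val_injective)
  rw [h]
  simp_rw [hE.2.2]

/-- The first `ℓ + 1` partial sums of an i.i.d. exponential sequence have density `gammaDensity ℓ`. -/
theorem IsIIDExponential.lintegral_partialSums [IsProbabilityMeasure P'] (hE : IsIIDExponential P' E) (ℓ : ℕ)
    {h : (Fin (ℓ + 1) → ℝ) → ℝ≥0∞} (hh : Measurable h) :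
    ∫⁻ ω, h (partialSums ℓ fun i => E i ω) ∂P' = ∫⁻ γ, h γ * gammaDensity ℓ γ := by
  have : IsProbabilityMeasure (ProbabilityTheory.expMeasure 1) :=
    ProbabilityTheory.isProbabilityMeasure_expMeasure one_pos
  have h1 : ∀ ω, (partialSums ℓ fun i => E i ω) = partialSums ℓ fun i =>
      (fun j : Fin (ℓ + 1) => E j ω) (Fin.ofNat (ℓ + 1) i) := by
    intro ω
    funext j
    refine Finset.sum_congr rfl fun i hi => ?_
    have : i % (ℓ + 1) = i := Nat.mod_eq_of_lt (by
      have := Finset.mem_range.1 hi; have := j.2; omega)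
    simp [Fin.ofNat, this]
  simp_rw [h1]
  rw [← lintegral_map (f := fun e : Fin (ℓ + 1) → ℝ =>
    h (partialSums ℓ fun i => e (Fin.ofNat (ℓ + 1) i))) (hh.comp (measurable_cum ℓ))
    (measurable_pi_lambda _ fun i : Fin (ℓ + 1) => hE.1 i), hE.map_eq_pi]
  have : SigmaFinite ((volume : Measure ℝ).withDensity (ProbabilityTheory.exponentialPDF 1)) := by
    rw [← expMeasure_eq_withDensity]; infer_instance
  simp_rw [expMeasure_eq_withDensity]
  have hmeas : Measurable fun x : Fin (ℓ + 1) → ℝ =>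
      ∏ i, ProbabilityTheory.exponentialPDF 1 (x i) :=
    Finset.measurable_prod _ fun i _ => (measurable_exponentialPDF 1).comp (measurable_pi_apply i)
  have hmeas' : Measurable fun e : Fin (ℓ + 1) → ℝ =>
      h (partialSums ℓ fun i => e (Fin.ofNat (ℓ + 1) i)) := hh.comp (measurable_cum ℓ)
  rw [pi_withDensity fun _ => measurable_exponentialPDF 1,
    lintegral_withDensity_eq_lintegral_mul _ hmeas hmeas']
  conv_rhs => rw [← map_cum_volume ℓ]
  have hmul : Measurable fun γ => h γ * gammaDensity ℓ γ := hh.mul (measurable_gammaDensity ℓ)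
  rw [lintegral_map hmul (measurable_cum ℓ)]
  refine lintegral_congr fun e => ?_
  rw [gammaDensity_cum, Pi.mul_apply, mul_comm]

theorem gammaDensity_le (ℓ : ℕ) (γ : Fin (ℓ + 1) → ℝ) : gammaDensity ℓ γ ≤
    ((ℓ + 1 : ℕ) : ℝ≥0∞) ^ (ℓ + 1) *
      ∏ j, ProbabilityTheory.exponentialPDF (1 / (ℓ + 1 : ℕ)) (γ j) := by
  by_cases hγ : 0 ≤ γ 0 ∧ Monotone γ
  · rw [gammaDensity, indicator_of_mem (by exact hγ)]
    have hR : (0 : ℝ) < (ℓ + 1 : ℕ) := by positivity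
    have h1 : ∀ j, ProbabilityTheory.exponentialPDF (1 / (ℓ + 1 : ℕ)) (γ j) =
        ENNReal.ofReal (1 / (ℓ + 1 : ℕ)) * ENNReal.ofReal (Real.exp (-(1 / (ℓ + 1 : ℕ) * γ j))) := by
      intro j
      rw [ProbabilityTheory.exponentialPDF_of_nonneg (hγ.1.trans (hγ.2 (Fin.zero_le j))),
        ENNReal.ofReal_mul (by positivity)]
    simp_rw [h1]
    rw [Finset.prod_mul_distrib, Finset.prod_const, Finset.card_univ, Fintype.card_fin, ← mul_assoc,
      ← mul_pow, ← ENNReal.ofReal_natCast, ← ENNReal.ofReal_mul hR.le, mul_one_div_cancel hR.ne',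
      ENNReal.ofReal_one, one_pow, one_mul,
      ← ENNReal.ofReal_prod_of_nonneg fun i _ => (Real.exp_pos _).le, ← Real.exp_sum]
    refine ENNReal.ofReal_le_ofReal (Real.exp_le_exp.2 ?_)
    rw [Finset.sum_neg_distrib, neg_le_neg_iff, ← Finset.mul_sum]
    have h2 : ∑ j, γ j ≤ ∑ _j : Fin (ℓ + 1), γ (Fin.last ℓ) :=
      Finset.sum_le_sum fun j _ => hγ.2 (Fin.le_last j)
    rw [Finset.sum_const, Finset.card_univ, Fintype.card_fin, nsmul_eq_mul] at h2
    calc 1 / ((ℓ + 1 : ℕ) : ℝ) * ∑ j, γ j ≤ 1 / ((ℓ + 1 : ℕ) : ℝ) *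
          (((ℓ + 1 : ℕ) : ℝ) * γ (Fin.last ℓ)) := by gcongr
      _ = γ (Fin.last ℓ) := by field_simp
  · rw [gammaDensity, indicator_of_notMem (by exact hγ)]
    exact zero_le

/-- Up to a constant factor, the law of the partial sums of exponential variables is dominated by a
product of exponential laws, because `γ_ℓ` is at least the mean of the `γ_j`. -/
theorem IsIIDExponential.lintegral_partialSums_le [IsProbabilityMeasure P'] (hE : IsIIDExponential P' E) (ℓ : ℕ)
    {h : (Fin (ℓ + 1) → ℝ) → ℝ≥0∞} (hh : Measurable h) :
    ∫⁻ ω, h (partialSums ℓ fun i => E i ω) ∂P' ≤ ((ℓ + 1 : ℕ) : ℝ≥0∞) ^ (ℓ + 1) *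
      ∫⁻ γ, h γ ∂Measure.pi fun _ : Fin (ℓ + 1) =>
        ProbabilityTheory.expMeasure (1 / (ℓ + 1 : ℕ)) := by
  have : IsProbabilityMeasure (ProbabilityTheory.expMeasure (1 / (ℓ + 1 : ℕ))) :=
    ProbabilityTheory.isProbabilityMeasure_expMeasure (by positivity)
  have : SigmaFinite ((volume : Measure ℝ).withDensity
      (ProbabilityTheory.exponentialPDF (1 / (ℓ + 1 : ℕ)))) := by
    rw [← expMeasure_eq_withDensity]; infer_instance
  have hmeas : Measurable fun x : Fin (ℓ + 1) → ℝ =>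
      ∏ i, ProbabilityTheory.exponentialPDF (1 / (ℓ + 1 : ℕ)) (x i) :=
    Finset.measurable_prod _ fun i _ => (measurable_exponentialPDF _).comp (measurable_pi_apply i)
  rw [hE.lintegral_partialSums ℓ hh]
  simp_rw [expMeasure_eq_withDensity]
  rw [pi_withDensity fun _ => measurable_exponentialPDF _,
    lintegral_withDensity_eq_lintegral_mul _ hmeas hh, ← lintegral_const_mul _ (hmeas.mul hh)]
  refine lintegral_mono fun γ => ?_
  rw [Pi.mul_apply, ← mul_assoc, mul_comm (h γ)]
  exact mul_le_mul_left (gammaDensity_le ℓ γ) _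

theorem IsIIDExponential.ae_pos (hE : IsIIDExponential P' E) : ∀ᵐ ω ∂P', ∀ i, 0 < E i ω := by
  refine ae_all_iff.2 fun i => ?_
  have h := ae_expMeasure_pos 1
  rw [← hE.2.2 i] at h
  exact ae_of_ae_map (hE.1 i).aemeasurable h

theorem IsIIDExponential.ae_partialSums_strictMono [IsProbabilityMeasure P'] (hE : IsIIDExponential P' E) (ℓ : ℕ) :
    ∀ᵐ ω ∂P', (∀ j, 0 < partialSums ℓ (fun i => E i ω) j) ∧
      StrictMono (partialSums ℓ fun i => E i ω) := by
  filter_upwards [hE.ae_pos] with ω hω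
  refine ⟨fun j => Finset.sum_pos (fun i _ => hω i) (by simp), fun i j hij => ?_⟩
  refine Finset.sum_lt_sum_of_subset (i := (j : ℕ)) ?_ ?_ ?_ (hω _) fun k _ _ => (hω k).le
  · exact Finset.range_mono (by have : (i : ℕ) < j := hij; omega)
  · simp
  · have : (i : ℕ) < j := hij
    simp; omega

theorem measurable_partialSums (hE : IsIIDExponential P' E) (ℓ : ℕ) :
    Measurable fun ω => partialSums ℓ fun i => E i ω :=
  measurable_pi_lambda _ fun _ => Finset.measurable_sum _ fun i _ => hE.1 i

theorem lintegral_Ioc_exp_neg {c d : ℝ} (hcd : c ≤ d) :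
    ∫⁻ y in Ioc c d, ENNReal.ofReal (Real.exp (-y)) =
      ENNReal.ofReal (Real.exp (-c) - Real.exp (-d)) := by
  rw [← ofReal_integral_eq_lintegral_ofReal]
  · rw [← intervalIntegral.integral_of_le hcd]
    simp
  · exact (Continuous.integrableOn_Icc (by fun_prop)).mono_set Ioc_subset_Icc_self
  · exact Eventually.of_forall fun y => (Real.exp_pos _).le

theorem IsIIDExponential.measure_partialSums_box [IsProbabilityMeasure P'] (hE : IsIIDExponential P' E) (ℓ : ℕ)
    {c d : Fin (ℓ + 1) → ℝ} (hc : ∀ j, 0 < c j) (hcd : ∀ j, c j < d j)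
    (hsep : ∀ i j, i < j → d i ≤ c j) :
    P'.real {ω | ∀ j, partialSums ℓ (fun i => E i ω) j ∈ Ioc (c j) (d j)} =
      (∏ j : Fin ℓ, (d j.castSucc - c j.castSucc)) *
        (Real.exp (-c (Fin.last ℓ)) - Real.exp (-d (Fin.last ℓ))) := by
  set B : Set (Fin (ℓ + 1) → ℝ) := {x | ∀ j, x j ∈ Ioc (c j) (d j)} with hB
  have hBm : MeasurableSet B := by
    rw [hB, ofPred_forall]
    exact MeasurableSet.iInter fun j => measurable_pi_apply j measurableSet_Ioc
  have hm := measurable_partialSums hE ℓ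
  have h1 : P' {ω | ∀ j, partialSums ℓ (fun i => E i ω) j ∈ Ioc (c j) (d j)} =
      ∫⁻ ω, B.indicator 1 (partialSums ℓ fun i => E i ω) ∂P' := by
    exact (lintegral_indicator_one (hm hBm)).symm
  set g : Fin (ℓ + 1) → ℝ → ℝ≥0∞ := fun j => (Ioc (c j) (d j)).indicator fun y =>
    if j = Fin.last ℓ then ENNReal.ofReal (Real.exp (-y)) else 1 with hg
  have hgm : ∀ j, Measurable (g j) := fun j => by
    refine Measurable.indicator ?_ measurableSet_Ioc
    by_cases hj : j = Fin.last ℓ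
    · simp only [hj, if_true]; fun_prop
    · simp only [hj, if_false]; fun_prop
  have h2 : ∀ γ, B.indicator 1 γ * gammaDensity ℓ γ = ∏ j, g j (γ j) := by
    intro γ
    by_cases hγ : γ ∈ B
    · have hcone : 0 ≤ γ 0 ∧ Monotone γ := by
        refine ⟨(hc 0).le.trans (hγ 0).1.le, fun i j hij => ?_⟩
        rcases hij.eq_or_lt with rfl | h
        · exact le_rfl
        · exact (hγ i).2.trans ((hsep i j h).trans (hγ j).1.le)
      rw [indicator_of_mem hγ, gammaDensity, indicator_of_mem (by exact hcone),
        Fin.prod_univ_castSucc]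
      simp only [hg, indicator_of_mem (hγ _), Pi.one_apply, one_mul, if_true]
      rw [Finset.prod_eq_one fun j _ => if_neg (Fin.castSucc_lt_last j).ne, one_mul]
    · rw [indicator_of_notMem hγ, zero_mul]
      simp only [hB, mem_ofPred_eq, not_forall] at hγ
      obtain ⟨i, hi⟩ := hγ
      exact (Finset.prod_eq_zero (Finset.mem_univ i) (indicator_of_notMem hi _)).symm
  rw [measureReal_def, h1, hE.lintegral_partialSums ℓ (measurable_one.indicator hBm)]
  simp_rw [h2]
  rw [volume_pi, lintegral_pi_prod _ hgm, Fin.prod_univ_castSucc, ENNReal.toReal_mul]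
  have h3 : ∀ j : Fin ℓ, ∫⁻ y, g j.castSucc y = ENNReal.ofReal (d j.castSucc - c j.castSucc) := by
    intro j
    simp only [hg, (Fin.castSucc_lt_last j).ne, if_false]
    rw [lintegral_indicator measurableSet_Ioc, setLIntegral_one, Real.volume_Ioc]
  have h4 : ∫⁻ y, g (Fin.last ℓ) y =
      ENNReal.ofReal (Real.exp (-c (Fin.last ℓ)) - Real.exp (-d (Fin.last ℓ))) := by
    simp only [hg, if_true]
    rw [lintegral_indicator measurableSet_Ioc, lintegral_Ioc_exp_neg (hcd _).le]
  simp_rw [h3]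
  rw [h4, ENNReal.toReal_prod, ENNReal.toReal_ofReal
    (sub_nonneg.2 (Real.exp_le_exp.2 (neg_le_neg (hcd _).le)))]
  congr 1
  exact Finset.prod_congr rfl fun j _ => ENNReal.toReal_ofReal (sub_nonneg.2 (hcd _).le)

end Exponential

/-! ### Regular variation at the end point -/

/-- Normalising scale of a function `t` that is regularly varying at `0+` with positive index `b`:
there are `e_n ↓ 0` with `n t(e_n v) → v ^ b` for all `v > 0`. -/
theorem exists_scale_of_regularlyVarying {t : ℝ → ℝ} (hmono : Monotone t)
    (hpos : ∀ z, 0 < z → 0 < t z) {b : ℝ} (hb : 0 < b)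
    (hreg : ∀ v : ℝ, 0 < v → Tendsto (fun z => t (v * z) / t z) (𝓝[>] 0) (𝓝 (v ^ b))) :
    ∃ e : ℕ → ℝ, (∀ n, 0 < e n) ∧ Tendsto e atTop (𝓝 0) ∧
      ∀ v : ℝ, 0 < v → Tendsto (fun n : ℕ => n * t (e n * v)) atTop (𝓝 (v ^ b)) := by
  -- the one-sided limit at `0` vanishes, since otherwise all ratios would tend to `1`
  have hlim0 : Tendsto t (𝓝[>] 0) (𝓝 0) := by
    have h := hmono.tendsto_nhdsGT 0
    rcases eq_or_ne (sInf (t '' Ioi 0)) 0 with h0 | h0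
    · rwa [h0] at h
    · exfalso
      have hmul : Tendsto (fun z : ℝ => 1 / 2 * z) (𝓝[>] 0) (𝓝[>] 0) := by
        refine tendsto_nhdsWithin_iff.2 ⟨?_, ?_⟩
        · have : Tendsto (fun z : ℝ => 1 / 2 * z) (𝓝 0) (𝓝 (1 / 2 * 0)) :=
            (continuous_const.mul continuous_id).tendsto _
          rw [mul_zero] at this
          exact this.mono_left nhdsWithin_le_nhds
        · filter_upwards [self_mem_nhdsWithin] with z hz
          exact mul_pos (show (0 : ℝ) < 1 / 2 by norm_num) hz
      have h1 := ((h.comp hmul).div h h0)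
      have h2 := tendsto_nhds_unique h1 (hreg (1 / 2) (by norm_num))
      rw [div_self h0] at h2
      exact (Real.rpow_lt_one (by norm_num) (by norm_num) hb).ne h2.symm
  set A : ℕ → Set ℝ := fun n => {z | 0 < z ∧ 1 / (n : ℝ) ≤ t z} with hA
  set e' : ℕ → ℝ := fun n => sInf (A n) with he'
  have hAbdd : ∀ n, BddBelow (A n) := fun n => ⟨0, fun z hz => hz.1.le⟩
  have hAmem : ∀ ε, 0 < ε → ∀ᶠ n : ℕ in atTop, ε ∈ A n := by
    intro ε hε
    filter_upwards [(tendsto_one_div_atTop_nhds_zero_nat (𝕜 := ℝ)).eventually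
      (gt_mem_nhds (hpos ε hε))] with n hn
    exact ⟨hε, hn.le⟩
  have hepos : ∀ᶠ n : ℕ in atTop, 0 < e' n := by
    filter_upwards [hAmem 1 one_pos, eventually_gt_atTop 0] with n hn hn0
    have h1 : ∀ᶠ z in 𝓝[>] 0, t z < 1 / (n : ℝ) := hlim0.eventually (gt_mem_nhds (by positivity))
    obtain ⟨δ, hδ, hδ'⟩ := mem_nhdsGT_iff_exists_Ioo_subset.1 h1
    refine lt_of_lt_of_le (show 0 < δ from hδ) (le_csInf ⟨1, hn⟩ fun z hz => ?_)
    by_contra hlt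
    exact absurd hz.2 (not_le.2 (hδ' ⟨hz.1, not_le.1 hlt⟩))
  have helim : Tendsto e' atTop (𝓝 0) := by
    refine tendsto_order.2 ⟨fun y hy => hepos.mono fun n hn => hy.trans hn, fun y hy => ?_⟩
    filter_upwards [hAmem (y / 2) (by linarith)] with n hn
    exact (csInf_le (hAbdd n) hn).trans_lt (by linarith)
  have hup : ∀ c, 1 < c → ∀ᶠ n : ℕ in atTop, 1 ≤ n * t (c * e' n) := by
    intro c hc
    filter_upwards [hepos, hAmem 1 one_pos, eventually_gt_atTop 0] with n hn hne hn0
    have hlt : sInf (A n) < c * e' n := by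
      change e' n < c * e' n
      nlinarith
    obtain ⟨z, hz, hzlt⟩ := exists_lt_of_csInf_lt ⟨1, hne⟩ hlt
    have := hz.2.trans (hmono hzlt.le)
    rw [div_le_iff₀ (by exact_mod_cast hn0)] at this
    linarith
  have hdn : ∀ c, 0 < c → c < 1 → ∀ᶠ n : ℕ in atTop, n * t (c * e' n) ≤ 1 := by
    intro c hc0 hc
    filter_upwards [hepos, eventually_gt_atTop 0] with n hn hn0
    have hnot : c * e' n ∉ A n := fun hmem => by
      have := csInf_le (hAbdd n) hmem
      change e' n ≤ c * e' n at this
      nlinarith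
    have : t (c * e' n) < 1 / n := by
      by_contra hge
      exact hnot ⟨mul_pos hc0 hn, not_lt.1 hge⟩
    rw [lt_div_iff₀ (by exact_mod_cast hn0)] at this
    linarith
  have hewithin : ∀ c, 0 < c → Tendsto (fun n => c * e' n) atTop (𝓝[>] 0) := by
    intro c hc
    refine tendsto_nhdsWithin_iff.2 ⟨?_, hepos.mono fun n hn => mul_pos hc hn⟩
    simpa using helim.const_mul c
  have hmain : ∀ v : ℝ, 0 < v → Tendsto (fun n : ℕ => n * t (e' n * v)) atTop (𝓝 (v ^ b)) := by
    intro v hv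
    have hcont : Tendsto (fun c : ℝ => (v / c) ^ b) (𝓝 1) (𝓝 (v ^ b)) := by
      have h1 : ContinuousAt (fun c : ℝ => (v / c) ^ b) 1 := by
        refine ContinuousAt.rpow_const ?_ (Or.inr hb.le)
        exact continuousAt_const.div continuousAt_id one_ne_zero
      simpa [ContinuousAt] using h1
    have hratio : ∀ c, 0 < c → Tendsto (fun n => t (e' n * v) / t (c * e' n)) atTop
        (𝓝 ((v / c) ^ b)) := by
      intro c hc
      refine ((hreg (v / c) (div_pos hv hc)).comp (hewithin c hc)).congr fun n => ?_
      simp only [Function.comp]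
      congr 2
      field_simp
    refine tendsto_order.2 ⟨fun y hy => ?_, fun y hy => ?_⟩
    · obtain ⟨c, hc1, hc⟩ : ∃ c : ℝ, 1 < c ∧ y < (v / c) ^ b := by
        have h1 : ∀ᶠ c in 𝓝[>] (1 : ℝ), 1 < c ∧ y < (v / c) ^ b :=
          eventually_mem_nhdsWithin.and
            (nhdsWithin_le_nhds (hcont.eventually (lt_mem_nhds hy)))
        exact h1.exists
      filter_upwards [(hratio c (by linarith)).eventually (lt_mem_nhds hc), hup c hc1, hepos]
        with n h1 h2 h3
      have h4 : 0 < t (c * e' n) := hpos _ (mul_pos (by linarith) h3)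
      have h5 : 0 < t (e' n * v) := hpos _ (mul_pos h3 hv)
      rw [lt_div_iff₀ h4] at h1
      by_cases hy0 : y ≤ 0
      · have : 0 < (n : ℝ) := by
          by_contra hn
          have : (n : ℝ) * t (c * e' n) ≤ 0 := mul_nonpos_of_nonpos_of_nonneg (not_lt.1 hn) h4.le
          linarith
        exact hy0.trans_lt (mul_pos this h5)
      · rw [not_le] at hy0
        have hn0 : (0 : ℝ) < n := by
          by_contra hn
          have : (n : ℝ) * t (c * e' n) ≤ 0 := mul_nonpos_of_nonpos_of_nonneg (not_lt.1 hn) h4.le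
          linarith
        nlinarith
    · obtain ⟨c, hc1, hc0, hc⟩ : ∃ c : ℝ, c < 1 ∧ 0 < c ∧ (v / c) ^ b < y := by
        have h1 : ∀ᶠ c in 𝓝[<] (1 : ℝ), c < 1 ∧ 0 < c ∧ (v / c) ^ b < y :=
          eventually_mem_nhdsWithin.and (nhdsWithin_le_nhds
            ((lt_mem_nhds one_pos).and (hcont.eventually (gt_mem_nhds hy))))
        exact h1.exists
      filter_upwards [(hratio c hc0).eventually (gt_mem_nhds hc), hdn c hc0 hc1, hepos,
        eventually_gt_atTop 0] with n h1 h2 h3 hn0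
      have h4 : 0 < t (c * e' n) := hpos _ (mul_pos hc0 h3)
      have h5 : 0 < t (e' n * v) := hpos _ (mul_pos h3 hv)
      rw [div_lt_iff₀ h4] at h1
      have hy0 : 0 < y := (Real.rpow_pos_of_pos (div_pos hv hc0) b).trans hc
      nlinarith
  refine ⟨fun n => if 0 < e' n then e' n else 1, fun n => ?_, ?_, fun v hv => ?_⟩
  · dsimp only
    split_ifs with h
    · exact h
    · exact one_pos
  · exact helim.congr' (hepos.mono fun n hn => (if_pos hn).symm)
  · exact (hmain v hv).congr' (hepos.mono fun n hn => by simp only [if_pos hn])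

/-! ### First-stage estimators as order statistics -/

theorem check_eq_bayesLoss (τ u : ℝ) : check τ u = bayesLoss τ (-u) := by
  unfold check bayesLoss
  rcases lt_trichotomy u 0 with h | rfl | h
  · rw [if_pos h.le, if_pos (by linarith)]; ring
  · simp
  · rw [if_neg (not_le.2 h), if_neg (by linarith)]; ring

/-- A minimiser of the sample objective over the observations `y i`, `i ∈ s`, is a sample
quantile. -/
theorem card_le_of_sample_minimiser {s : Finset ℕ} {y : ℕ → ℝ} {τ q : ℝ} (hτ0 : 0 ≤ τ)
    (hτ1 : τ ≤ 1)
    (hmin : ∀ q', ∑ i ∈ s, check τ (y i - q) ≤ ∑ i ∈ s, check τ (y i - q')) :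
    ((s.filter fun i => y i < q).card : ℝ) ≤ τ * s.card ∧
      τ * s.card ≤ ((s.filter fun i => y i ≤ q).card : ℝ) := by
  set μ : Measure ℝ := ∑ i ∈ s, Measure.dirac (y i) with hμ
  have hint : ∀ q', ∫⁻ r, ENNReal.ofReal (bayesLoss τ (1 * (q' - r))) ∂μ =
      ENNReal.ofReal (∑ i ∈ s, check τ (y i - q')) := by
    intro q'
    rw [hμ, lintegral_finsetSum_measure, ENNReal.ofReal_sum_of_nonneg fun i _ => by
      rw [check_eq_bayesLoss]; exact bayesLoss_nonneg hτ0 hτ1 _]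
    refine Finset.sum_congr rfl fun i _ => ?_
    rw [lintegral_dirac, check_eq_bayesLoss]
    congr 2
    ring
  have hmass : ∀ A : Set ℝ, MeasurableSet A → ∀ p : ℕ → Prop, ∀ [DecidablePred p],
      (∀ i, p i ↔ y i ∈ A) → μ A = ((s.filter p).card : ℝ≥0∞) := by
    intro A hA p _ hp
    rw [hμ, Measure.finsetSum_apply, Finset.card_filter]
    push_cast
    refine Finset.sum_congr rfl fun i _ => ?_
    rw [Measure.dirac_apply' _ hA]
    by_cases h : y i ∈ A
    · simp [h, hp]
    · simp [h, hp]
  have huniv : μ univ = (s.card : ℝ≥0∞) := by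
    have := hmass univ MeasurableSet.univ (fun _ => True) (by simp)
    simpa using this
  have hmin' : ∀ q', ∫⁻ r, ENNReal.ofReal (bayesLoss τ (1 * (q - r))) ∂μ ≤
      ∫⁻ r, ENNReal.ofReal (bayesLoss τ (1 * (q' - r))) ∂μ := fun q' => by
    rw [hint, hint]; exact ENNReal.ofReal_le_ofReal (hmin q')
  have hfin : ∫⁻ r, ENNReal.ofReal (bayesLoss τ (1 * (q - r))) ∂μ ≠ ∞ := by
    rw [hint]; exact ENNReal.ofReal_ne_top
  have h1 := measure_Iio_minimiser_le hτ0 hτ1 one_pos hfin hmin'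
  have h2 := le_measure_Iic_minimiser hτ0 hτ1 one_pos hfin hmin'
  rw [huniv, hmass (Iio q) measurableSet_Iio (fun i => y i < q) (fun i => Iff.rfl)] at h1
  rw [huniv, hmass (Iic q) measurableSet_Iic (fun i => y i ≤ q) (fun i => Iff.rfl)] at h2
  have hcast : ∀ k : ℕ, (k : ℝ≥0∞) = ENNReal.ofReal (k : ℝ) := fun k =>
    (ENNReal.ofReal_natCast k).symm
  rw [hcast, hcast, ← ENNReal.ofReal_mul hτ0] at h1 h2
  exact ⟨(ENNReal.ofReal_le_ofReal_iff (by positivity)).1 h1,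
    (ENNReal.ofReal_le_ofReal_iff (by positivity)).1 h2⟩

/-- If `(1 - τ) N ∈ (j, j + 1)`, where `N` is the number of observations in the subsample `s`, a
minimiser of the sample objective is the `(j + 1)`-st largest observation: in terms of the gaps to
an upper bound `z`, the `(j + 1)`-st smallest gap. Observations outside the subsample get the gap
`z + 1`, beyond those of the subsample. -/
theorem sample_minimiser_eq_orderStat {n : ℕ} {s : Finset ℕ} (hs : s ⊆ Finset.range n)
    {y v : ℕ → ℝ} {z τ q : ℝ} (hτ0 : 0 ≤ τ) (hτ1 : τ ≤ 1) (hy : ∀ i ∈ s, 0 ≤ y i)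
    (hv : ∀ i ∈ s, v i = z - y i) (hv' : ∀ i ∉ s, v i = z + 1) {j : ℕ}
    (hj : (j : ℝ) < (1 - τ) * s.card) (hj' : (1 - τ) * s.card < j + 1)
    (hmin : ∀ q', ∑ i ∈ s, check τ (y i - q) ≤ ∑ i ∈ s, check τ (y i - q')) :
    q = z - orderStat n v j := by
  obtain ⟨h1, h2⟩ := card_le_of_sample_minimiser hτ0 hτ1 hmin
  have hle : (s.filter fun i => y i ≤ q).card + (s.filter fun i => q < y i).card = s.card := by
    rw [← Finset.card_filter_add_card_filter_not (s := s) (fun i => y i ≤ q)]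
    simp
  have hlt : (s.filter fun i => y i < q).card + (s.filter fun i => q ≤ y i).card = s.card := by
    rw [← Finset.card_filter_add_card_filter_not (s := s) (fun i => y i < q)]
    simp
  have h3 : (s.filter fun i => q < y i).card ≤ j := by
    have : ((s.filter fun i => q < y i).card : ℝ) < j + 1 := by
      have : ((s.filter fun i => y i ≤ q).card : ℝ) + (s.filter fun i => q < y i).card = s.card := by
        exact_mod_cast hle
      linarith
    exact Nat.lt_succ_iff.1 (by exact_mod_cast this)
  have h4 : j < (s.filter fun i => q ≤ y i).card := by
    have : (j : ℝ) < (s.filter fun i => q ≤ y i).card := by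
      have : ((s.filter fun i => y i < q).card : ℝ) + (s.filter fun i => q ≤ y i).card = s.card := by
        exact_mod_cast hlt
      linarith
    exact_mod_cast this
  have hq0 : 0 ≤ q := by
    by_contra hneg
    have : s.filter (fun i => q ≤ y i) ⊆ s.filter fun i => q < y i := by
      intro i hi
      rw [Finset.mem_filter] at hi ⊢
      exact ⟨hi.1, (not_le.1 hneg).trans_le (hy i hi.1)⟩
    exact absurd (h4.trans_le ((Finset.card_le_card this).trans h3)) (lt_irrefl _)
  have hjn : j < n := by
    have := Finset.card_le_card ((Finset.filter_subset (fun i => q ≤ y i) s).trans hs)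
    rw [Finset.card_range] at this
    omega
  have hos : z - q = orderStat n v j := by
    refine eq_orderStat hjn ?_ ?_
    · refine le_trans (Finset.card_le_card fun i hi => ?_) h3
      obtain ⟨-, hi2⟩ := Finset.mem_filter.1 hi
      by_cases his : i ∈ s
      · rw [hv i his] at hi2
        exact Finset.mem_filter.2 ⟨his, by linarith⟩
      · rw [hv' i his] at hi2
        linarith
    · refine lt_of_lt_of_le h4 (Finset.card_le_card fun i hi => ?_)
      obtain ⟨his, hi2⟩ := Finset.mem_filter.1 hi
      refine Finset.mem_filter.2 ⟨hs his, ?_⟩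
      rw [hv i his]
      linarith
  linarith

section FirstStage

variable {d : ℕ} {Ω : Type*} [MeasurableSpace Ω] {P : Measure Ω} {X : ℕ → Ω → Fin d → ℝ}
  {Y : ℕ → Ω → ℝ} {T : Set ((Fin d → ℝ) × ℝ)} {x : Fin d → ℝ} {p₀ : ℝ}

theorem condDist_eq [IsProbabilityMeasure P] {X : Ω → Fin d → ℝ} {Y : Ω → ℝ} (hX : Measurable X)
    (hY : Measurable Y) (hp₀ : p₀ = P.real {ω | X ω ≤ x}) (hp₀pos : 0 < p₀) (z : ℝ) :
    condDist P X Y x z = 1 - P.real {ω | X ω ≤ x ∧ z < Y ω} / p₀ := by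
  have hXm : MeasurableSet {ω | X ω ≤ x} := hX measurableSet_Iic
  have hYm : MeasurableSet {ω | Y ω ≤ z} := hY measurableSet_Iic
  rw [condDist, measureReal_def, ProbabilityTheory.cond_apply hXm, ENNReal.toReal_mul,
    ENNReal.toReal_inv, ← measureReal_def, ← measureReal_def, ← hp₀]
  have h := measureReal_inter_add_sdiff (μ := P) (s := {ω | X ω ≤ x}) hYm
  have h2 : {ω | X ω ≤ x} \ {ω | Y ω ≤ z} = {ω | X ω ≤ x ∧ z < Y ω} := by
    ext ω; simp
  rw [h2, ← hp₀] at h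
  field_simp
  linarith

/-- Under free disposal the frontier is the right end point of the conditional output
distribution. -/
theorem prodFrontier_eq_sSup [IsProbabilityMeasure P] (hX : ∀ i, Measurable (X i))
    (hY : ∀ i, Measurable (Y i)) (hTnonneg : ∀ z ∈ T, 0 ≤ z.1 ∧ 0 ≤ z.2)
    (hdisposal : FreeDisposal T) (hdata : ∀ i, ∀ᵐ ω ∂P, (X i ω, Y i ω) ∈ T)
    (hp₀ : p₀ = P.real {ω | X 0 ω ≤ x}) (hp₀pos : 0 < p₀)
    (hreach : ∀ y : ℝ, (x, y) ∈ T → ∀ y' < y, 0 < P {ω | X 0 ω ≤ x ∧ y' < Y 0 ω})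
    (hbdd : BddAbove {z | condDist P (X 0) (Y 0) x z < 1}) :
    prodFrontier T x = sSup {z | condDist P (X 0) (Y 0) x z < 1} ∧ 0 ≤ prodFrontier T x ∧
      (∀ i, ∀ᵐ ω ∂P, X i ω ≤ x → 0 ≤ Y i ω ∧ Y i ω ≤ prodFrontier T x) ∧
      ∀ y' < prodFrontier T x, 0 < P {ω | X 0 ω ≤ x ∧ y' < Y 0 ω} := by
  have hF : ∀ z, condDist P (X 0) (Y 0) x z < 1 ↔ 0 < P {ω | X 0 ω ≤ x ∧ z < Y 0 ω} := by
    intro z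
    rw [condDist_eq (hX 0) (hY 0) hp₀ hp₀pos, sub_lt_self_iff, div_pos_iff_of_pos_right hp₀pos,
      measureReal_def, ENNReal.toReal_pos_iff]
    simp [measure_lt_top]
  have hmem : ∀ i, ∀ᵐ ω ∂P, X i ω ≤ x → (x, Y i ω) ∈ T := by
    intro i
    filter_upwards [hdata i] with ω hω hle
    exact hdisposal _ _ _ _ hω hle (hTnonneg _ hω).2 le_rfl
  set z₁ := sSup {z | condDist P (X 0) (Y 0) x z < 1} with hz₁
  have hub : ∀ y, (x, y) ∈ T → y ≤ z₁ := by
    intro y hy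
    refine le_of_forall_lt fun y' hy' => ?_
    obtain ⟨y'', h1, h2⟩ := exists_between hy'
    exact h1.trans_le (le_csSup hbdd ((hF y'').2 (hreach y hy y'' h2)))
  have hbddT : BddAbove {y | (x, y) ∈ T} := ⟨z₁, hub⟩
  have hpos : ∀ i, ∀ᵐ ω ∂P, X i ω ≤ x → 0 ≤ Y i ω ∧ Y i ω ≤ prodFrontier T x := by
    intro i
    filter_upwards [hmem i] with ω hω hle
    exact ⟨(hTnonneg _ (hω hle)).2, le_csSup hbddT (hω hle)⟩
  have hex : ∀ z, 0 < P {ω | X 0 ω ≤ x ∧ z < Y 0 ω} →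
      ∃ y, (x, y) ∈ T ∧ z < y := by
    intro z hz
    have hfreq : ∃ᵐ ω ∂P, X 0 ω ≤ x ∧ z < Y 0 ω := by
      rw [frequently_ae_iff]; exact hz.ne'
    obtain ⟨ω, h1, h2⟩ := (hfreq.and_eventually (hmem 0)).exists
    exact ⟨_, h2 h1.1, h1.2⟩
  have hneT : ∃ y, (x, y) ∈ T := by
    have hfreq : ∃ᵐ ω ∂P, X 0 ω ≤ x := by
      rw [frequently_ae_iff]
      intro h0
      rw [hp₀, measureReal_def, h0] at hp₀pos
      simp at hp₀pos
    obtain ⟨ω, h1, h2⟩ := (hfreq.and_eventually (hmem 0)).exists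
    exact ⟨_, h2 h1⟩
  have hne : {z | condDist P (X 0) (Y 0) x z < 1}.Nonempty := by
    obtain ⟨y, hy⟩ := hneT
    exact ⟨y - 1, (hF _).2 (hreach y hy _ (by linarith))⟩
  have heq : prodFrontier T x = z₁ := by
    refine le_antisymm (csSup_le hneT hub) (csSup_le hne fun z hz => ?_)
    obtain ⟨y, hy, hlt⟩ := hex z ((hF z).1 hz)
    exact hlt.le.trans (le_csSup hbddT hy)
  refine ⟨heq, ?_, hpos, fun y' hy' => ?_⟩
  · obtain ⟨y, hy⟩ := hneT
    exact (hTnonneg _ hy).2.trans (le_csSup hbddT hy)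
  · obtain ⟨y, hy, hlt⟩ := exists_lt_of_lt_csSup hneT hy'
    exact hreach y hy y' hlt

/-- The gap of an observation to the frontier value `z`; observations that do not belong to the
subsample `X ≤ x` get the value `z + 1`, beyond the gap of every observation of the subsample. -/
noncomputable def gap (x : Fin d → ℝ) (z : ℝ) (u : (Fin d → ℝ) × ℝ) : ℝ :=
  {w : (Fin d → ℝ) × ℝ | w.1 ≤ x}.indicator (fun w => z - w.2 - (z + 1)) u + (z + 1)

theorem gap_of_le {z : ℝ} {u : (Fin d → ℝ) × ℝ} (h : u.1 ≤ x) : gap x z u = z - u.2 := by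
  rw [gap, indicator_of_mem (by exact h)]; ring

theorem gap_of_not_le {z : ℝ} {u : (Fin d → ℝ) × ℝ} (h : ¬ u.1 ≤ x) : gap x z u = z + 1 := by
  rw [gap, indicator_of_notMem (by exact h)]; ring

theorem measurable_gap (x : Fin d → ℝ) (z : ℝ) : Measurable (gap x z) := by
  refine Measurable.add_const (Measurable.indicator (by fun_prop) ?_) _
  exact measurable_fst measurableSet_Iic

/-- The proportion of observations with `X ≤ x` converges in probability. -/
theorem tendsto_measure_card_subsample [IsProbabilityMeasure P] (hX : ∀ i, Measurable (X i))
    (hindep : ProbabilityTheory.iIndepFun (fun i ω => (X i ω, Y i ω)) P)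
    (hident : ∀ i, ProbabilityTheory.IdentDistrib
      (fun ω => (X i ω, Y i ω)) (fun ω => (X 0 ω, Y 0 ω)) P P)
    (hp₀ : p₀ = P.real {ω | X 0 ω ≤ x}) {k : ℝ} (hk : 0 < k) {U : Set ℝ}
    (hU : U ∈ 𝓝 (k * p₀)) : Tendsto (fun n : ℕ => P {ω | ¬ (k / n *
      ∑ i ∈ Finset.range n, {w : Fin d → ℝ | w ≤ x}.indicator (fun _ => (1 : ℝ)) (X i ω)) ∈ U})
      atTop (𝓝 0) := by
  set ι : (Fin d → ℝ) × ℝ → ℝ := fun w => {w : Fin d → ℝ | w ≤ x}.indicator (fun _ => (1 : ℝ)) w.1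
    with hι
  have hιm : Measurable ι := (measurable_const.indicator measurableSet_Iic).comp measurable_fst
  have hZm : ∀ i, Measurable fun ω => ι (X i ω, Y i ω) := fun i =>
    (measurable_const.indicator measurableSet_Iic).comp (hX i)
  have hmean : ∫ ω, ι (X 0 ω, Y 0 ω) ∂P = p₀ := by
    have : (fun ω => ι (X 0 ω, Y 0 ω)) = {ω | X 0 ω ≤ x}.indicator fun _ => (1 : ℝ) := by
      ext ω; simp [hι, indicator]
    have hm : MeasurableSet {ω | X 0 ω ≤ x} := hX 0 measurableSet_Iic
    rw [this, integral_indicator hm, setIntegral_const, hp₀]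
    simp
  have hint : Integrable (fun ω => ι (X 0 ω, Y 0 ω)) P := by
    refine Integrable.of_bound (hZm 0).aestronglyMeasurable 1 (Eventually.of_forall fun ω => ?_)
    simp only [hι, indicator]
    split_ifs <;> simp
  have hslln := ProbabilityTheory.strong_law_ae_real (μ := P) (fun i ω => ι (X i ω, Y i ω)) hint
    (fun i j hij => (hindep.comp (fun _ => ι) (fun _ => hιm)).indepFun hij)
    (fun i => (hident i).comp hιm)
  rw [hmean] at hslln
  set S : ℕ → Ω → ℝ := fun n ω => (∑ i ∈ Finset.range n, ι (X i ω, Y i ω)) / n with hS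
  have hSm : ∀ n, Measurable (S n) := fun n =>
    (Finset.measurable_sum _ fun i _ => hZm i).div_const _
  have hprob := tendstoInMeasure_of_tendsto_ae (fun n => (hSm n).aestronglyMeasurable) hslln
  obtain ⟨ε, hε, hball⟩ := Metric.mem_nhds_iff.1 hU
  rw [tendstoInMeasure_iff_dist] at hprob
  refine tendsto_of_tendsto_of_tendsto_of_le_of_le tendsto_const_nhds
    (hprob (ε / k) (by positivity)) (fun n => zero_le) fun n => measure_mono fun ω hω => ?_
  simp only [mem_ofPred_eq] at hω ⊢
  by_contra hlt
  refine hω (hball ?_)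
  rw [Metric.mem_ball]
  have h1 : k / n * ∑ i ∈ Finset.range n, {w : Fin d → ℝ | w ≤ x}.indicator (fun _ => (1 : ℝ))
      (X i ω) = k * S n ω := by
    simp only [hS, hι]; ring
  rw [h1, Real.dist_eq, ← mul_sub, abs_mul, abs_of_pos hk, ← Real.dist_eq]
  rw [not_le, lt_div_iff₀ hk] at hlt
  linarith

/-- Off an event of vanishing probability, the extreme quantile estimator is an order statistic. -/
theorem tendsto_measure_qhat_ne [IsProbabilityMeasure P] (hX : ∀ i, Measurable (X i))
    (hindep : ProbabilityTheory.iIndepFun (fun i ω => (X i ω, Y i ω)) P)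
    (hident : ∀ i, ProbabilityTheory.IdentDistrib
      (fun ω => (X i ω, Y i ω)) (fun ω => (X 0 ω, Y 0 ω)) P P)
    (hp₀ : p₀ = P.real {ω | X 0 ω ≤ x}) {z : ℝ}
    (hYpos : ∀ i, ∀ᵐ ω ∂P, X i ω ≤ x → 0 ≤ Y i ω ∧ Y i ω ≤ z)
    {qhat : ℕ → ℝ → Ω → ℝ} (hqhat : IsQuantileEstimator P X Y x qhat) {k : ℝ} (hk : 0 < k)
    (hkint : ∀ N : ℤ, k * p₀ ≠ N) {j : ℕ} (hj : j + 1 = rank k p₀) :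
    Tendsto (fun n : ℕ => P {ω | ¬ (qhat n (1 - k / n) ω =
      z - orderStat n (fun i => gap x z (X i ω, Y i ω)) j)}) atTop (𝓝 0) := by
  have hlo : (j : ℝ) < k * p₀ := by
    have : j < rank k p₀ := by omega
    rw [rank] at this
    exact Nat.lt_ceil.1 this
  have hhi : k * p₀ < j + 1 := by
    have h1 : k * p₀ ≤ (rank k p₀ : ℕ) := Nat.le_ceil _
    rw [← hj] at h1
    push_cast at h1
    refine lt_of_le_of_ne h1 fun h => hkint (j + 1) ?_
    rw [h]; push_cast; rfl
  refine tendsto_of_tendsto_of_tendsto_of_le_of_le' tendsto_const_nhds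
    (tendsto_measure_card_subsample (Y := Y) hX hindep hident hp₀ hk (Ioo_mem_nhds hlo hhi))
    (Eventually.of_forall fun n => zero_le) ?_
  filter_upwards [eventually_gt_atTop ⌈k⌉₊] with n hn
  have hkn : k < n := (Nat.le_ceil k).trans_lt (by exact_mod_cast hn)
  have hn0 : (0 : ℝ) < n := hk.trans hkn
  have hτ0 : 0 < 1 - k / n := sub_pos.2 ((div_lt_one hn0).2 hkn)
  have hτ1 : 1 - k / n < 1 := by linarith [div_pos hk hn0]
  refine measure_mono_ae ?_
  filter_upwards [(hqhat n _ hτ0 hτ1).2, ae_all_iff.2 hYpos] with ω hω hYω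
  simp only [le_Prop_eq]
  intro hbad hgood
  apply hbad
  classical
  set s := (Finset.range n).filter fun i => X i ω ≤ x with hs
  have hobj : ∀ q, quantileObjective X Y x n (1 - k / n) ω q =
      ∑ i ∈ s, check (1 - k / n) (Y i ω - q) := by
    intro q
    rw [quantileObjective, hs, Finset.sum_filter]
    refine Finset.sum_congr rfl fun i _ => ?_
    simp [indicator]
  have hcard : ∑ i ∈ Finset.range n, {w : Fin d → ℝ | w ≤ x}.indicator (fun _ => (1 : ℝ)) (X i ω) =
      s.card := by
    rw [hs, Finset.card_filter]
    push_cast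
    refine Finset.sum_congr rfl fun i _ => ?_
    simp [indicator]
  rw [hcard] at hgood
  have h1 : (1 - (1 - k / (n : ℝ))) * (s.card : ℝ) = k / n * s.card := by ring
  have hos : orderStat n (fun i => gap x z (X i ω, Y i ω)) j = orderStat n
      (fun i => if i ∈ s then z - Y i ω else z + 1) j := by
    have : (fun i : Fin n => gap x z (X i ω, Y i ω)) =
        fun i : Fin n => if (i : ℕ) ∈ s then z - Y i ω else z + 1 := by
      funext i
      by_cases hi : X i ω ≤ x
      · rw [if_pos (Finset.mem_filter.2 ⟨Finset.mem_range.2 i.2, hi⟩), gap_of_le hi]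
      · rw [if_neg (fun h => hi (Finset.mem_filter.1 h).2 : (i : ℕ) ∉ s), gap_of_not_le hi]
    unfold orderStat
    by_cases hjn : j < n
    · rw [dif_pos hjn, dif_pos hjn, this]
      exact congrFun this _
    · rw [dif_neg hjn, dif_neg hjn]
  rw [hos]
  refine sample_minimiser_eq_orderStat (s := s) (Finset.filter_subset _ _) (y := fun i => Y i ω)
    hτ0.le hτ1.le (fun i hi => (hYω i (Finset.mem_filter.1 hi).2).1) (fun i hi => if_pos hi)
    (fun i hi => if_neg hi) (by rw [h1]; exact hgood.1) (by rw [h1]; exact hgood.2) fun q' => ?_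
  rw [← hobj, ← hobj]
  exact hω q'

/-- The scaled gaps satisfy `n P(scaled gap ≤ γ) → γ`, the tail condition for Poisson limits. -/
theorem exists_scale_gap [IsProbabilityMeasure P] (hX : ∀ i, Measurable (X i))
    (hY : ∀ i, Measurable (Y i)) (hp₀ : p₀ = P.real {ω | X 0 ω ≤ x}) (hp₀pos : 0 < p₀) {ξ₀ : ℝ}
    (hev : InTypeIIIDomain (condDist P (X 0) (Y 0) x) ξ₀) {z : ℝ} (hz0 : 0 ≤ z)
    (hz : z = sSup {z | condDist P (X 0) (Y 0) x z < 1})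
    (hzpos : ∀ y' < z, 0 < P {ω | X 0 ω ≤ x ∧ y' < Y 0 ω}) :
    ∃ e : ℕ → ℝ, (∀ n, 0 < e n) ∧ Tendsto e atTop (𝓝 0) ∧ ∀ γ : ℝ, 0 < γ →
      Tendsto (fun n : ℕ => n * P.real {ω | p₀ * (max (gap x z (X 0 ω, Y 0 ω)) 0 / e n) ^ (-1 / ξ₀) ≤
        γ}) atTop (𝓝 γ) := by
  obtain ⟨hξ, -, hreg⟩ := hev
  rw [← hz] at hreg
  have hb : 0 < -1 / ξ₀ := div_pos_of_neg_of_neg (by norm_num) hξ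
  set b := -1 / ξ₀ with hbdef
  set t : ℝ → ℝ := fun y => P.real {ω | X 0 ω ≤ x ∧ z - y < Y 0 ω} / p₀ with ht
  have hF : ∀ y, 1 - condDist P (X 0) (Y 0) x (z - y) = t y := fun y => by
    rw [condDist_eq (hX 0) (hY 0) hp₀ hp₀pos]; simp [ht]
  simp_rw [hF] at hreg
  have hmono : Monotone t := fun y y' h => by
    refine div_le_div_of_nonneg_right (measureReal_mono fun ω hω => ⟨hω.1, ?_⟩) hp₀pos.le
    linarith [hω.2]
  have hpos : ∀ y, 0 < y → 0 < t y := fun y hy =>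
    div_pos (ENNReal.toReal_pos (hzpos _ (by linarith)).ne' (measure_ne_top _ _)) hp₀pos
  obtain ⟨e, he0, helim, he⟩ := exists_scale_of_regularlyVarying hmono hpos hb hreg
  refine ⟨e, he0, helim, fun γ hγ => ?_⟩
  set v := (γ / p₀) ^ b⁻¹ with hv
  have hγp : 0 < γ / p₀ := div_pos hγ hp₀pos
  have hv0 : 0 < v := Real.rpow_pos_of_pos hγp _
  have hvb : v ^ b = γ / p₀ := Real.rpow_inv_rpow hγp.le hb.ne'
  have hset : ∀ᶠ n in atTop, {ω | p₀ * (max (gap x z (X 0 ω, Y 0 ω)) 0 / e n) ^ b ≤ γ} =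
      {ω | X 0 ω ≤ x ∧ z - e n * v ≤ Y 0 ω} := by
    have h1 : Tendsto (fun n => e n * v) atTop (𝓝 0) := by simpa using helim.mul_const v
    filter_upwards [h1.eventually (gt_mem_nhds (show (0 : ℝ) < z + 1 by linarith))] with n hn
    ext ω
    simp only [mem_ofPred_eq]
    have h2 : p₀ * (max (gap x z (X 0 ω, Y 0 ω)) 0 / e n) ^ b ≤ γ ↔
        gap x z (X 0 ω, Y 0 ω) ≤ e n * v := by
      rw [← le_div_iff₀' hp₀pos, ← hvb, Real.rpow_le_rpow_iff
        (div_nonneg (le_max_right _ _) (he0 n).le) hv0.le hb, div_le_iff₀' (he0 n), max_le_iff,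
        and_iff_left (mul_pos (he0 n) hv0).le]
    rw [h2]
    by_cases hle : X 0 ω ≤ x
    · rw [gap_of_le hle]
      exact ⟨fun h => ⟨hle, by linarith⟩, fun h => by linarith [h.2]⟩
    · rw [gap_of_not_le hle]
      exact ⟨fun h => absurd h (not_le.2 hn), fun h => absurd h.1 hle⟩
  -- the closed tail is squeezed between open tails at slightly different thresholds
  have hmain : Tendsto (fun n : ℕ => n * (P.real {ω | X 0 ω ≤ x ∧ z - e n * v ≤ Y 0 ω} / p₀))
      atTop (𝓝 (v ^ b)) := by
    refine tendsto_order.2 ⟨fun y hy => ?_, fun y hy => ?_⟩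
    · filter_upwards [(he v hv0).eventually (lt_mem_nhds hy)] with n hn
      refine hn.trans_le (mul_le_mul_of_nonneg_left ?_ n.cast_nonneg)
      exact div_le_div_of_nonneg_right (measureReal_mono fun ω hω => ⟨hω.1, hω.2.le⟩) hp₀pos.le
    · have hcont : Tendsto (fun c : ℝ => c ^ b) (𝓝[>] v) (𝓝 (v ^ b)) :=
        (Real.continuousAt_rpow_const v b (Or.inr hb.le)).tendsto.mono_left nhdsWithin_le_nhds
      obtain ⟨c, hc, hcv⟩ := ((hcont.eventually (gt_mem_nhds hy)).and
        eventually_mem_nhdsWithin).exists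
      have hcv' : v < c := hcv
      filter_upwards [(he c (hv0.trans hcv')).eventually (gt_mem_nhds hc)] with n hn
      refine lt_of_le_of_lt (mul_le_mul_of_nonneg_left ?_ n.cast_nonneg) hn
      refine div_le_div_of_nonneg_right (measureReal_mono fun ω hω => ⟨hω.1, ?_⟩) hp₀pos.le
      have := mul_lt_mul_of_pos_left hcv' (he0 n)
      have h2 := hω.2
      linarith
  have h3 := hmain.const_mul p₀
  rw [hvb, mul_div_cancel₀ _ hp₀pos.ne'] at h3
  refine h3.congr' (hset.mono fun n hn => ?_)
  simp only [hn]
  field_simp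

/-- The extreme quantile estimators are asymptotically functions of a random vector that converges
in distribution to the first points of a unit rate Poisson process. -/
theorem exists_tendstoInDistribution_firstStage [IsProbabilityMeasure P]
    (hX : ∀ i, Measurable (X i)) (hY : ∀ i, Measurable (Y i))
    (hTnonneg : ∀ z ∈ T, 0 ≤ z.1 ∧ 0 ≤ z.2)
    (hdisposal : FreeDisposal T) (hdata : ∀ i, ∀ᵐ ω ∂P, (X i ω, Y i ω) ∈ T)
    (hp₀ : p₀ = P.real {ω | X 0 ω ≤ x}) (hp₀pos : 0 < p₀)
    (hreach : ∀ y : ℝ, (x, y) ∈ T → ∀ y' < y, 0 < P {ω | X 0 ω ≤ x ∧ y' < Y 0 ω})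
    (hindep : ProbabilityTheory.iIndepFun (fun i ω => (X i ω, Y i ω)) P)
    (hident : ∀ i, ProbabilityTheory.IdentDistrib
      (fun ω => (X i ω, Y i ω)) (fun ω => (X 0 ω, Y 0 ω)) P P) {ξ₀ : ℝ}
    (hev : InTypeIIIDomain (condDist P (X 0) (Y 0) x) ξ₀)
    {qhat : ℕ → ℝ → Ω → ℝ} (hqhat : IsQuantileEstimator P X Y x qhat)
    {Ω' : Type*} [MeasurableSpace Ω'] {P' : Measure Ω'} [IsProbabilityMeasure P']
    {E : ℕ → Ω' → ℝ} (hE : IsIIDExponential P' E) (ℓ : ℕ) :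
    ∃ (e : ℕ → ℝ) (O : ℕ → Ω → Fin (ℓ + 1) → ℝ), (∀ n, 0 < e n) ∧ Tendsto e atTop (𝓝 0) ∧
      TendstoInDistribution O atTop (fun ω => partialSums ℓ fun i => E i ω) (fun _ => P) P' ∧
      ∀ k : ℝ, 0 < k → (∀ N : ℤ, k * p₀ ≠ N) → ∀ j : Fin (ℓ + 1), (j : ℕ) + 1 = rank k p₀ →
        Tendsto (fun n : ℕ => P {ω | ¬ (qhat n (1 - k / n) ω =
          prodFrontier T x - e n * (O n ω j / p₀) ^ (-ξ₀))}) atTop (𝓝 0) := by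
  obtain ⟨hz, hz0, hYpos, hzpos⟩ := prodFrontier_eq_sSup hX hY hTnonneg hdisposal hdata hp₀ hp₀pos
    hreach hev.2.1
  obtain ⟨e, he0, helim, he⟩ := exists_scale_gap hX hY hp₀ hp₀pos hev hz0 hz hzpos
  set z := prodFrontier T x with hzdef
  have hξ := hev.1
  have hb : 0 < -1 / ξ₀ := div_pos_of_neg_of_neg (by norm_num) hξ
  set g : ℕ → ℝ → ℝ := fun n y => p₀ * (max y 0 / e n) ^ (-1 / ξ₀) with hg
  have hgmono : ∀ n, Monotone (g n) := fun n y y' h => by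
    have h1 : max y 0 / e n ≤ max y' 0 / e n :=
      div_le_div_of_nonneg_right (max_le_max_right _ h) (he0 n).le
    exact mul_le_mul_of_nonneg_left (Real.rpow_le_rpow
      (div_nonneg (le_max_right _ _) (he0 n).le) h1 hb.le) hp₀pos.le
  have hgm : ∀ n, Measurable (g n) := fun n => (hgmono n).measurable
  have hGm : ∀ n, Measurable fun u => g n (gap x z u) := fun n => (hgm n).comp (measurable_gap x z)
  set V : ℕ → ℕ → Ω → ℝ := fun n i ω => g n (gap x z (X i ω, Y i ω)) with hV
  have hVm : ∀ n i, Measurable (V n i) := fun n i => (hGm n).comp ((hX i).prodMk (hY i))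
  have hνprob : ∀ n, IsProbabilityMeasure (P.map (V n 0)) := fun n =>
    Measure.isProbabilityMeasure_map (hVm n 0).aemeasurable
  have hdist := tendstoInDistribution_orderStat hVm
    (fun n => hindep.comp (fun _ u => g n (gap x z u)) fun _ => hGm n)
    (ν := fun n => P.map (V n 0)) (fun n i => ((hident i).comp (hGm n)).map_eq)
    (fun γ hγ => by
      refine (he γ hγ).congr fun n => ?_
      rw [map_measureReal_apply (hVm n 0) measurableSet_Iic]
      rfl)
    (measurable_partialSums hE ℓ) (hE.ae_partialSums_strictMono ℓ)
    fun c d hc hcd hsep => hE.measure_partialSums_box ℓ hc hcd hsep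
  refine ⟨e, _, he0, helim, hdist, fun k hk hkint j hj => ?_⟩
  refine tendsto_of_tendsto_of_tendsto_of_le_of_le' tendsto_const_nhds
    (tendsto_measure_qhat_ne hX hindep hident hp₀ hYpos hqhat hk hkint hj)
    (Eventually.of_forall fun n => zero_le) ?_
  filter_upwards [eventually_gt_atTop (j : ℕ)] with n hn
  refine measure_mono_ae ?_
  filter_upwards [ae_all_iff.2 hYpos] with ω hω
  simp only [le_Prop_eq]
  intro hbad hgood
  apply hbad
  rw [hgood]
  congr 1
  have hos := orderStat_comp_monotone (v := fun i => gap x z (X i ω, Y i ω)) (hgmono n) hn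
  change _ = e n * (orderStat n (fun i => g n (gap x z (X i ω, Y i ω))) j / p₀) ^ (-ξ₀)
  rw [hos]
  have h0 : 0 ≤ orderStat n (fun i => gap x z (X i ω, Y i ω)) j := by
    rw [orderStat, dif_pos hn]
    set i := Tuple.sort (fun i : Fin n => gap x z (X i ω, Y i ω)) ⟨j, hn⟩
    by_cases hle : X i ω ≤ x
    · rw [gap_of_le hle]
      have := (hω i hle).2
      simp only; linarith
    · rw [gap_of_not_le hle]; linarith
  set y := orderStat n (fun i => gap x z (X i ω, Y i ω)) j
  simp only [hg]
  rw [max_eq_left h0, mul_div_cancel_left₀ _ hp₀pos.ne', ← Real.rpow_mul (div_nonneg h0 (he0 n).le)]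
  have : -1 / ξ₀ * -ξ₀ = 1 := by
    have := hξ.ne
    field_simp
  rw [this, Real.rpow_one, mul_div_cancel₀ _ (he0 n).ne']

end FirstStage

/-! ### Elementary bounds for powers -/

theorem one_sub_rpow_ge {a t : ℝ} (ha : 0 < a) (ht0 : 0 ≤ t) (ht1 : t ≤ 1) :
    min 1 a * (1 - t) ≤ 1 - t ^ a := by
  rcases le_total 1 a with h | h
  · rw [min_eq_left h]
    have : t ^ a ≤ t ^ (1 : ℝ) := Real.rpow_le_rpow_of_exponent_ge' ht0 ht1 zero_le_one h
    rw [Real.rpow_one] at this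
    linarith
  · rw [min_eq_right h]
    have := rpow_one_add_le_one_add_mul_self (s := t - 1) (by linarith) ha.le h
    rw [add_sub_cancel] at this
    linarith

theorem one_sub_rpow_le {a t : ℝ} (ha : 0 < a) (ht0 : 0 ≤ t) (ht1 : t ≤ 1) :
    1 - t ^ a ≤ max 1 a * (1 - t) := by
  rcases le_total 1 a with h | h
  · rw [max_eq_right h]
    have := one_add_mul_self_le_rpow_one_add (s := t - 1) (by linarith) h
    rw [add_sub_cancel] at this
    linarith
  · rw [max_eq_left h]
    have : t ^ (1 : ℝ) ≤ t ^ a := Real.rpow_le_rpow_of_exponent_ge' ht0 ht1 ha.le h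
    rw [Real.rpow_one] at this
    linarith

theorem rpow_sub_rpow_eq {a g s : ℝ} (hg : 0 ≤ g) (hs : 0 < s) :
    s ^ a - g ^ a = s ^ a * (1 - (g / s) ^ a) := by
  rw [Real.div_rpow hg hs.le, mul_sub, mul_one, mul_div_cancel₀ _ (Real.rpow_pos_of_pos hs a).ne']

theorem rpow_le_one_add_rpow {y s t : ℝ} (hy : 0 < y) (hs : 0 ≤ s) (hst : s ≤ t) :
    y ^ (-s) ≤ 1 + y ^ (-t) := by
  rcases le_total 1 y with h | h
  · have h1 : y ^ (-s) ≤ 1 := Real.rpow_le_one_of_one_le_of_nonpos h (by linarith)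
    have h2 := Real.rpow_pos_of_pos hy (-t)
    linarith
  · have h1 : y ^ (-s) ≤ y ^ (-t) := Real.rpow_le_rpow_of_exponent_ge hy h (by linarith)
    linarith

/-- Small negative powers of `(g + e) ^ a - g ^ a` are bounded by integrable functions, uniformly
for `a` in a compact interval. -/
theorem rpow_sub_rpow_neg_le {a₁ a₂ a g e κ : ℝ} (ha₁ : 0 < a₁) (h1 : a₁ ≤ a) (h2 : a ≤ a₂)
    (hg : 0 ≤ g) (he : 0 < e) (hκ : κ = 1 / (2 * (1 + a₂))) :
    ((g + e) ^ a - g ^ a) ^ (-κ) ≤ (min 1 a₁)⁻¹ * ((1 + g) * ((1 + e) * (1 + e ^ (-(1 / 2) : ℝ)))) := by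
  have ha : 0 < a := ha₁.trans_le h1
  have ha₂ : 0 < a₂ := ha.trans_le h2
  have hκ0 : 0 < κ := by rw [hκ]; positivity
  have hκ1 : κ ≤ 1 / 2 := by
    rw [hκ]
    exact one_div_le_one_div_of_le (by norm_num) (by linarith)
  have haκ : a * κ ≤ 1 / 2 := by
    rw [hκ, mul_one_div, div_le_iff₀ (by positivity)]
    linarith
  set s := g + e with hs
  have hs0 : 0 < s := by positivity
  have hes : e ≤ s := by linarith
  set c := min 1 a₁ with hc
  have hc0 : 0 < c := lt_min one_pos ha₁
  have hc1 : c ≤ 1 := min_le_left _ _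
  have hlow : c * (e * s ^ (a - 1)) ≤ s ^ a - g ^ a := by
    rw [rpow_sub_rpow_eq hg hs0]
    have h3 := one_sub_rpow_ge ha (div_nonneg hg hs0.le) ((div_le_one hs0).2 (by linarith))
    have h4 : 1 - g / s = e / s := by field_simp; linarith
    rw [h4] at h3
    have h5 : c ≤ min 1 a := min_le_min_left _ h1
    have hsa := Real.rpow_pos_of_pos hs0 a
    calc c * (e * s ^ (a - 1)) = s ^ a * (c * (e / s)) := by
          rw [Real.rpow_sub_one hs0.ne']; ring
      _ ≤ s ^ a * (min 1 a * (e / s)) := by gcongr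
      _ ≤ _ := mul_le_mul_of_nonneg_left h3 hsa.le
  have hpos : 0 < c * (e * s ^ (a - 1)) := by positivity
  have hsa1 := Real.rpow_pos_of_pos hs0 (a - 1)
  have step1 : (s ^ a - g ^ a) ^ (-κ) ≤ c⁻¹ * (e ^ (-κ) * (s ^ (a - 1)) ^ (-κ)) := by
    calc (s ^ a - g ^ a) ^ (-κ) ≤ (c * (e * s ^ (a - 1))) ^ (-κ) :=
          Real.rpow_le_rpow_of_nonpos hpos hlow (by linarith)
      _ = c ^ (-κ) * (e ^ (-κ) * (s ^ (a - 1)) ^ (-κ)) := by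
          rw [Real.mul_rpow hc0.le (by positivity), Real.mul_rpow he.le hsa1.le]
      _ ≤ c⁻¹ * (e ^ (-κ) * (s ^ (a - 1)) ^ (-κ)) := by
          gcongr
          rw [← Real.rpow_neg_one]
          exact Real.rpow_le_rpow_of_exponent_ge hc0 hc1 (by linarith)
  refine step1.trans (mul_le_mul_of_nonneg_left ?_ (by positivity))
  rcases le_total 1 a with h | h
  · have h3 : (s ^ (a - 1)) ^ (-κ) ≤ (e ^ (a - 1)) ^ (-κ) :=
      Real.rpow_le_rpow_of_nonpos (Real.rpow_pos_of_pos he _)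
        (Real.rpow_le_rpow he.le hes (by linarith)) (by linarith)
    calc e ^ (-κ) * (s ^ (a - 1)) ^ (-κ) ≤ e ^ (-κ) * (e ^ (a - 1)) ^ (-κ) := by gcongr
      _ = e ^ (-(a * κ)) := by
          rw [← Real.rpow_mul he.le, ← Real.rpow_add he]; congr 1; ring
      _ ≤ 1 + e ^ (-(1 / 2) : ℝ) := rpow_le_one_add_rpow he (by positivity) haκ
      _ ≤ (1 + g) * ((1 + e) * (1 + e ^ (-(1 / 2) : ℝ))) := by
          have h4 : 1 ≤ (1 + g) * (1 + e) := by nlinarith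
          calc 1 + e ^ (-(1 / 2) : ℝ) = 1 * (1 + e ^ (-(1 / 2) : ℝ)) := (one_mul _).symm
            _ ≤ ((1 + g) * (1 + e)) * (1 + e ^ (-(1 / 2) : ℝ)) := by gcongr
            _ = _ := by ring
  · have h3 : (s ^ (a - 1)) ^ (-κ) ≤ (1 + g) * (1 + e) := by
      rw [← Real.rpow_mul hs0.le]
      have h4 : 0 ≤ (a - 1) * -κ := mul_nonneg_of_nonpos_of_nonpos (by linarith) (by linarith)
      have h5 : (a - 1) * -κ ≤ 1 := by nlinarith
      calc s ^ ((a - 1) * -κ) ≤ (1 + s) ^ ((a - 1) * -κ) :=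
            Real.rpow_le_rpow hs0.le (by linarith) h4
        _ ≤ (1 + s) ^ (1 : ℝ) := Real.rpow_le_rpow_of_exponent_le (by linarith) h5
        _ = 1 + s := Real.rpow_one _
        _ ≤ (1 + g) * (1 + e) := by nlinarith
    have h4 : e ^ (-κ) ≤ 1 + e ^ (-(1 / 2) : ℝ) := rpow_le_one_add_rpow he hκ0.le hκ1
    calc e ^ (-κ) * (s ^ (a - 1)) ^ (-κ) ≤ (1 + e ^ (-(1 / 2) : ℝ)) * ((1 + g) * (1 + e)) := by
          gcongr
      _ = _ := by ring

theorem pow_mul_exp_neg_le {r s : ℝ} (hr : 0 < r) (hs : 0 ≤ s) (N : ℕ) :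
    (1 + s) ^ N * Real.exp (-(r * s)) ≤ N.factorial / r ^ N * Real.exp r := by
  have h := Real.pow_div_factorial_le_exp (x := r * (1 + s)) (by positivity) N
  have hN : (0 : ℝ) < N.factorial := by exact_mod_cast N.factorial_pos
  rw [mul_pow, div_le_iff₀ hN, mul_add, mul_one, Real.exp_add] at h
  rw [Real.exp_neg, ← div_eq_mul_inv, div_le_iff₀ (Real.exp_pos _)]
  calc (1 + s) ^ N = (r ^ N * (1 + s) ^ N) / r ^ N := by field_simp
    _ ≤ (Real.exp r * Real.exp (r * s) * N.factorial) / r ^ N := by gcongr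
    _ = _ := by ring

/-! ### Moments of exponential variables -/

theorem lintegral_expMeasure_eq {r : ℝ} {h : ℝ → ℝ≥0∞} (hh : Measurable h) :
    ∫⁻ y, h y ∂ProbabilityTheory.expMeasure r =
      ∫⁻ y in Ioi 0, ENNReal.ofReal (r * Real.exp (-(r * y))) * h y := by
  rw [expMeasure_eq_withDensity,
    lintegral_withDensity_eq_lintegral_mul _ (measurable_exponentialPDF r) hh,
    ← lintegral_indicator measurableSet_Ioi]
  refine lintegral_congr_ae ?_
  have h0 : ∀ᵐ y : ℝ, y ≠ 0 := by simp [ae_iff]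
  filter_upwards [h0] with y hy
  rw [Pi.mul_apply]
  rcases lt_or_gt_of_ne hy with h1 | h1
  · rw [ProbabilityTheory.exponentialPDF_of_neg h1, zero_mul,
      indicator_of_notMem (by simpa using h1.le)]
  · rw [ProbabilityTheory.exponentialPDF_of_nonneg h1.le, indicator_of_mem (by exact h1)]

theorem lintegral_rpow_expMeasure_lt_top {r s : ℝ} (hr : 0 < r) (hs : -1 < s) :
    ∫⁻ y, ENNReal.ofReal (y ^ s) ∂ProbabilityTheory.expMeasure r < ∞ := by
  rw [lintegral_expMeasure_eq (by fun_prop)]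
  have hint := integrableOn_rpow_mul_exp_neg_mul_rpow (p := 1) hs one_pos hr
  have h2 : IntegrableOn (fun y : ℝ => r * Real.exp (-(r * y)) * y ^ s) (Ioi 0) := by
    refine (hint.const_mul r).congr (Eventually.of_forall fun y => ?_)
    simp only [Real.rpow_one, neg_mul]
    ring
  refine lt_of_le_of_lt (lintegral_mono fun y => ?_) h2.lintegral_lt_top
  rw [ENNReal.ofReal_mul (by positivity : 0 ≤ r * Real.exp (-(r * y)))]

/-- Uniform bound for small negative moments of `γ_m ^ a - γ₀ ^ a` on `γ₀ < γ_m`, when `γ₀`, `γ_m` are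
independent exponential variables. -/
theorem exists_lintegral_rpow_sub_rpow_le {r a₁ a₂ : ℝ} (hr : 0 < r) (ha₁ : 0 < a₁) :
    ∃ C : ℝ≥0∞, C ≠ ∞ ∧ ∀ a ∈ Icc a₁ a₂,
      ∫⁻ g, ∫⁻ y in Ioi g, ENNReal.ofReal ((y ^ a - g ^ a) ^ (-(1 / (2 * (1 + a₂)))))
        ∂ProbabilityTheory.expMeasure r ∂ProbabilityTheory.expMeasure r ≤ C := by
  set ν := ProbabilityTheory.expMeasure r with hν
  have : IsProbabilityMeasure ν := ProbabilityTheory.isProbabilityMeasure_expMeasure hr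
  set A : ℝ≥0∞ := ∫⁻ y, ENNReal.ofReal ((1 + y) * (1 + y ^ (-(1 / 2) : ℝ))) ∂ν with hA
  set B : ℝ≥0∞ := ∫⁻ g, ENNReal.ofReal (1 + g) ∂ν with hB
  have hmom : ∀ s : ℝ, -1 < s → ∫⁻ y, ENNReal.ofReal (y ^ s) ∂ν < ∞ := fun s hs =>
    lintegral_rpow_expMeasure_lt_top hr hs
  have hνpos : ∀ᵐ y ∂ν, 0 < y := ae_expMeasure_pos r
  have hBfin : B < ∞ := by
    refine lt_of_le_of_lt (b := ∫⁻ g, (1 + ENNReal.ofReal (g ^ (1 : ℝ))) ∂ν) ?_ ?_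
    · refine lintegral_mono fun g => ?_
      rw [Real.rpow_one]
      exact ENNReal.ofReal_add_le.trans (by simp)
    · rw [lintegral_add_left measurable_const]
      simpa using hmom 1 (by norm_num)
  have hAfin : A < ∞ := by
    refine lt_of_le_of_lt (b := ∫⁻ y, (((1 + ENNReal.ofReal (y ^ (1 : ℝ))) +
      ENNReal.ofReal (y ^ (-(1 / 2) : ℝ))) + ENNReal.ofReal (y ^ ((1 / 2) : ℝ))) ∂ν) ?_ ?_
    · refine lintegral_mono_ae (hνpos.mono fun y hy => ?_)
      have h1 : (1 + y) * (1 + y ^ (-(1 / 2) : ℝ)) =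
          ((1 + y ^ (1 : ℝ)) + y ^ (-(1 / 2) : ℝ)) + y ^ ((1 / 2) : ℝ) := by
        have : y * y ^ (-(1 / 2) : ℝ) = y ^ ((1 / 2) : ℝ) := by
          nth_rw 1 [← Real.rpow_one y]
          rw [← Real.rpow_add hy]; norm_num
        rw [Real.rpow_one]
        linear_combination this
      rw [h1]
      refine ENNReal.ofReal_add_le.trans (add_le_add_left (ENNReal.ofReal_add_le.trans
        (add_le_add_left (ENNReal.ofReal_add_le.trans (by simp)) _)) _)
    · rw [lintegral_add_right _ (by fun_prop), lintegral_add_right _ (by fun_prop),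
        lintegral_add_left measurable_const]
      have h1 := hmom 1 (by norm_num)
      have h2 := hmom (-(1 / 2)) (by norm_num)
      have h3 := hmom (1 / 2) (by norm_num)
      simp only [lintegral_const, measure_univ, mul_one]
      exact ENNReal.add_lt_top.2 ⟨ENNReal.add_lt_top.2 ⟨ENNReal.add_lt_top.2
        ⟨ENNReal.one_lt_top, h1⟩, h2⟩, h3⟩
  refine ⟨ENNReal.ofReal (min 1 a₁)⁻¹ * (B * A), ENNReal.mul_ne_top ENNReal.ofReal_ne_top
    (ENNReal.mul_ne_top hBfin.ne hAfin.ne), fun a hmem => ?_⟩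
  set κ := 1 / (2 * (1 + a₂)) with hκ
  set F : ℝ → ℝ := fun e => (1 + e) * (1 + e ^ (-(1 / 2) : ℝ)) with hF
  have hinner : ∀ g, 0 < g → ∫⁻ y in Ioi g, ENNReal.ofReal ((y ^ a - g ^ a) ^ (-κ)) ∂ν ≤
      ENNReal.ofReal (min 1 a₁)⁻¹ * (ENNReal.ofReal (1 + g) * A) := by
    intro g hg
    have hm : Measurable ((Ioi g).indicator fun y => ENNReal.ofReal ((y ^ a - g ^ a) ^ (-κ))) := by
      refine Measurable.indicator ?_ measurableSet_Ioi
      fun_prop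
    rw [← lintegral_indicator measurableSet_Ioi, lintegral_expMeasure_eq hm,
      ← lintegral_indicator measurableSet_Ioi,
      -- shift by `g`, using that the exponential density decreases
      ← lintegral_add_left_eq_self _ g, hA, lintegral_expMeasure_eq (by fun_prop),
      ← lintegral_const_mul _ (by fun_prop), ← lintegral_const_mul _ (by fun_prop),
      ← lintegral_indicator measurableSet_Ioi]
    refine lintegral_mono fun e => ?_
    by_cases he : 0 < e
    · have h1 : g + e ∈ Ioi (0 : ℝ) := by exact add_pos hg he
      have h2 : g + e ∈ Ioi g := by simpa using he
      rw [indicator_of_mem h1, indicator_of_mem h2, indicator_of_mem (by exact he)]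
      have h3 := rpow_sub_rpow_neg_le ha₁ hmem.1 hmem.2 hg.le he hκ
      rw [← ENNReal.ofReal_mul (by positivity), ← ENNReal.ofReal_mul (by positivity),
        ← ENNReal.ofReal_mul (by positivity), ← ENNReal.ofReal_mul (by positivity)]
      refine ENNReal.ofReal_le_ofReal ?_
      have h4 : Real.exp (-(r * (g + e))) ≤ Real.exp (-(r * e)) :=
        Real.exp_le_exp.2 (by nlinarith)
      have h5 : 0 ≤ ((g + e) ^ a - g ^ a) ^ (-κ) := Real.rpow_nonneg (sub_nonneg.2
        (Real.rpow_le_rpow hg.le (by linarith) (ha₁.trans_le hmem.1).le)) _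
      calc r * Real.exp (-(r * (g + e))) * ((g + e) ^ a - g ^ a) ^ (-κ) ≤
          r * Real.exp (-(r * e)) *
            ((min 1 a₁)⁻¹ * ((1 + g) * ((1 + e) * (1 + e ^ (-(1 / 2) : ℝ))))) := by gcongr
        _ = _ := by ring
    · have h2 : g + e ∉ Ioi g := by simpa using he
      simp only [indicator, h2, if_false, mul_zero, ite_self]
      exact zero_le
  calc ∫⁻ g, ∫⁻ y in Ioi g, ENNReal.ofReal ((y ^ a - g ^ a) ^ (-κ)) ∂ν ∂ν ≤
      ∫⁻ g, ENNReal.ofReal (min 1 a₁)⁻¹ * (ENNReal.ofReal (1 + g) * A) ∂ν :=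
        lintegral_mono_ae (hνpos.mono fun g hg => hinner g hg)
    _ = ENNReal.ofReal (min 1 a₁)⁻¹ * (B * A) := by
        rw [lintegral_const_mul _ (by fun_prop), lintegral_mul_const _ (by fun_prop)]

/-! ### A polynomial bound for the density of the limit vector -/

/-- The vector of `-γ_{j l} ^ a / (γ_{jm} ^ a - γ_{j₀} ^ a)`: the limit vector as a function of the
partial sums `γ` of the exponential variables, with `a = -ξ`. -/
noncomputable def powerRatio {L ℓ : ℕ} (j₀ jm : Fin (ℓ + 1)) (j : Fin L → Fin (ℓ + 1)) (a : ℝ)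
    (γ : Fin (ℓ + 1) → ℝ) (l : Fin L) : ℝ :=
  -(γ (j l)) ^ a / ((γ jm) ^ a - (γ j₀) ^ a)

theorem measurable_powerRatio {L ℓ : ℕ} (j₀ jm : Fin (ℓ + 1)) (j : Fin L → Fin (ℓ + 1)) (a : ℝ) :
    Measurable (powerRatio j₀ jm j a) :=
  measurable_pi_lambda _ fun l => by unfold powerRatio; fun_prop

theorem lintegral_pi_cons {n : ℕ} (ν : Measure ℝ) [SigmaFinite ν] {h : (Fin (n + 1) → ℝ) → ℝ≥0∞}
    (hh : Measurable h) :
    ∫⁻ x, h x ∂Measure.pi (fun _ : Fin (n + 1) => ν) =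
      ∫⁻ y, ∫⁻ x, h (Fin.cons y x) ∂Measure.pi (fun _ : Fin n => ν) ∂ν := by
  have hmp := measurePreserving_piFinSuccAbove (fun _ : Fin (n + 1) => ν) 0
  have h2 := (hmp.symm).lintegral_comp hh
  rw [← h2, lintegral_prod _ (by exact (hh.comp (MeasurableEquiv.measurable _)).aemeasurable)]
  refine lintegral_congr fun y => lintegral_congr fun x => ?_
  simp [MeasurableEquiv.piFinSuccAbove, Fin.insertNthEquiv]

theorem map_pi_comp_injective {n N : ℕ} (ν : Measure ℝ) [IsProbabilityMeasure ν] {s : Fin n → Fin N}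
    (hs : Function.Injective s) :
    (Measure.pi fun _ : Fin N => ν).map (fun γ i => γ (s i)) = Measure.pi fun _ : Fin n => ν := by
  have h0 : ProbabilityTheory.iIndepFun (fun (i : Fin N) (γ : Fin N → ℝ) => γ i)
      (Measure.pi fun _ : Fin N => ν) :=
    ProbabilityTheory.iIndepFun_pi (X := fun (_ : Fin N) (y : ℝ) => y) fun _ => aemeasurable_id
  have h := (ProbabilityTheory.iIndepFun_iff_map_fun_eq_pi_map
    (f := fun (i : Fin n) (γ : Fin N → ℝ) => γ (s i)) fun i => (measurable_pi_apply _).aemeasurable).1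
      (h0.precomp hs)
  rw [h]
  congr 1
  funext i
  exact (measurePreserving_eval (fun _ : Fin N => ν) (s i)).map_eq

/-- Under a product of identical laws, the coordinates with distinct indices `j₀`, `jm` and `j l` may be
integrated as independent variables with the same laws. -/
theorem lintegral_pi_marginal {L N : ℕ} (ν : Measure ℝ) [IsProbabilityMeasure ν] {j₀ jm : Fin N}
    {j : Fin L → Fin N} (h0m : j₀ ≠ jm) (hj : Function.Injective j) (hj0 : ∀ l, j l ≠ j₀)
    (hjm : ∀ l, j l ≠ jm) {h : ℝ → ℝ → (Fin L → ℝ) → ℝ≥0∞}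
    (hh : Measurable fun u : ℝ × ℝ × (Fin L → ℝ) => h u.1 u.2.1 u.2.2) :
    ∫⁻ γ, h (γ j₀) (γ jm) (fun l => γ (j l)) ∂Measure.pi (fun _ : Fin N => ν) =
      ∫⁻ g, ∫⁻ y, ∫⁻ x, h g y x ∂Measure.pi (fun _ : Fin L => ν) ∂ν ∂ν := by
  set s : Fin (L + 2) → Fin N := Fin.cons j₀ (Fin.cons jm j) with hs
  have hsi : Function.Injective s := by
    rw [hs, Fin.cons_injective_iff, Fin.cons_injective_iff]
    refine ⟨?_, ?_, hj⟩
    · rintro ⟨i, hi⟩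
      induction i using Fin.cases with
      | zero => exact h0m (by simpa using hi.symm)
      | succ i => exact hj0 i (by simpa using hi)
    · rintro ⟨i, hi⟩
      exact hjm i hi
  set H : (Fin (L + 2) → ℝ) → ℝ≥0∞ := fun x => h (x 0) (x 1) (fun l => x l.succ.succ) with hH
  have hproj : Measurable fun x : Fin (L + 2) → ℝ => (x 0, x 1, fun l : Fin L => x l.succ.succ) :=
    (measurable_pi_apply 0).prodMk
      ((measurable_pi_apply 1).prodMk (measurable_pi_lambda _ fun l => measurable_pi_apply _))
  have hHm : Measurable H := hh.comp hproj
  have h1 := lintegral_map (μ := Measure.pi fun _ : Fin N => ν) hHm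
    (measurable_pi_lambda (fun (γ : Fin N → ℝ) (i : Fin (L + 2)) => γ (s i))
      fun i => measurable_pi_apply _)
  rw [map_pi_comp_injective ν hsi, lintegral_pi_cons ν hHm] at h1
  rw [show (fun γ : Fin N → ℝ => h (γ j₀) (γ jm) fun l => γ (j l)) = fun γ => H fun i => γ (s i) from rfl,
    ← h1]
  refine lintegral_congr fun g => ?_
  have hm2 : Measurable fun x : Fin (L + 1) → ℝ => H (Fin.cons g x) := by
    refine hHm.comp (measurable_pi_lambda _ fun i => ?_)
    induction i using Fin.cases with
    | zero => exact measurable_const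
    | succ i => exact measurable_pi_apply i
  rw [lintegral_pi_cons ν hm2]
  rfl

/-- The probability that `x ^ a / Δ` lies within `ε` of `u ∈ [v / 2, 2 v]`, for an exponential variable
`x`, is of the order of `ε`. The constant is uniform in `a ≥ a₁` and decays in `v` faster than `1 / v`.
Both come from `s exp (-r s) ≤ C s ^ (-κ a)` with `s` of the order `(v Δ) ^ (1 / a)`, which also explains the
factor `Δ ^ (-κ)`. -/
theorem expMeasure_power_window_le {r a a₁ κ u v ε Δ : ℝ} (hr : 0 < r) (ha₁ : 0 < a₁) (ha : a₁ ≤ a)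
    (hκ0 : 0 ≤ κ) (hκ1 : κ ≤ 1) (hκa : κ * a ≤ 1) (hv : 0 < v) (hu1 : v / 2 ≤ u) (hu2 : u ≤ 2 * v)
    (hε0 : 0 < ε) (hε : ε ≤ v / 4) (hΔ : 0 < Δ) :
    ProbabilityTheory.expMeasure r {x | -x ^ a / Δ ∈ Icc (-u - ε) (-u + ε)} ≤
      ENNReal.ofReal (2 * ε * (16 * 9 ^ (1 / a₁) * max 1 (1 / a₁) * Real.exp r / r) *
        (v ^ (-1 - κ) * Δ ^ (-κ))) := by
  have ha0 : 0 < a := ha₁.trans_le ha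
  set b := 1 / a with hb
  have hb0 : 0 < b := by positivity
  have hb1 : b ≤ 1 / a₁ := one_div_le_one_div_of_le ha₁ ha
  have hab : a * b = 1 := by rw [hb]; field_simp
  set S : Set ℝ := {x | -x ^ a / Δ ∈ Icc (-u - ε) (-u + ε)} with hS
  have hSm : MeasurableSet S :=
    (by fun_prop : Measurable fun x : ℝ => -x ^ a / Δ) measurableSet_Icc
  -- `x` lies in `[A, B]`, and `s ≤ A` is a lower bound that does not depend on `u` and `ε`
  set s := (v * Δ / 4) ^ b with hs
  have hvΔ : 0 < v * Δ / 4 := by positivity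
  have hs0 : 0 < s := Real.rpow_pos_of_pos hvΔ b
  set A := ((u - ε) * Δ) ^ b with hA
  set B := ((u + ε) * Δ) ^ b with hB
  have hue : 0 < u - ε := by linarith
  have hue' : 0 < u + ε := by linarith
  have hBA : B - A ≤ 9 ^ (1 / a₁) * s * (max 1 (1 / a₁) * (4 * ε / v)) := by
    have h1 : B - A = B * (1 - ((u - ε) / (u + ε)) ^ b) := by
      rw [hA, hB, Real.div_rpow hue.le hue'.le, Real.mul_rpow hue.le hΔ.le,
        Real.mul_rpow hue'.le hΔ.le]
      have := (Real.rpow_pos_of_pos hue' b).ne'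
      field_simp
    have h2 := one_sub_rpow_le (t := (u - ε) / (u + ε)) hb0 (by positivity)
      ((div_le_one hue').2 (by linarith))
    have h3 : 1 - (u - ε) / (u + ε) ≤ 4 * ε / v := by
      rw [one_sub_div hue'.ne', div_le_div_iff₀ hue' hv]
      nlinarith
    have h4 : B ≤ 9 ^ (1 / a₁) * s := by
      calc B ≤ (9 * (v * Δ / 4)) ^ b :=
            Real.rpow_le_rpow (by positivity) (by nlinarith) hb0.le
        _ = 9 ^ b * s := by rw [Real.mul_rpow (by norm_num) hvΔ.le]
        _ ≤ 9 ^ (1 / a₁) * s := by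
            gcongr
            norm_num
    have h5 : 0 ≤ 1 - ((u - ε) / (u + ε)) ^ b := sub_nonneg.2
      (Real.rpow_le_one (by positivity) ((div_le_one hue').2 (by linarith)) hb0.le)
    rw [h1]
    refine mul_le_mul h4 (h2.trans ?_) h5 (by positivity)
    have : 0 ≤ 1 - (u - ε) / (u + ε) := sub_nonneg.2 ((div_le_one hue').2 (by linarith))
    gcongr
  have hwin : ∀ x, 0 < x → x ∈ S → x ∈ Icc A B ∧ s ≤ x := by
    intro x hx hxS
    have hxS : -u - ε ≤ -x ^ a / Δ ∧ -x ^ a / Δ ≤ -u + ε := hxS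
    rw [le_div_iff₀ hΔ, div_le_iff₀ hΔ] at hxS
    have hxa : (x ^ a) ^ b = x := by rw [← Real.rpow_mul hx.le, hab, Real.rpow_one]
    have hxa0 := Real.rpow_pos_of_pos hx a
    refine ⟨⟨?_, ?_⟩, ?_⟩
    · rw [← hxa]; exact Real.rpow_le_rpow (by positivity) (by nlinarith) hb0.le
    · rw [← hxa]; exact Real.rpow_le_rpow hxa0.le (by nlinarith) hb0.le
    · rw [← hxa]; exact Real.rpow_le_rpow hvΔ.le (by nlinarith) hb0.le
  have hprob : ProbabilityTheory.expMeasure r S ≤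
      ENNReal.ofReal (r * Real.exp (-(r * s)) * (B - A)) := by
    rw [← lintegral_indicator_one hSm, lintegral_expMeasure_eq (measurable_one.indicator hSm)]
    calc ∫⁻ y in Ioi 0, ENNReal.ofReal (r * Real.exp (-(r * y))) * S.indicator 1 y ≤
          ∫⁻ y in Ioi 0, (Icc A B).indicator (fun _ => ENNReal.ofReal (r * Real.exp (-(r * s)))) y := by
          refine setLIntegral_mono (measurable_const.indicator measurableSet_Icc) fun y hy => ?_
          by_cases hyS : y ∈ S
          · obtain ⟨h1, h2⟩ := hwin y hy hyS
            rw [indicator_of_mem hyS, indicator_of_mem h1, Pi.one_apply, mul_one]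
            gcongr
          · rw [indicator_of_notMem hyS, mul_zero]; exact zero_le
      _ ≤ ∫⁻ y, (Icc A B).indicator (fun _ => ENNReal.ofReal (r * Real.exp (-(r * s)))) y :=
          setLIntegral_le_lintegral _ _
      _ = _ := by
          rw [lintegral_indicator measurableSet_Icc, setLIntegral_const, Real.volume_Icc,
            ENNReal.ofReal_mul (by positivity : 0 ≤ r * Real.exp (-(r * s)))]
  refine hprob.trans (ENNReal.ofReal_le_ofReal ?_)
  -- write `s = s ^ (1 + κ a) (v Δ / 4) ^ (-κ)` and absorb the first factor in the exponential
  have hkey : Real.exp (-(r * s)) * s ≤ 2 / r ^ 2 * Real.exp r * (4 * (v ^ (-κ) * Δ ^ (-κ))) := by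
    have h1 : s = s ^ (1 + κ * a) * (v * Δ / 4) ^ (-κ) := by
      have h3 : (v * Δ / 4) ^ (-κ) = s ^ (-(κ * a)) := by
        rw [hs, ← Real.rpow_mul hvΔ.le]
        congr 1
        linear_combination κ * hab
      rw [h3, ← Real.rpow_add hs0]
      simp
    have h2 : s ^ (1 + κ * a) ≤ (1 + s) ^ 2 := by
      calc s ^ (1 + κ * a) ≤ (1 + s) ^ (1 + κ * a) :=
            Real.rpow_le_rpow hs0.le (by linarith) (by positivity)
        _ ≤ (1 + s) ^ (2 : ℝ) := Real.rpow_le_rpow_of_exponent_le (by linarith) (by linarith)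
        _ = (1 + s) ^ 2 := by norm_cast
    have h3 := pow_mul_exp_neg_le hr hs0.le 2
    have h4 : (v * Δ / 4) ^ (-κ) ≤ 4 * (v ^ (-κ) * Δ ^ (-κ)) := by
      rw [Real.div_rpow (by positivity) (by norm_num), Real.mul_rpow hv.le hΔ.le, div_eq_mul_inv,
        ← Real.rpow_neg (by norm_num), neg_neg, mul_comm]
      have : (4 : ℝ) ^ κ ≤ 4 ^ (1 : ℝ) := Real.rpow_le_rpow_of_exponent_le (by norm_num) hκ1
      rw [Real.rpow_one] at this
      gcongr
    calc Real.exp (-(r * s)) * s = Real.exp (-(r * s)) * (s ^ (1 + κ * a) * (v * Δ / 4) ^ (-κ)) := by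
          rw [← h1]
      _ ≤ Real.exp (-(r * s)) * ((1 + s) ^ 2 * (4 * (v ^ (-κ) * Δ ^ (-κ)))) := by
          gcongr
      _ = ((1 + s) ^ 2 * Real.exp (-(r * s))) * (4 * (v ^ (-κ) * Δ ^ (-κ))) := by ring
      _ ≤ _ := by
          refine mul_le_mul_of_nonneg_right ?_ (by positivity)
          simpa using h3
  have hv1 : v ^ (-1 - κ) = v⁻¹ * v ^ (-κ) := by
    rw [← Real.rpow_neg_one, ← Real.rpow_add hv]; rfl
  calc r * Real.exp (-(r * s)) * (B - A) ≤
      r * Real.exp (-(r * s)) * (9 ^ (1 / a₁) * s * (max 1 (1 / a₁) * (4 * ε / v))) := by gcongr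
    _ = (Real.exp (-(r * s)) * s) * (r * 9 ^ (1 / a₁) * (max 1 (1 / a₁) * (4 * ε / v))) := by ring
    _ ≤ (2 / r ^ 2 * Real.exp r * (4 * (v ^ (-κ) * Δ ^ (-κ)))) *
        (r * 9 ^ (1 / a₁) * (max 1 (1 / a₁) * (4 * ε / v))) := by gcongr
    _ = _ := by
        rw [hv1]
        field_simp
        ring

section DensityBound

variable {Ω' : Type*} [MeasurableSpace Ω'] {P' : Measure Ω'} {E : ℕ → Ω' → ℝ}

/-- A continuous density of the limit vector decays, along the negative diagonal, faster than
`v ^ (-L)`, uniformly for `a` in a compact interval. The density at `z` is bounded by the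
normalised probability of small boxes around `z`, which is estimated with the dominating product
law of `IsIIDExponential.lintegral_partialSums_le`. Each of the `L` coordinates contributes a factor
`v ^ (-1 - κ / L) Δ ^ (-κ / L)`, and `Δ ^ (-κ)` is integrable for the chosen
`κ = 1 / (2 (1 + a₂))`. -/
theorem IsIIDExponential.exists_density_le [IsProbabilityMeasure P'] (hE : IsIIDExponential P' E)
    {L ℓ : ℕ} (hL : 0 < L) {j₀ jm : Fin (ℓ + 1)} {j : Fin L → Fin (ℓ + 1)} (h0m : j₀ < jm)
    (hj : Function.Injective j) (hj0 : ∀ l, j l ≠ j₀) (hjm : ∀ l, j l ≠ jm) {a₁ a₂ : ℝ}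
    (ha₁ : 0 < a₁) :
    ∃ C : ℝ, 0 ≤ C ∧ ∀ a ∈ Icc a₁ a₂, ∀ g : (Fin L → ℝ) → ℝ, Continuous g →
      P'.map (fun ω => powerRatio j₀ jm j a (partialSums ℓ fun i => E i ω)) =
        (volume.withDensity fun z => ENNReal.ofReal (g z)) →
      ∀ v, 0 < v → ∀ z : Fin L → ℝ, (∀ l, z l ∈ Icc (-(2 * v)) (-(v / 2))) →
        g z ≤ C * v ^ (-(L : ℝ) - 1 / (2 * (1 + a₂))) := by
  set r : ℝ := 1 / (ℓ + 1 : ℕ) with hr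
  have hr0 : 0 < r := by positivity
  set ν := ProbabilityTheory.expMeasure r with hν
  have hνp : IsProbabilityMeasure ν := ProbabilityTheory.isProbabilityMeasure_expMeasure hr0
  set K : ℝ := 16 * 9 ^ (1 / a₁) * max 1 (1 / a₁) * Real.exp r / r with hK
  obtain ⟨C₁, hC₁, hC₁le⟩ := exists_lintegral_rpow_sub_rpow_le (a₂ := a₂) hr0 ha₁
  set R : ℝ≥0∞ := ((ℓ + 1 : ℕ) : ℝ≥0∞) ^ (ℓ + 1) with hR
  have hRtop : R ≠ ∞ := ENNReal.pow_ne_top (ENNReal.natCast_ne_top _)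
  refine ⟨K ^ L * (R * C₁).toReal, by positivity, fun a ha g hg hmap v hv z hz => ?_⟩
  have ha0 : 0 < a := ha₁.trans_le ha.1
  have ha₂ : 0 < a₂ := ha0.trans_le ha.2
  set κ := 1 / (2 * (1 + a₂)) with hκ
  have hL0 : (0 : ℝ) < L := by exact_mod_cast hL
  have hL1 : (1 : ℝ) ≤ L := by exact_mod_cast hL
  have hκ1 : κ / L ≤ 1 := by
    rw [div_le_one hL0]
    refine le_trans ?_ hL1
    rw [hκ, div_le_one (by positivity)]; linarith
  have hκa : κ / L * a ≤ 1 := by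
    have h1 : κ * a ≤ 1 := by
      rw [hκ, one_div_mul_eq_div, div_le_one (by positivity)]; linarith [ha.2]
    calc κ / L * a = κ * a / L := by ring
      _ ≤ κ * a := div_le_self (by positivity) hL1
      _ ≤ 1 := h1
  have hbox : ∀ ε, 0 < ε → ε ≤ v / 4 →
      P' {ω | ∀ l, powerRatio j₀ jm j a (partialSums ℓ fun i => E i ω) l ∈
        Icc (z l - ε) (z l + ε)} ≤
      ENNReal.ofReal ((2 * ε) ^ L) * (ENNReal.ofReal (K ^ L * v ^ (-(L : ℝ) - κ)) * (R * C₁)) := by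
    intro ε hε0 hε
    set D : Set (ℝ × ℝ × (Fin L → ℝ)) := {u | u.1 < u.2.1 ∧
      ∀ l, -(u.2.2 l) ^ a / (u.2.1 ^ a - u.1 ^ a) ∈ Icc (z l - ε) (z l + ε)} with hD
    have hDm : MeasurableSet D := by
      refine (measurableSet_lt measurable_fst measurable_snd.fst).inter ?_
      refine MeasurableSet.congr (MeasurableSet.iInter fun l => ?_) (ofPred_forall _).symm
      exact (by fun_prop : Measurable fun u : ℝ × ℝ × (Fin L → ℝ) =>
        -(u.2.2 l) ^ a / (u.2.1 ^ a - u.1 ^ a)) measurableSet_Icc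
    have hproj : Measurable fun γ : Fin (ℓ + 1) → ℝ => (γ j₀, γ jm, fun l => γ (j l)) := by
      fun_prop
    set h : ℝ → ℝ → (Fin L → ℝ) → ℝ≥0∞ := fun g y x => D.indicator 1 (g, y, x) with hh
    have hhm : Measurable fun u : ℝ × ℝ × (Fin L → ℝ) => h u.1 u.2.1 u.2.2 :=
      measurable_one.indicator hDm
    have h1 : P' {ω | ∀ l, powerRatio j₀ jm j a (partialSums ℓ fun i => E i ω) l ∈
        Icc (z l - ε) (z l + ε)} ≤ ∫⁻ ω, (fun γ : Fin (ℓ + 1) → ℝ =>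
          h (γ j₀) (γ jm) fun l => γ (j l)) (partialSums ℓ fun i => E i ω) ∂P' := by
      rw [← setLIntegral_one]
      have hm : MeasurableSet {ω | ∀ l, powerRatio j₀ jm j a (partialSums ℓ fun i => E i ω) l ∈
          Icc (z l - ε) (z l + ε)} := by
        rw [ofPred_forall]
        exact MeasurableSet.iInter fun l => ((measurable_pi_apply l).comp
          ((measurable_powerRatio j₀ jm j a).comp (measurable_partialSums hE ℓ))) measurableSet_Icc
      rw [← lintegral_indicator hm]
      refine lintegral_mono_ae ?_
      filter_upwards [hE.ae_partialSums_strictMono ℓ] with ω hω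
      by_cases hmem : ∀ l, powerRatio j₀ jm j a (partialSums ℓ fun i => E i ω) l ∈
          Icc (z l - ε) (z l + ε)
      · have hmemD : (partialSums ℓ (fun i => E i ω) j₀, partialSums ℓ (fun i => E i ω) jm,
            fun l => partialSums ℓ (fun i => E i ω) (j l)) ∈ D := ⟨hω.2 h0m, hmem⟩
        rw [indicator_of_mem (by exact hmem), hh]
        simp only
        rw [indicator_of_mem hmemD, Pi.one_apply]
      · rw [indicator_of_notMem (by exact hmem)]
        exact zero_le
    have h2 := hE.lintegral_partialSums_le ℓ
      (h := fun γ => h (γ j₀) (γ jm) fun l => γ (j l)) (hhm.comp hproj)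
    rw [lintegral_pi_marginal ν h0m.ne hj hj0 hjm hhm] at h2
    refine (h1.trans h2).trans ?_
    have hinner : ∀ g, 0 < g → ∀ y, ∫⁻ x, h g y x ∂Measure.pi (fun _ : Fin L => ν) ≤
        (ENNReal.ofReal ((2 * ε) ^ L) * ENNReal.ofReal (K ^ L * v ^ (-(L : ℝ) - κ))) *
          (Ioi g).indicator (fun y => ENNReal.ofReal ((y ^ a - g ^ a) ^ (-κ))) y := by
      intro g hg y
      by_cases hgy : g < y
      · set Δ := y ^ a - g ^ a with hΔ
        have hΔ0 : 0 < Δ := sub_pos.2 (Real.rpow_lt_rpow hg.le hgy ha0)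
        set S : Fin L → Set ℝ := fun l => {x | -x ^ a / Δ ∈ Icc (z l - ε) (z l + ε)} with hS
        have hSm : ∀ l, MeasurableSet (S l) := fun l =>
          (by fun_prop : Measurable fun x : ℝ => -x ^ a / Δ) measurableSet_Icc
        have h3 : ∀ x, h g y x = (Set.pi univ S).indicator 1 x := by
          intro x
          simp only [hh, indicator, hD, hS, mem_ofPred_eq, mem_univ_pi, hgy, true_and, Pi.one_apply]
          rfl
        simp_rw [h3]
        rw [lintegral_indicator_one (MeasurableSet.univ_pi hSm), Measure.pi_pi,
          indicator_of_mem (by exact hgy)]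
        have h4 : ∀ l, ν (S l) ≤ ENNReal.ofReal (2 * ε * K *
            (v ^ (-1 - κ / L) * Δ ^ (-(κ / L)))) := by
          intro l
          have := expMeasure_power_window_le (u := -z l) hr0 ha₁ ha.1 (by positivity) hκ1 hκa hv
            (by linarith [(hz l).2]) (by linarith [(hz l).1]) hε0 hε hΔ0
          rwa [neg_neg] at this
        refine (Finset.prod_le_prod' fun l _ => h4 l).trans ?_
        rw [Finset.prod_const, Finset.card_univ, Fintype.card_fin, ← ENNReal.ofReal_pow (by positivity),
          ← ENNReal.ofReal_mul (by positivity), ← ENNReal.ofReal_mul (by positivity)]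
        refine ENNReal.ofReal_le_ofReal (le_of_eq ?_)
        have h5 : (v ^ (-1 - κ / L)) ^ L = v ^ (-(L : ℝ) - κ) := by
          rw [← Real.rpow_natCast, ← Real.rpow_mul hv.le]
          congr 1
          field_simp
        have h6 : (Δ ^ (-(κ / L))) ^ L = Δ ^ (-κ) := by
          rw [← Real.rpow_natCast, ← Real.rpow_mul hΔ0.le]
          congr 1
          field_simp
        rw [mul_pow _ (v ^ _ * _), mul_pow (v ^ _), h5, h6, hΔ]
        ring_nf
      · have h3 : ∀ x, h g y x = 0 := fun x => by
          simp only [hh, indicator, hD, mem_ofPred_eq, hgy, false_and, if_false]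
        simp [h3]
    calc R * ∫⁻ g, ∫⁻ y, ∫⁻ x, h g y x ∂Measure.pi (fun _ : Fin L => ν) ∂ν ∂ν ≤
        R * ∫⁻ g, (ENNReal.ofReal ((2 * ε) ^ L) * ENNReal.ofReal (K ^ L * v ^ (-(L : ℝ) - κ))) *
          ∫⁻ y in Ioi g, ENNReal.ofReal ((y ^ a - g ^ a) ^ (-κ)) ∂ν ∂ν := by
          refine mul_le_mul_right (lintegral_mono_ae ?_) R
          refine ((ae_expMeasure_pos r).mono fun g hg => ?_)
          refine (lintegral_mono (hinner g hg)).trans ?_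
          rw [lintegral_const_mul' _ _ (by finiteness), lintegral_indicator measurableSet_Ioi]
      _ ≤ R * ((ENNReal.ofReal ((2 * ε) ^ L) * ENNReal.ofReal (K ^ L * v ^ (-(L : ℝ) - κ))) * C₁) := by
          rw [lintegral_const_mul' _ _ (by finiteness)]
          gcongr
          exact hC₁le a ha
      _ = _ := by ring
  -- by continuity `g > c` on a small box around `z`, whose volume is `(2 ε) ^ L`
  refine le_of_forall_lt_imp_le_of_dense fun c hc => ?_
  rcases le_or_gt c 0 with hc0 | hc0
  · exact hc0.trans (by positivity)
  have hnear : ∀ᶠ z' in 𝓝 z, c < g z' := hg.continuousAt.eventually_const_lt hc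
  obtain ⟨ε₀, hε₀, hball⟩ := Metric.eventually_nhds_iff_ball.1 hnear
  set ε := min (ε₀ / 2) (v / 4) with hε
  have hεpos : 0 < ε := by positivity
  have h1 := hbox ε hεpos (min_le_right _ _)
  set S : Set (Fin L → ℝ) := Set.pi univ fun l => Icc (z l - ε) (z l + ε) with hS
  have hSm : MeasurableSet S := MeasurableSet.univ_pi fun l => measurableSet_Icc
  have h2 : P' {ω | ∀ l, powerRatio j₀ jm j a (partialSums ℓ fun i => E i ω) l ∈
      Icc (z l - ε) (z l + ε)} = ∫⁻ z' in S, ENNReal.ofReal (g z') := by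
    have hm : Measurable fun ω => powerRatio j₀ jm j a (partialSums ℓ fun i => E i ω) :=
      (measurable_powerRatio j₀ jm j a).comp (measurable_partialSums hE ℓ)
    rw [← withDensity_apply _ hSm, ← hmap, Measure.map_apply hm hSm]
    congr 1
    ext ω
    simp only [hS, mem_preimage, mem_univ_pi, mem_ofPred_eq]
  have h3 : ENNReal.ofReal ((2 * ε) ^ L) * ENNReal.ofReal c ≤ ∫⁻ z' in S, ENNReal.ofReal (g z') := by
    have hvol : volume S = ENNReal.ofReal ((2 * ε) ^ L) := by
      rw [hS, volume_pi_pi]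
      simp only [Real.volume_Icc]
      rw [ENNReal.ofReal_pow (by positivity)]
      simp [← two_mul]
    rw [mul_comm, ← hvol, ← setLIntegral_const]
    refine setLIntegral_mono (by fun_prop) fun z' hz' => ENNReal.ofReal_le_ofReal (hball z' ?_).le
    rw [Metric.mem_ball, dist_pi_lt_iff hε₀]
    intro l
    have := hz' l (mem_univ l)
    rw [Real.dist_eq]
    have hε2 : ε ≤ ε₀ / 2 := min_le_left _ _
    have : |z' l - z l| ≤ ε := abs_le.2 ⟨by linarith [this.1], by linarith [this.2]⟩
    linarith
  have hpos : ENNReal.ofReal ((2 * ε) ^ L) ≠ 0 := by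
    simp only [ne_eq, ENNReal.ofReal_eq_zero, not_le]; positivity
  have h4 : ENNReal.ofReal c ≤ ENNReal.ofReal (K ^ L * v ^ (-(L : ℝ) - κ)) * (R * C₁) := by
    rw [← h2] at h3
    exact (ENNReal.mul_le_mul_iff_right hpos ENNReal.ofReal_ne_top).1 (h3.trans h1)
  have hfin : R * C₁ ≠ ∞ := ENNReal.mul_ne_top hRtop hC₁
  rw [← ENNReal.ofReal_toReal hfin, ← ENNReal.ofReal_mul (by positivity),
    ENNReal.ofReal_le_ofReal_iff (by positivity)] at h4
  calc c ≤ _ := h4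
    _ = _ := by ring

end DensityBound
/-! ### First moment of a scalar limit vector -/

section FirstMoment

variable {Ω' : Type*} [MeasurableSpace Ω'] {P' : Measure Ω'} {E : ℕ → Ω' → ℝ}

theorem IsIIDExponential.lintegral_finsetProd [IsProbabilityMeasure P'] (hE : IsIIDExponential P' E) {n : ℕ}
    {φ : ℕ → ℝ → ℝ≥0∞} (hφ : ∀ i, Measurable (φ i)) :
    ∫⁻ ω, ∏ i ∈ Finset.range n, φ i (E i ω) ∂P' =
      ∏ i ∈ Finset.range n, ∫⁻ y, φ i y ∂ProbabilityTheory.expMeasure 1 := by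
  have : IsProbabilityMeasure (ProbabilityTheory.expMeasure 1) :=
    ProbabilityTheory.isProbabilityMeasure_expMeasure one_pos
  have hm : Measurable fun x : Fin n → ℝ => ∏ i : Fin n, φ i (x i) :=
    Finset.measurable_prod _ fun i _ => (hφ i).comp (measurable_pi_apply i)
  have h := lintegral_map (μ := P') hm (measurable_pi_lambda (fun ω (i : Fin n) => E i ω)
    fun i => hE.1 i)
  rw [hE.map_eq_pi, lintegral_pi_prod (fun _ : Fin n => ProbabilityTheory.expMeasure 1)
    (fun i : Fin n => hφ i)] at h
  rw [Finset.prod_range fun i => ∫⁻ y, φ i y ∂ProbabilityTheory.expMeasure 1, h]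
  simp_rw [Finset.prod_range]

theorem lintegral_inv_Ioc_eq_top : ∫⁻ y in Ioc (0 : ℝ) 1, ENNReal.ofReal y⁻¹ = ∞ := by
  by_contra h
  have h1 : IntegrableOn (fun y : ℝ => y⁻¹) (Ioc 0 1) := by
    refine ⟨by fun_prop, ?_⟩
    rw [hasFiniteIntegral_iff_ofReal]
    · exact lt_top_iff_ne_top.2 h
    · filter_upwards [ae_restrict_mem measurableSet_Ioc] with y hy
      exact inv_nonneg.2 hy.1.le
  have h2 := (intervalIntegrable_iff_integrableOn_Ioc_of_le (zero_le_one' ℝ)).2 h1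
  rw [intervalIntegrable_inv_iff] at h2
  simp at h2

theorem le_expMeasure_Ioc {l t : ℝ} (hl0 : 0 ≤ l) (hl1 : l ≤ 1) (ht1 : t ≤ 1) :
    ENNReal.ofReal (Real.exp (-2) * t) ≤ ProbabilityTheory.expMeasure 1 (Ioc l (l + t)) := by
  rw [← lintegral_indicator_one measurableSet_Ioc,
    lintegral_expMeasure_eq (measurable_one.indicator measurableSet_Ioc)]
  calc ENNReal.ofReal (Real.exp (-2) * t) =
      ∫⁻ y in Ioi 0, (Ioc l (l + t)).indicator (fun _ => ENNReal.ofReal (Real.exp (-2))) y := by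
        have hsub : Ioc l (l + t) ⊆ Ioi 0 := fun y hy => hl0.trans_lt hy.1
        rw [lintegral_indicator measurableSet_Ioc, Measure.restrict_restrict measurableSet_Ioc,
          inter_eq_left.2 hsub, setLIntegral_const, Real.volume_Ioc,
          add_sub_cancel_left, ENNReal.ofReal_mul (Real.exp_pos _).le]
    _ ≤ _ := by
        refine lintegral_mono fun y => ?_
        by_cases hy : y ∈ Ioc l (l + t)
        · rw [indicator_of_mem hy, indicator_of_mem hy, Pi.one_apply, mul_one, one_mul]
          refine ENNReal.ofReal_le_ofReal (Real.exp_le_exp.2 ?_)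
          linarith [hy.2]
        · rw [indicator_of_notMem hy]; exact zero_le

/-- A criterion for an infinite expectation: the variable `E q = y` is singled out, the others are
confined to intervals of length `y ^ s i`, and the random variable is at least a multiple of
`y ^ (-(1 + D))`, where `D` is the sum of the exponents `s i`. -/
theorem IsIIDExponential.lintegral_eq_top [IsProbabilityMeasure P'] (hE : IsIIDExponential P' E)
    {n q D : ℕ} (hq : q < n) {l : ℕ → ℝ} (hl : ∀ i, l i ∈ Icc 0 1) {s : ℕ → ℕ}
    (hD : ∑ i ∈ Finset.range n, s i = s q + D) {V : Ω' → ℝ≥0∞} {c : ℝ} (hc : 0 < c)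
    (hV : ∀ᵐ ω ∂P', E q ω ∈ Ioc 0 1 → (∀ i < n, i ≠ q → E i ω ∈ Ioc (l i) (l i + E q ω ^ s i)) →
      ENNReal.ofReal (c * (E q ω ^ (1 + D))⁻¹) ≤ V ω) : ∫⁻ ω, V ω ∂P' = ∞ := by
  obtain ⟨N, rfl⟩ : ∃ N, n = N + 1 := ⟨n - 1, by omega⟩
  set ν := ProbabilityTheory.expMeasure 1 with hν
  have hνp : IsProbabilityMeasure ν := ProbabilityTheory.isProbabilityMeasure_expMeasure one_pos
  set Q : Fin (N + 1) := ⟨q, hq⟩ with hQ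
  set A : Fin N → ℝ → Set ℝ := fun i y => Ioc (l (Q.succAbove i)) (l (Q.succAbove i) + y ^ s (Q.succAbove i))
    with hA
  set F : ℝ × (Fin N → ℝ) → ℝ≥0∞ := {u : ℝ × (Fin N → ℝ) | u.1 ∈ Ioc 0 1 ∧ ∀ i, u.2 i ∈ A i u.1}.indicator
    fun u => ENNReal.ofReal (c * (u.1 ^ (1 + D))⁻¹) with hF
  have hFm : Measurable F := by
    refine Measurable.indicator (by fun_prop) ?_
    refine (measurable_fst measurableSet_Ioc).inter ?_
    refine MeasurableSet.congr (MeasurableSet.iInter fun i => ?_) (ofPred_forall _).symm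
    have hmi : Measurable fun u : ℝ × (Fin N → ℝ) => u.2 i :=
      (measurable_pi_apply i).comp measurable_snd
    exact (measurableSet_lt measurable_const hmi).inter
      (measurableSet_le hmi (measurable_const.add (measurable_fst.pow_const _)))
  have hEm : Measurable fun ω => (E q ω, fun i : Fin N => E (Q.succAbove i) ω) :=
    (hE.1 q).prodMk (measurable_pi_lambda _ fun i => hE.1 _)
  have hlaw : P'.map (fun ω => (E q ω, fun i : Fin N => E (Q.succAbove i) ω)) =
      ν.prod (Measure.pi fun _ => ν) := by
    have h1 := measurePreserving_piFinSuccAbove (fun _ : Fin (N + 1) => ν) Q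
    have h2 := h1.map_eq
    rw [← hE.map_eq_pi, Measure.map_map (MeasurableEquiv.measurable _)
      (measurable_pi_lambda (fun ω (i : Fin (N + 1)) => E i ω) fun i => hE.1 i)] at h2
    rw [← h2]
    rfl
  have h1 : ∫⁻ ω, F (E q ω, fun i : Fin N => E (Q.succAbove i) ω) ∂P' ≤ ∫⁻ ω, V ω ∂P' := by
    refine lintegral_mono_ae (hV.mono fun ω hV => ?_)
    simp only [hF]
    refine indicator_apply_le' (fun h => hV h.1 fun i hi hiq => ?_) fun _ => zero_le
    obtain ⟨i', hi'⟩ := Fin.exists_succAbove_eq (x := (⟨i, hi⟩ : Fin (N + 1))) (y := Q)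
      (fun h => hiq (by simpa [hQ] using congrArg Fin.val h))
    have := h.2 i'
    simpa only [hA, hi'] using this
  rw [← lintegral_map hFm hEm, hlaw, lintegral_prod _ hFm.aemeasurable] at h1
  refine top_le_iff.1 (le_trans ?_ h1)
  have h2 : ∀ y ∈ Ioc (0 : ℝ) 1, ENNReal.ofReal (c * Real.exp (-2) ^ N * y⁻¹) ≤
      ∫⁻ x, F (y, x) ∂Measure.pi fun _ => ν := by
    intro y hy
    have h3 : ∀ x, F (y, x) =
        (Set.pi univ fun i => A i y).indicator (fun _ => ENNReal.ofReal (c * (y ^ (1 + D))⁻¹)) x := by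
      intro x
      simp only [hF, indicator, mem_ofPred_eq, mem_univ_pi, hy, true_and]
    simp_rw [h3]
    rw [lintegral_indicator (MeasurableSet.univ_pi fun i => measurableSet_Ioc), setLIntegral_const,
      Measure.pi_pi]
    have h4 : ∀ i : Fin N, ENNReal.ofReal (Real.exp (-2) * y ^ s (Q.succAbove i)) ≤ ν (A i y) :=
      fun i => le_expMeasure_Ioc (hl _).1 (hl _).2 (pow_le_one₀ hy.1.le hy.2)
    have hy0 := hy.1
    have hD' : ∑ i : Fin N, s (Q.succAbove i) = D := by
      rw [Finset.sum_range, Fin.sum_univ_succAbove _ Q] at hD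
      simp only [hQ] at hD ⊢
      omega
    calc ENNReal.ofReal (c * Real.exp (-2) ^ N * y⁻¹) =
        ENNReal.ofReal (c * (y ^ (1 + D))⁻¹) *
          ∏ i : Fin N, ENNReal.ofReal (Real.exp (-2) * y ^ s (Q.succAbove i)) := by
          rw [← ENNReal.ofReal_prod_of_nonneg fun i _ => by positivity,
            ← ENNReal.ofReal_mul (by positivity), Finset.prod_mul_distrib, Finset.prod_const,
            Finset.card_univ, Fintype.card_fin, Finset.prod_pow_eq_pow_sum, hD']
          congr 1
          field_simp
          ring
      _ ≤ _ := by gcongr with i; exact h4 i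
  calc (∞ : ℝ≥0∞) = ENNReal.ofReal (Real.exp (-1)) *
        (ENNReal.ofReal (c * Real.exp (-2) ^ N) * ∫⁻ y in Ioc (0 : ℝ) 1, ENNReal.ofReal y⁻¹) := by
        rw [lintegral_inv_Ioc_eq_top, ENNReal.mul_top, ENNReal.mul_top]
        · simp only [ne_eq, ENNReal.ofReal_eq_zero, not_le]; positivity
        · simp only [ne_eq, ENNReal.ofReal_eq_zero, not_le]; positivity
    _ = ∫⁻ y in Ioc (0 : ℝ) 1, ENNReal.ofReal (Real.exp (-1)) *
          ENNReal.ofReal (c * Real.exp (-2) ^ N * y⁻¹) := by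
        rw [← lintegral_const_mul _ (by fun_prop), ← lintegral_const_mul _ (by fun_prop)]
        refine lintegral_congr fun y => ?_
        rw [ENNReal.ofReal_mul (p := c * Real.exp (-2) ^ N) (by positivity)]
    _ ≤ ∫⁻ y in Ioi (0 : ℝ), ENNReal.ofReal (1 * Real.exp (-(1 * y))) *
          ∫⁻ x, F (y, x) ∂Measure.pi fun _ => ν := by
        refine le_trans (setLIntegral_mono ?_ fun y hy => mul_le_mul' ?_ (h2 y hy))
          (lintegral_mono_set Ioc_subset_Ioi_self)
        · exact Measurable.mul (by fun_prop) hFm.lintegral_prod_right'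
        · refine ENNReal.ofReal_le_ofReal ?_
          rw [one_mul, one_mul]
          exact Real.exp_le_exp.2 (by linarith [hy.2])
    _ = _ := (lintegral_expMeasure_eq hFm.lintegral_prod_right').symm

theorem lintegral_one_add_rpow_mul_rpow_lt_top {a θ : ℝ} (hθ : θ < 1) :
    ∫⁻ y, ENNReal.ofReal ((1 + y) ^ a * y ^ (-θ)) ∂ProbabilityTheory.expMeasure 1 < ∞ := by
  rw [lintegral_expMeasure_eq (by fun_prop)]
  have h1 := lintegral_rpow_expMeasure_lt_top (r := 1 / 2) (s := -θ) (by norm_num) (by linarith)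
  rw [lintegral_expMeasure_eq (by fun_prop)] at h1
  set N := ⌈a⌉₊ with hN
  set K : ℝ := N.factorial / (1 / 2) ^ N * Real.exp (1 / 2) with hK
  refine lt_of_le_of_lt (setLIntegral_mono
    (g := fun y => ENNReal.ofReal (2 * K) * (ENNReal.ofReal (1 / 2 * Real.exp (-(1 / 2 * y))) *
      ENNReal.ofReal (y ^ (-θ)))) (by fun_prop) fun y hy => ?_) ?_
  · have hy0 : 0 < y := hy
    rw [← ENNReal.ofReal_mul (by positivity), ← ENNReal.ofReal_mul (by positivity),
      ← ENNReal.ofReal_mul (by positivity)]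
    refine ENNReal.ofReal_le_ofReal ?_
    have h2 := pow_mul_exp_neg_le (r := 1 / 2) (by norm_num) hy0.le N
    have h3 : (1 + y) ^ a ≤ (1 + y) ^ N := by
      rw [← Real.rpow_natCast]
      exact Real.rpow_le_rpow_of_exponent_le (by linarith) (Nat.le_ceil a)
    have h4 : Real.exp (-(1 * y)) = Real.exp (-(1 / 2 * y)) * Real.exp (-(1 / 2 * y)) := by
      rw [← Real.exp_add]; congr 1; ring
    calc 1 * Real.exp (-(1 * y)) * ((1 + y) ^ a * y ^ (-θ)) =
        ((1 + y) ^ a * Real.exp (-(1 / 2 * y))) * (Real.exp (-(1 / 2 * y)) * y ^ (-θ)) := by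
          rw [h4]; ring
      _ ≤ K * (Real.exp (-(1 / 2 * y)) * y ^ (-θ)) := by
          refine mul_le_mul_of_nonneg_right (le_trans ?_ h2) (by positivity)
          gcongr
      _ = _ := by ring
  · rw [lintegral_const_mul _ (by fun_prop)]
    exact ENNReal.mul_lt_top ENNReal.ofReal_lt_top h1

/-- A bound for the ratio by a product of functions of the single variables. The denominator is at least
`S ^ (a - 1) G`, where `S = γ_{n_m}` and `G = γ_{n_m} - γ_{n₀}`, and the powers of `S` and `G` are
distributed over the variables by `S ≥ e_i` and `G ≥ e_i`. The total exponent is `a`, to be spread over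
`n_m` variables with every single exponent below `1`. -/
theorem power_ratio_le_prod {n₀ nm h : ℕ} (hgap : n₀ + 2 ≤ nm) (hn₀ : 0 < n₀) (hh : nm < h) {a : ℝ}
    (ha1 : 1 < a) {e : ℕ → ℝ} (he : ∀ i, 0 < e i) :
    (∑ i ∈ Finset.range h, e i) ^ a /
        ((∑ i ∈ Finset.range nm, e i) ^ a - (∑ i ∈ Finset.range n₀, e i) ^ a) ≤
      ∏ i ∈ Finset.range h, (1 + e i) ^ a * e i ^ (-(if i < n₀ then (a - 1) / (nm - 1) else
        if i < nm then (a - 1) / (nm - 1) * (1 - 1 / (nm - n₀)) + 1 / (nm - n₀) else 0)) := by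
  set S₀ := ∑ i ∈ Finset.range n₀, e i with hS₀
  set S := ∑ i ∈ Finset.range nm, e i with hS
  set G := ∑ i ∈ Finset.Ico n₀ nm, e i with hG
  have hSG : S₀ + G = S := Finset.sum_range_add_sum_Ico e (by omega)
  have hS₀pos : 0 < S₀ := Finset.sum_pos (fun i _ => he i) (by simp; omega)
  have hGpos : 0 < G := Finset.sum_pos (fun i _ => he i) (by simp; omega)
  have hSpos : 0 < S := by linarith
  have hg2 : (2 : ℝ) ≤ nm - n₀ := by
    have : ((n₀ + 2 : ℕ) : ℝ) ≤ nm := by exact_mod_cast hgap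
    push_cast at this; linarith
  set g : ℝ := nm - n₀ with hg
  -- `θ n₀ + θ (1 - 1 / g) g = θ (n_m - 1) = a - 1` is the exponent of `S`
  set θ : ℝ := (a - 1) / (nm - 1) with hθ
  have hθ0 : 0 < θ := div_pos (by linarith) (by linarith)
  have hg1 : 0 < 1 - 1 / g := by
    rw [sub_pos, div_lt_one (by linarith)]; linarith
  set t : ℕ → ℝ := fun i => if i < n₀ then θ else if i < nm then θ * (1 - 1 / g) + 1 / g else 0 with ht
  have hden : S ^ (a - 1) * G ≤ S ^ a - S₀ ^ a := by
    rw [rpow_sub_rpow_eq hS₀pos.le hSpos]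
    have h1 := one_sub_rpow_ge (a := a) (t := S₀ / S) (by linarith) (by positivity)
      ((div_le_one hSpos).2 (by linarith))
    rw [min_eq_left ha1.le, one_mul] at h1
    have h2 : 1 - S₀ / S = G / S := by rw [one_sub_div hSpos.ne']; congr 1; linarith
    rw [h2] at h1
    calc S ^ (a - 1) * G = S ^ a * (G / S) := by rw [Real.rpow_sub_one hSpos.ne']; ring
      _ ≤ _ := by gcongr
  have hprod : ∏ i ∈ Finset.range h, e i ^ t i ≤ S ^ (a - 1) * G := by
    have hsplit : ∏ i ∈ Finset.range h, e i ^ t i =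
        (∏ i ∈ Finset.range n₀, e i ^ θ) * ∏ i ∈ Finset.Ico n₀ nm, e i ^ (θ * (1 - 1 / g) + 1 / g) := by
      rw [← Finset.prod_range_mul_prod_Ico _ hh.le, ← Finset.prod_range_mul_prod_Ico _ (by omega : n₀ ≤ nm),
        Finset.prod_eq_one (s := Finset.Ico nm h), mul_one]
      · congr 1
        · exact Finset.prod_congr rfl fun i hi => by simp [ht, Finset.mem_range.1 hi]
        · refine Finset.prod_congr rfl fun i hi => ?_
          have := Finset.mem_Ico.1 hi
          simp [ht, this.2, not_lt.2 this.1]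
      · intro i hi
        have := Finset.mem_Ico.1 hi
        simp [ht, not_lt.2 this.1, not_lt.2 (show n₀ ≤ i by omega)]
    rw [hsplit]
    have h1 : ∏ i ∈ Finset.range n₀, e i ^ θ ≤ (S ^ θ) ^ n₀ := by
      have := Finset.prod_le_prod (s := Finset.range n₀) (f := fun i => e i ^ θ) (g := fun _ => S ^ θ)
        (fun i _ => (Real.rpow_pos_of_pos (he i) _).le) fun i hi =>
          Real.rpow_le_rpow (he i).le ((Finset.single_le_sum (f := e) (fun j _ => (he j).le) hi).trans
            (by linarith : S₀ ≤ S)) hθ0.le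
      simpa using this
    have h2 : ∏ i ∈ Finset.Ico n₀ nm, e i ^ (θ * (1 - 1 / g) + 1 / g) ≤
        (S ^ (θ * (1 - 1 / g)) * G ^ (1 / g)) ^ (nm - n₀) := by
      have := Finset.prod_le_prod (s := Finset.Ico n₀ nm)
        (f := fun i => e i ^ (θ * (1 - 1 / g) + 1 / g))
        (g := fun _ => S ^ (θ * (1 - 1 / g)) * G ^ (1 / g))
        (fun i _ => (Real.rpow_pos_of_pos (he i) _).le) fun i hi => by
          have h3 := Finset.single_le_sum (f := e) (fun j _ => (he j).le) hi
          have h0 := he i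
          rw [Real.rpow_add h0]
          have h4 : e i ≤ S := h3.trans (by linarith)
          gcongr
      simpa using this
    have hgn : (((nm - n₀ : ℕ) : ℕ) : ℝ) = g := by rw [Nat.cast_sub (by omega)]
    have h0 : 0 ≤ ∏ i ∈ Finset.Ico n₀ nm, e i ^ (θ * (1 - 1 / g) + 1 / g) :=
      Finset.prod_nonneg fun i _ => (Real.rpow_pos_of_pos (he i) _).le
    refine (mul_le_mul h1 h2 h0 (by positivity)).trans (le_of_eq ?_)
    rw [mul_pow, ← Real.rpow_natCast (S ^ θ), ← Real.rpow_natCast (S ^ _), ← Real.rpow_natCast (G ^ _),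
      hgn, ← Real.rpow_mul hSpos.le, ← Real.rpow_mul hSpos.le, ← Real.rpow_mul hGpos.le,
      one_div_mul_cancel (by linarith), Real.rpow_one, ← mul_assoc, ← Real.rpow_add hSpos]
    congr 2
    have hm1 : (nm : ℝ) - 1 ≠ 0 := by linarith
    calc θ * n₀ + θ * (1 - 1 / g) * g = θ * (n₀ + g - 1) := by field_simp; ring
      _ = θ * (nm - 1) := by rw [hg]; ring
      _ = a - 1 := div_mul_cancel₀ _ hm1
  have hprodpos : 0 < ∏ i ∈ Finset.range h, e i ^ t i :=
    Finset.prod_pos fun i _ => Real.rpow_pos_of_pos (he i) _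
  have hsum : ∑ i ∈ Finset.range h, e i ≤ ∏ i ∈ Finset.range h, (1 + e i) := by
    clear_value S₀ S G
    clear * - he
    have h1 : 1 + ∑ i ∈ Finset.range h, e i ≤ ∏ i ∈ Finset.range h, (1 + e i) := by
      induction h with
      | zero => simp
      | succ n ih =>
        rw [Finset.sum_range_succ, Finset.prod_range_succ]
        have h2 : 0 ≤ ∑ i ∈ Finset.range n, e i := Finset.sum_nonneg fun i _ => (he i).le
        nlinarith [he n]
    linarith
  have hnum : (∑ i ∈ Finset.range h, e i) ^ a ≤ ∏ i ∈ Finset.range h, (1 + e i) ^ a := by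
    rw [Real.finsetProd_rpow _ _ fun i _ => by linarith [he i]]
    exact Real.rpow_le_rpow (Finset.sum_nonneg fun i _ => (he i).le) hsum (by linarith)
  rw [Finset.prod_mul_distrib]
  have hneg : ∏ i ∈ Finset.range h, e i ^ (-t i) = (∏ i ∈ Finset.range h, e i ^ t i)⁻¹ := by
    rw [← Finset.prod_inv_distrib]
    exact Finset.prod_congr rfl fun i _ => Real.rpow_neg (he i).le _
  change _ ≤ _ * ∏ i ∈ Finset.range h, e i ^ (-t i)
  rw [hneg, ← div_eq_mul_inv]
  exact div_le_div₀ (Finset.prod_nonneg fun i _ => Real.rpow_nonneg (by linarith [he i]) _) hnum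
    hprodpos (hprod.trans hden)

/-- The expectation of the ratio is finite if `n_m ≥ n₀ + 2` and `1 < a < n_m`, since the negative
exponents in `power_ratio_le_prod` are then larger than `-1`. -/
theorem IsIIDExponential.lintegral_power_ratio_lt_top [IsProbabilityMeasure P']
    (hE : IsIIDExponential P' E) {n₀ nm h : ℕ} (hn₀ : 0 < n₀) (hgap : n₀ + 2 ≤ nm) (hh : nm < h)
    {a : ℝ} (ha1 : 1 < a) (ham : a < nm) :
    ∫⁻ ω, ENNReal.ofReal ((∑ i ∈ Finset.range h, E i ω) ^ a /
      ((∑ i ∈ Finset.range nm, E i ω) ^ a - (∑ i ∈ Finset.range n₀, E i ω) ^ a)) ∂P' < ∞ := by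
  set t : ℕ → ℝ := fun i => if i < n₀ then (a - 1) / (nm - 1) else
    if i < nm then (a - 1) / (nm - 1) * (1 - 1 / (nm - n₀)) + 1 / (nm - n₀) else 0 with ht
  have hg2 : (2 : ℝ) ≤ nm - n₀ := by
    have : ((n₀ + 2 : ℕ) : ℝ) ≤ nm := by exact_mod_cast hgap
    push_cast at this; linarith
  have ht1 : ∀ i, t i < 1 := by
    intro i
    have hθ : (a - 1) / ((nm : ℝ) - 1) < 1 := by
      rw [div_lt_one (by linarith)]; linarith
    have hg : 1 / ((nm : ℝ) - n₀) < 1 := by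
      rw [div_lt_one (by linarith)]; linarith
    simp only [ht]
    split_ifs
    · exact hθ
    · nlinarith
    · exact zero_lt_one
  have h1 : ∫⁻ ω, ENNReal.ofReal ((∑ i ∈ Finset.range h, E i ω) ^ a /
      ((∑ i ∈ Finset.range nm, E i ω) ^ a - (∑ i ∈ Finset.range n₀, E i ω) ^ a)) ∂P' ≤
      ∫⁻ ω, ∏ i ∈ Finset.range h, (fun i y => ENNReal.ofReal ((1 + y) ^ a * y ^ (-t i))) i (E i ω)
        ∂P' := by
    refine lintegral_mono_ae (hE.ae_pos.mono fun ω hω => ?_)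
    rw [← ENNReal.ofReal_prod_of_nonneg fun i _ => mul_nonneg
      (Real.rpow_nonneg (by linarith [hω i]) _) (Real.rpow_nonneg (hω i).le _)]
    exact ENNReal.ofReal_le_ofReal (power_ratio_le_prod hgap hn₀ hh ha1 hω)
  refine lt_of_le_of_lt h1 ?_
  rw [hE.lintegral_finsetProd (φ := fun i y => ENNReal.ofReal ((1 + y) ^ a * y ^ (-t i)))
    fun i => by fun_prop]
  exact ENNReal.prod_lt_top fun i _ => lintegral_one_add_rpow_mul_rpow_lt_top (ht1 i)

/-- If `n_m = n₀ + 1`, the difference `γ_{n_m} ^ a - γ_{n₀} ^ a` is of the order of a single exponential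
variable, whose inverse is not integrable. -/
theorem IsIIDExponential.lintegral_power_ratio_eq_top_of_succ [IsProbabilityMeasure P']
    (hE : IsIIDExponential P' E) {n₀ h : ℕ} (hn₀ : 0 < n₀) (hh : 0 < h) {a : ℝ} (ha : 0 < a) :
    ∫⁻ ω, ENNReal.ofReal ((∑ i ∈ Finset.range h, E i ω) ^ a /
      ((∑ i ∈ Finset.range (n₀ + 1), E i ω) ^ a - (∑ i ∈ Finset.range n₀, E i ω) ^ a)) ∂P' = ∞ := by
  set K : ℝ := max 1 a * (2 * (n₀ + 1)) ^ a with hK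
  -- confine the first variable to `(1, 2]`, so that `γ_{n₀}` stays away from zero
  refine hE.lintegral_eq_top (n := n₀ + 1) (q := n₀) (D := 0) (l := fun i => if i = 0 then 1 else 0)
    (s := fun _ => 0) (by omega) (fun i => ?_) (by simp) (c := K⁻¹) (by positivity)
    (hE.ae_pos.mono fun ω hpos hq hi => ?_)
  · split_ifs <;> simp
  refine ENNReal.ofReal_le_ofReal ?_
  set S₀ := ∑ i ∈ Finset.range n₀, E i ω with hS₀
  have hS₀pos : 0 < S₀ := Finset.sum_pos (fun i _ => hpos i) (by simp; omega)
  rw [Finset.sum_range_succ, add_zero, pow_one]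
  set y := E n₀ ω with hy
  have hy0 : 0 < y := hq.1
  have hE0 : 1 ≤ E 0 ω := by
    have := (hi 0 (by omega) (by omega)).1
    simpa using this.le
  have hS₀1 : 1 ≤ S₀ := hE0.trans (Finset.single_le_sum (f := fun i => E i ω)
    (fun j _ => (hpos j).le) (by simp; omega))
  have hS2 : S₀ + y ≤ 2 * (n₀ + 1) := by
    have h1 : ∑ i ∈ Finset.range (n₀ + 1), E i ω ≤ ∑ i ∈ Finset.range (n₀ + 1), (2 : ℝ) := by
      refine Finset.sum_le_sum fun i hi' => ?_
      by_cases hin : i = n₀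
      · rw [hin]; linarith [hq.2]
      · have := (hi i (by simpa using hi') hin).2
        refine this.trans ?_
        simp only [pow_zero]
        split_ifs <;> norm_num
    rw [Finset.sum_range_succ] at h1
    simp only [Finset.sum_const, Finset.card_range, nsmul_eq_mul] at h1
    push_cast at h1
    linarith
  have hnum : 1 ≤ (∑ i ∈ Finset.range h, E i ω) ^ a := by
    refine Real.one_le_rpow (hE0.trans ?_) ha.le
    exact Finset.single_le_sum (f := fun i => E i ω) (fun j _ => (hpos j).le) (by simp; omega)
  have hSpos : 0 < S₀ + y := by linarith
  have hden : (S₀ + y) ^ a - S₀ ^ a ≤ K * y := by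
    rw [rpow_sub_rpow_eq hS₀pos.le hSpos]
    have h1 := one_sub_rpow_le (a := a) (t := S₀ / (S₀ + y)) ha (by positivity)
      ((div_le_one hSpos).2 (by linarith))
    have h2 : 1 - S₀ / (S₀ + y) ≤ y := by
      rw [one_sub_div hSpos.ne', div_le_iff₀ hSpos]
      nlinarith
    calc (S₀ + y) ^ a * (1 - (S₀ / (S₀ + y)) ^ a) ≤ (2 * (n₀ + 1)) ^ a * (max 1 a * y) := by
          refine mul_le_mul (Real.rpow_le_rpow hSpos.le hS2 ha.le) (h1.trans ?_) ?_ (by positivity)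
          · gcongr
          · refine sub_nonneg.2 (Real.rpow_le_one (by positivity) ?_ ha.le)
            exact (div_le_one hSpos).2 (by linarith)
      _ = K * y := by rw [hK]; ring
  have hdenpos : 0 < (S₀ + y) ^ a - S₀ ^ a :=
    sub_pos.2 (Real.rpow_lt_rpow hS₀pos.le (by linarith) ha)
  rw [← mul_inv, inv_eq_one_div]
  exact div_le_div₀ (by linarith) hnum hdenpos hden

/-- For `h > n_m` the expectation is infinite when `a ≥ n_m`, since `γ_{n_m}` has infinite inverse
moments of these orders. -/
theorem IsIIDExponential.lintegral_power_ratio_eq_top_of_le [IsProbabilityMeasure P']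
    (hE : IsIIDExponential P' E) {n₀ nm h : ℕ} (hn₀ : 0 < n₀) (hnm : n₀ < nm) (hh : nm < h) {a : ℝ}
    (ha : nm ≤ a) :
    ∫⁻ ω, ENNReal.ofReal ((∑ i ∈ Finset.range h, E i ω) ^ a /
      ((∑ i ∈ Finset.range nm, E i ω) ^ a - (∑ i ∈ Finset.range n₀, E i ω) ^ a)) ∂P' = ∞ := by
  have hnm0 : (0 : ℝ) < nm := by exact_mod_cast (by omega : 0 < nm)
  have ha0 : 0 < a := hnm0.trans_le ha
  -- confine the first `n_m` variables to `(0, y]`, where `y` is the first one, and the next to `(1, 2]`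
  refine hE.lintegral_eq_top (n := nm + 1) (q := 0) (D := nm - 1)
    (l := fun i => if i < nm then 0 else 1) (s := fun i => if i < nm then 1 else 0) (by omega)
    (fun i => ?_) ?_ (c := ((nm : ℝ) ^ a)⁻¹) (by positivity) (hE.ae_pos.mono fun ω hpos hq hi => ?_)
  · split_ifs <;> simp
  · rw [Finset.sum_range_succ, Finset.sum_congr rfl fun i hi => if_pos (Finset.mem_range.1 hi)]
    simp [show 0 < nm by omega]
    omega
  refine ENNReal.ofReal_le_ofReal ?_
  set S₀ := ∑ i ∈ Finset.range n₀, E i ω with hS₀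
  set S := ∑ i ∈ Finset.range nm, E i ω with hS
  set y := E 0 ω with hy
  have hy0 : 0 < y := hq.1
  have hS₀pos : 0 < S₀ := Finset.sum_pos (fun i _ => hpos i) (by simp; omega)
  have hSS : S₀ < S := Finset.sum_lt_sum_of_subset (i := n₀) (Finset.range_mono hnm.le)
    (by simpa using hnm) (by simp) (hpos _) fun j _ _ => (hpos j).le
  have hSle : S ≤ nm * y := by
    have h1 : S ≤ ∑ i ∈ Finset.range nm, y := by
      refine Finset.sum_le_sum fun i hi' => ?_
      have hi' := Finset.mem_range.1 hi'
      by_cases hi0 : i = 0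
      · rw [hi0]
      · have := (hi i (by omega) hi0).2
        simpa [hi'] using this
    simpa using h1
  have hnum : 1 ≤ (∑ i ∈ Finset.range h, E i ω) ^ a := by
    have h1 := (hi nm (by omega) (by omega)).1
    simp only [lt_irrefl, if_false] at h1
    refine Real.one_le_rpow (h1.le.trans ?_) ha0.le
    exact Finset.single_le_sum (f := fun i => E i ω) (fun j _ => (hpos j).le) (by simpa using hh)
  have hdenpos : 0 < S ^ a - S₀ ^ a := sub_pos.2 (Real.rpow_lt_rpow hS₀pos.le hSS ha0)
  have hden : S ^ a - S₀ ^ a ≤ (nm : ℝ) ^ a * y ^ (1 + (nm - 1)) := by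
    have h1 : y ^ a ≤ y ^ (1 + (nm - 1)) := by
      rw [show 1 + (nm - 1) = nm by omega, ← Real.rpow_natCast]
      exact Real.rpow_le_rpow_of_exponent_ge hy0 hq.2 ha
    have h2 : S ^ a ≤ (nm : ℝ) ^ a * y ^ a := by
      rw [← Real.mul_rpow hnm0.le hy0.le]
      exact Real.rpow_le_rpow (hS₀pos.trans hSS).le hSle ha0.le
    have h3 : 0 ≤ S₀ ^ a := Real.rpow_nonneg hS₀pos.le a
    calc S ^ a - S₀ ^ a ≤ (nm : ℝ) ^ a * y ^ a := by linarith
      _ ≤ _ := by gcongr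
  rw [← mul_inv, inv_eq_one_div]
  exact div_le_div₀ (by linarith) hnum hdenpos hden

/-- Up to constants the ratio is `(γ_h / γ_{n_m}) ^ a / (1 - γ_{n₀} / γ_{n_m})`. It increases with `a`
when `γ_{n_m} ≤ γ_h`, and otherwise it only increases if `γ_h` is replaced by a larger partial sum. -/
theorem power_ratio_le_of_exponent_le {s₀ s t t' a a' : ℝ} (hs₀ : 0 < s₀) (hs : s₀ < s) (ht : 0 < t)
    (htt' : t ≤ t') (hst' : s ≤ t') (ha : 0 < a) (ha' : 0 < a') (h : t ≤ s ∨ (t = t' ∧ a ≤ a')) :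
    t ^ a / (s ^ a - s₀ ^ a) ≤ (min 1 a)⁻¹ * max 1 a' * (t' ^ a' / (s ^ a' - s₀ ^ a')) := by
  have hs0 : 0 < s := hs₀.trans hs
  have hr0 : 0 ≤ s₀ / s := by positivity
  have hr1 : s₀ / s < 1 := (div_lt_one hs0).2 hs
  have hb : ∀ b : ℝ, 0 < b → 0 < 1 - (s₀ / s) ^ b := fun b hb =>
    sub_pos.2 (Real.rpow_lt_one hr0 hr1 hb)
  have hform : ∀ u b : ℝ, 0 < u → 0 < b → u ^ b / (s ^ b - s₀ ^ b) = (u / s) ^ b / (1 - (s₀ / s) ^ b) := by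
    intro u b hu hb'
    rw [rpow_sub_rpow_eq hs₀.le hs0, Real.div_rpow hu.le hs0.le, div_div]
  have ht' : 0 < t' := ht.trans_le htt'
  rw [hform t a ht ha, hform t' a' ht' ha']
  have h1 := one_sub_rpow_ge ha hr0 hr1.le
  have h2 := one_sub_rpow_le ha' hr0 hr1.le
  have h3 : (t / s) ^ a ≤ (t' / s) ^ a' := by
    rcases h with h | ⟨rfl, h⟩
    · calc (t / s) ^ a ≤ 1 := Real.rpow_le_one (by positivity) ((div_le_one hs0).2 h) ha.le
        _ ≤ _ := Real.one_le_rpow ((one_le_div hs0).2 hst') ha'.le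
    · exact Real.rpow_le_rpow_of_exponent_le ((one_le_div hs0).2 hst') h
  have h5 : 0 < (t' / s) ^ a' := by positivity
  calc (t / s) ^ a / (1 - (s₀ / s) ^ a) ≤ (t' / s) ^ a' / (min 1 a * (1 - s₀ / s)) :=
        div_le_div₀ h5.le h3 (by positivity) h1
    _ = (min 1 a)⁻¹ * max 1 a' * ((t' / s) ^ a' / (max 1 a' * (1 - s₀ / s))) := by
        have : 0 < max 1 a' := by positivity
        field_simp
    _ ≤ _ := by
        have := hb a' ha'
        gcongr

/-- The expectation of the ratio is finite for an open set of exponents. Finiteness at `a₀` excludes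
`n_m = n₀ + 1`; it then holds for all exponents if `h < n_m`, and for the exponents below `n_m` if
`h > n_m`. -/
theorem IsIIDExponential.eventually_lintegral_power_ratio_lt_top [IsProbabilityMeasure P']
    (hE : IsIIDExponential P' E) {n₀ nm h : ℕ} (hn₀ : 0 < n₀) (hnm : n₀ < nm) (hh : 0 < h)
    (hne : h ≠ nm) {a₀ : ℝ} (ha₀ : 0 < a₀)
    (hfin : ∫⁻ ω, ENNReal.ofReal ((∑ i ∈ Finset.range h, E i ω) ^ a₀ /
      ((∑ i ∈ Finset.range nm, E i ω) ^ a₀ - (∑ i ∈ Finset.range n₀, E i ω) ^ a₀)) ∂P' < ∞) :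
    ∀ᶠ a in 𝓝 a₀, ∫⁻ ω, ENNReal.ofReal ((∑ i ∈ Finset.range h, E i ω) ^ a /
      ((∑ i ∈ Finset.range nm, E i ω) ^ a - (∑ i ∈ Finset.range n₀, E i ω) ^ a)) ∂P' < ∞ := by
  have hgap : n₀ + 2 ≤ nm := by
    by_contra hcon
    obtain rfl : nm = n₀ + 1 := by omega
    exact hfin.ne (hE.lintegral_power_ratio_eq_top_of_succ hn₀ hh ha₀)
  have hsum : ∀ ω, (∀ i, 0 < E i ω) → ∀ {u v : ℕ}, u ≤ v →
      ∑ i ∈ Finset.range u, E i ω ≤ ∑ i ∈ Finset.range v, E i ω := fun ω hω u v huv =>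
    Finset.sum_le_sum_of_subset_of_nonneg (Finset.range_mono huv) fun i _ _ => (hω i).le
  have hpos : ∀ ω, (∀ i, 0 < E i ω) → ∀ {u : ℕ}, 0 < u → 0 < ∑ i ∈ Finset.range u, E i ω :=
    fun ω hω u hu => Finset.sum_pos (fun i _ => hω i) (by simp; omega)
  have hlt : ∀ ω, (∀ i, 0 < E i ω) → ∑ i ∈ Finset.range n₀, E i ω < ∑ i ∈ Finset.range nm, E i ω :=
    fun ω hω => Finset.sum_lt_sum_of_subset (i := n₀) (Finset.range_mono hnm.le)
      (by simpa using hnm) (by simp) (hω _) fun j _ _ => (hω j).le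
  have key : ∀ (h' : ℕ) (a a' : ℝ), 0 < a → 1 < a' → a' < nm → nm < h' → h ≤ h' → (h < nm ∨ (h = h' ∧ a ≤ a')) →
      ∫⁻ ω, ENNReal.ofReal ((∑ i ∈ Finset.range h, E i ω) ^ a /
      ((∑ i ∈ Finset.range nm, E i ω) ^ a - (∑ i ∈ Finset.range n₀, E i ω) ^ a)) ∂P' < ∞ := by
    intro h' a a' ha ha1 ham hh' hhh' hcase
    have hfin' := hE.lintegral_power_ratio_lt_top hn₀ hgap hh' ha1 ham
    have hle : ∫⁻ ω, ENNReal.ofReal ((∑ i ∈ Finset.range h, E i ω) ^ a /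
        ((∑ i ∈ Finset.range nm, E i ω) ^ a - (∑ i ∈ Finset.range n₀, E i ω) ^ a)) ∂P' ≤
        ∫⁻ ω, ENNReal.ofReal ((min 1 a)⁻¹ * max 1 a') *
          ENNReal.ofReal ((∑ i ∈ Finset.range h', E i ω) ^ a' /
          ((∑ i ∈ Finset.range nm, E i ω) ^ a' - (∑ i ∈ Finset.range n₀, E i ω) ^ a')) ∂P' := by
      refine lintegral_mono_ae (hE.ae_pos.mono fun ω hω => ?_)
      rw [← ENNReal.ofReal_mul (by positivity)]
      refine ENNReal.ofReal_le_ofReal (power_ratio_le_of_exponent_le (hpos ω hω hn₀) (hlt ω hω)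
        (hpos ω hω hh) (hsum ω hω hhh') (hsum ω hω hh'.le) ha (by linarith) ?_)
      rcases hcase with hc | ⟨rfl, hc⟩
      · exact Or.inl (hsum ω hω hc.le)
      · exact Or.inr ⟨rfl, hc⟩
    refine hle.trans_lt ?_
    rw [lintegral_const_mul' _ _ ENNReal.ofReal_ne_top]
    exact ENNReal.mul_lt_top ENNReal.ofReal_lt_top hfin'
  have hpos_near : ∀ᶠ a in 𝓝 a₀, 0 < a := lt_mem_nhds ha₀
  rcases lt_or_gt_of_ne hne with hlt' | hgt
  · filter_upwards [hpos_near] with a ha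
    refine key (nm + 1) a (3 / 2) ha (by norm_num) ?_ (by omega) (by omega) (Or.inl hlt')
    have : ((3 : ℕ) : ℝ) ≤ nm := by exact_mod_cast (by omega : 3 ≤ nm)
    push_cast at this; linarith
  · have ham : a₀ < nm := by
      by_contra hcon
      exact hfin.ne (hE.lintegral_power_ratio_eq_top_of_le hn₀ hnm hgt (not_lt.1 hcon))
    have h3 : ((3 : ℕ) : ℝ) ≤ nm := by exact_mod_cast (by omega : 3 ≤ nm)
    push_cast at h3
    obtain ⟨a', h1, h2⟩ := exists_between (max_lt ham (by linarith : (1 : ℝ) < nm))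
    have hnear : ∀ᶠ a in 𝓝 a₀, a < a' := gt_mem_nhds ((le_max_left _ _).trans_lt h1)
    filter_upwards [hpos_near, hnear] with a ha haa'
    exact key h a a' ha ((le_max_right _ _).trans_lt h1) h2 hgt le_rfl (Or.inr ⟨rfl, haa'.le⟩)

end FirstMoment

/-! ### The limit density near the true parameters -/

theorem eventually_rank_eq {k p₀ : ℝ} (hk : 0 < k) (hp₀ : 0 < p₀) (hint : ∀ N : ℤ, k * p₀ ≠ N) :
    ∀ᶠ p in 𝓝 p₀, rank k p = rank k p₀ := by
  have hpos : 0 < rank k p₀ := Nat.ceil_pos.2 (mul_pos hk hp₀)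
  have h1 : k * p₀ < rank k p₀ := lt_of_le_of_ne (Nat.le_ceil _) (by exact_mod_cast hint (rank k p₀))
  have h2 : ((rank k p₀ - 1 : ℕ) : ℝ) < k * p₀ := Nat.lt_ceil.1 (Nat.sub_lt hpos one_pos)
  have hc : ContinuousAt (fun p => k * p) p₀ := by fun_prop
  filter_upwards [hc.eventually_lt_const h1, hc.eventually_const_lt h2] with p hp1 hp2
  exact (Nat.ceil_eq_iff hpos.ne').2 ⟨hp2, hp1.le⟩

/-- The factor `p ^ (-ξ)` cancels in the normalised limit variables. -/
theorem Ztilde_eq_powerRatio {Ω' : Type*} {E : ℕ → Ω' → ℝ} {L ℓ : ℕ} {k₀ m : ℝ} {k : Fin L → ℝ}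
    {ξ p : ℝ} {j₀ jm : Fin (ℓ + 1)} {j : Fin L → Fin (ℓ + 1)} (hp : 0 < p)
    (h₀ : (j₀ : ℕ) + 1 = rank k₀ p) (hm : (jm : ℕ) + 1 = rank (m * k₀) p)
    (h : ∀ l, (j l : ℕ) + 1 = rank (k l) p) {ω : Ω'} (hω : ∀ i, 0 < E i ω) :
    Ztilde E k₀ m k ξ p ω = powerRatio j₀ jm j (-ξ) (partialSums ℓ fun i => E i ω) := by
  have hpa : p ^ (-ξ) ≠ 0 := (Real.rpow_pos_of_pos hp _).ne'
  have hZ : ∀ (κ : ℝ) (i : Fin (ℓ + 1)), (i : ℕ) + 1 = rank κ p →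
      Zlim E ξ p κ ω = -(partialSums ℓ (fun i => E i ω) i ^ (-ξ) / p ^ (-ξ)) := by
    intro κ i hi
    rw [Zlim, ← hi, Real.div_rpow (Finset.sum_nonneg fun i _ => (hω i).le) hp.le]
    rfl
  funext l
  rw [Ztilde, powerRatio, hZ _ _ h₀, hZ _ _ hm, hZ _ _ (h l)]
  have : -(partialSums ℓ (fun i => E i ω) j₀ ^ (-ξ) / p ^ (-ξ)) -
      -(partialSums ℓ (fun i => E i ω) jm ^ (-ξ) / p ^ (-ξ)) =
      (partialSums ℓ (fun i => E i ω) jm ^ (-ξ) - partialSums ℓ (fun i => E i ω) j₀ ^ (-ξ)) /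
        p ^ (-ξ) := by ring
  rw [this, ← neg_div, div_div_div_cancel_right₀ hpa]

/-- The properties of the family of limit densities, near the true parameter `θ₀`, on which the
asymptotic analysis of the posterior distributions rests: continuity, support in the negative
orthant, integrable decay along the diagonal and finite first moments along the diagonal. -/
structure IsRegularFamily {L : ℕ} (g : ℝ × ℝ → (Fin L → ℝ) → ℝ) (θ₀ : ℝ × ℝ) : Prop where
  nonneg : ∀ᶠ θ in 𝓝 θ₀, ∀ z, 0 ≤ g θ z
  cont : ∀ᶠ θ in 𝓝 θ₀, Continuous (g θ)
  continuousAt : ∀ z, ContinuousAt (fun u : (ℝ × ℝ) × (Fin L → ℝ) => g u.1 u.2) (θ₀, z)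
  eq_zero : ∀ᶠ θ in 𝓝 θ₀, ∀ z : Fin L → ℝ, (∃ l, 0 < z l) → g θ z = 0
  decay : ∃ C κ : ℝ, 0 ≤ C ∧ 0 < κ ∧ ∀ᶠ θ in 𝓝 θ₀, ∀ v, 1 ≤ v → ∀ z : Fin L → ℝ,
    (∀ l, z l ∈ Icc (-(2 * v)) (-(v / 2))) → g θ z ≤ C * v ^ (-1 - κ)
  moment : ∀ᶠ θ in 𝓝 θ₀, ∀ w : Fin L → ℝ,
    ∫⁻ v : ℝ, ENNReal.ofReal |v| * ENNReal.ofReal (g θ fun l => w l - v) < ∞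

/-- A continuous density vanishes on an open half-space of probability zero. -/
theorem eq_zero_of_ae_nonpos {L : ℕ} {g : (Fin L → ℝ) → ℝ} (hg : Continuous g)
    (hnn : ∀ z, 0 ≤ g z) (l : Fin L)
    (h : (volume.withDensity fun z => ENNReal.ofReal (g z)) {z | 0 < z l} = 0) :
    ∀ z : Fin L → ℝ, 0 < z l → g z = 0 := by
  intro z hz
  by_contra hne
  have hpos : 0 < g z := lt_of_le_of_ne (hnn z) (Ne.symm hne)
  have hO : IsOpen {z : Fin L → ℝ | 0 < z l ∧ 0 < g z} :=
    (isOpen_lt continuous_const (continuous_apply l)).inter (isOpen_lt continuous_const hg)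
  have hm : MeasurableSet {z : Fin L → ℝ | 0 < z l} :=
    (isOpen_lt continuous_const (continuous_apply l)).measurableSet
  rw [withDensity_apply _ hm, lintegral_eq_zero_iff (by fun_prop),
    Filter.EventuallyEq, ae_restrict_iff' hm] at h
  refine (hO.measure_pos volume ⟨z, hz, hpos⟩).ne' (measure_mono_null ?_ h)
  intro y hy
  simp only [mem_compl_iff, mem_ofPred_eq, Pi.zero_apply, ENNReal.ofReal_eq_zero, not_forall, not_le]
  exact ⟨hy.1, hy.2⟩

/-- The function that dominates the translates of the limit densities along the diagonal: constant for
`|v| ≤ V`, a power of `v` beyond `V`, and zero below `-V`, where a translate leaves the support. -/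
noncomputable def envelope (V c C κ : ℝ) (v : ℝ) : ℝ≥0∞ :=
  (Icc (-V) V).indicator (fun _ => ENNReal.ofReal c) v +
    (Ioi V).indicator (fun v => ENNReal.ofReal (C * v ^ (-1 - κ))) v

theorem lintegral_envelope_lt_top {V c C κ : ℝ} (hV : 0 < V) (hκ : 0 < κ) :
    ∫⁻ v, envelope V c C κ v < ∞ := by
  simp only [envelope]
  rw [lintegral_add_left (measurable_const.indicator measurableSet_Icc),
    lintegral_indicator measurableSet_Icc, lintegral_indicator measurableSet_Ioi, setLIntegral_const]
  have h1 : IntegrableOn (fun v : ℝ => C * v ^ (-1 - κ)) (Ioi V) :=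
    (integrableOn_Ioi_rpow_of_lt (by linarith) hV).const_mul C
  refine ENNReal.add_lt_top.2 ⟨ENNReal.mul_lt_top ENNReal.ofReal_lt_top ?_, h1.lintegral_lt_top⟩
  rw [Real.volume_Icc]
  exact ENNReal.ofReal_lt_top

theorem le_envelope {V c C κ v : ℝ} {x : ℝ≥0∞} (hin : |v| ≤ V → x ≤ ENNReal.ofReal c)
    (hout : V < v → x ≤ ENNReal.ofReal (C * v ^ (-1 - κ))) (hneg : v < -V → x = 0) :
    x ≤ envelope V c C κ v := by
  rcases lt_or_ge v (-V) with h | h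
  · rw [hneg h]; exact zero_le
  · rcases lt_or_ge V v with h' | h'
    · refine (hout h').trans ?_
      rw [envelope, indicator_of_mem (s := Ioi V) h']
      exact le_add_left le_rfl
    · refine (hin (abs_le.2 ⟨h, h'⟩)).trans ?_
      rw [envelope, indicator_of_mem (s := Icc (-V) V) ⟨h, h'⟩]
      exact le_add_right le_rfl

theorem sub_mem_Icc_of_abs_le {L : ℕ} {w : Fin L → ℝ} {W v : ℝ} (hw : ∀ l, |w l| ≤ W)
    (hv : 2 * W + 1 < v) (l : Fin L) : w l - v ∈ Icc (-(2 * v)) (-(v / 2)) := by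
  have h1 := abs_le.1 (hw l)
  constructor <;> linarith [h1.1, h1.2]

/-- For `L ≥ 2` the decay `v ^ (-L - κ)` of the density gives finite first moments along the diagonal. -/
theorem lintegral_abs_mul_comp_sub_lt_top_of_decay {L : ℕ} (hL : 2 ≤ L) {g : (Fin L → ℝ) → ℝ}
    (hg : Continuous g) (hzero : ∀ z : Fin L → ℝ, (∃ l, 0 < z l) → g z = 0) {C κ : ℝ} (hC : 0 ≤ C)
    (hκ : 0 < κ)
    (hdecay : ∀ v, 0 < v → ∀ z : Fin L → ℝ, (∀ l, z l ∈ Icc (-(2 * v)) (-(v / 2))) →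
      g z ≤ C * v ^ (-(L : ℝ) - κ)) (w : Fin L → ℝ) :
    ∫⁻ v : ℝ, ENNReal.ofReal |v| * ENNReal.ofReal (g fun l => w l - v) < ∞ := by
  set W := ‖w‖ with hW
  have hW0 : 0 ≤ W := norm_nonneg w
  have hw : ∀ l, |w l| ≤ W := fun l => norm_le_pi_norm w l
  set V := 2 * W + 1 with hV
  have hcont : Continuous fun v : ℝ => |v| * g fun l => w l - v :=
    continuous_abs.mul (hg.comp (by fun_prop))
  obtain ⟨c, hc⟩ := (isCompact_Icc (a := -V) (b := V)).bddAbove_image hcont.continuousOn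
  have l0 : Fin L := ⟨0, by omega⟩
  refine lt_of_le_of_lt (lintegral_mono fun v => ?_)
    (lintegral_envelope_lt_top (V := V) (c := c) (C := C) (κ := κ) (by linarith) hκ)
  rw [← ENNReal.ofReal_mul (abs_nonneg v)]
  refine le_envelope (fun h => ENNReal.ofReal_le_ofReal ?_) (fun h => ENNReal.ofReal_le_ofReal ?_)
    fun h => ?_
  · exact hc (mem_image_of_mem _ (abs_le.1 h))
  · have hv1 : 1 ≤ v := by linarith
    have hv0 : 0 < v := by linarith
    have hL2 : (2 : ℝ) ≤ L := by exact_mod_cast hL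
    rw [abs_of_pos hv0]
    calc v * g (fun l => w l - v) ≤ v * (C * v ^ (-(L : ℝ) - κ)) :=
          mul_le_mul_of_nonneg_left (hdecay v hv0 _ (sub_mem_Icc_of_abs_le hw h)) hv0.le
      _ = C * v ^ (1 + (-(L : ℝ) - κ)) := by rw [Real.rpow_add hv0, Real.rpow_one]; ring
      _ ≤ C * v ^ (-1 - κ) := mul_le_mul_of_nonneg_left
          (Real.rpow_le_rpow_of_exponent_le hv1 (by linarith)) hC
  · rw [hzero _ ⟨l0, by have := (abs_le.1 (hw l0)).1; linarith⟩, mul_zero, ENNReal.ofReal_zero]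

theorem lintegral_fin_one {h : (Fin 1 → ℝ) → ℝ≥0∞} (hh : Measurable h) :
    ∫⁻ z, h z = ∫⁻ y : ℝ, h fun _ => y := by
  have h1 := ((volume_preserving_funUnique (Fin 1) ℝ).symm _).lintegral_comp hh
  exact h1.symm

theorem lintegral_abs_mul_comp_sub_lt_top_of_moment {g : (Fin 1 → ℝ) → ℝ} (hg : Measurable g)
    (hmass : ∫⁻ z, ENNReal.ofReal (g z) ≠ ∞)
    (hfin : ∫⁻ z : Fin 1 → ℝ, ENNReal.ofReal |z 0| * ENNReal.ofReal (g z) < ∞) (w : Fin 1 → ℝ) :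
    ∫⁻ v : ℝ, ENNReal.ofReal |v| * ENNReal.ofReal (g fun l => w l - v) < ∞ := by
  rw [lintegral_fin_one (by fun_prop)] at hmass hfin
  have h1 := lintegral_sub_left_eq_self
    (fun v : ℝ => ENNReal.ofReal |v| * ENNReal.ofReal (g fun _ => w 0 - v)) (w 0) (μ := volume)
  have h2 : ∀ v : ℝ, (fun l : Fin 1 => w l - v) = fun _ => w 0 - v := fun v => by
    funext l; rw [Subsingleton.elim l 0]
  simp_rw [h2]
  rw [← h1]
  refine lt_of_le_of_lt (lintegral_mono fun y => ?_) (b := ∫⁻ y : ℝ,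
    (ENNReal.ofReal |w 0| * ENNReal.ofReal (g fun _ => y) +
      ENNReal.ofReal |y| * ENNReal.ofReal (g fun _ => y))) ?_
  · rw [← add_mul, ← ENNReal.ofReal_add (abs_nonneg _) (abs_nonneg _), sub_sub_cancel]
    gcongr
    exact abs_sub _ _
  · rw [lintegral_add_left (by fun_prop), lintegral_const_mul _ (by fun_prop)]
    exact ENNReal.add_lt_top.2 ⟨ENNReal.mul_lt_top ENNReal.ofReal_lt_top (lt_top_iff_ne_top.2 hmass),
      hfin⟩

section Regular

variable {Ω' : Type*} [MeasurableSpace Ω'] {P' : Measure Ω'} {E : ℕ → Ω' → ℝ}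

/-- For `L = 1`, finiteness of the limit risk means that the limit variable is integrable. -/
theorem lintegral_abs_lt_top_of_limitRisk [IsProbabilityMeasure P'] {τ : ℝ} (hτ0 : 0 < τ)
    (hτ1 : τ < 1) {g : (Fin 1 → ℝ) → ℝ} (hg : Measurable g)
    (hmass : ∫⁻ z, ENNReal.ofReal (g z) = 1) {W : Ω' → Fin 1 → ℝ} {Z : Ω' → ℝ}
    (hZ : IsUniqueLimitArgmin P' τ g W Z) :
    ∫⁻ z : Fin 1 → ℝ, ENNReal.ofReal |z 0| * ENNReal.ofReal (g z) < ∞ := by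
  obtain ⟨ω, ⟨O, -, ⟨z, hzO⟩, hfin⟩, -⟩ := hZ.2.exists
  have h := hfin z hzO
  rw [lintegral_fin_one (by fun_prop)] at hmass ⊢
  set w := W ω 0 with hw
  have h2 : ∀ v : ℝ, (fun l : Fin 1 => W ω l - v) = fun _ => w - v := fun v => by
    funext l; rw [Subsingleton.elim l 0]
  have hm : ∫⁻ v : ℝ, ENNReal.ofReal (g fun _ => w - v) = 1 := by
    rw [← hmass]
    exact lintegral_sub_left_eq_self (fun y : ℝ => ENNReal.ofReal (g fun _ => y)) w
  simp only [limitRisk, h2, hm, div_one] at h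
  have h1 := lintegral_sub_left_eq_self (fun v : ℝ => ENNReal.ofReal (bayesLoss τ (z - v)) *
    ENNReal.ofReal (g fun _ => w - v)) w (μ := volume)
  rw [← h1] at h
  simp only [sub_sub_cancel] at h
  set c := min τ (1 - τ) with hc
  have hc0 : 0 < c := lt_min hτ0 (by linarith)
  have hloss : ∀ u, c * |u| ≤ bayesLoss τ u := by
    intro u
    unfold bayesLoss
    split_ifs with hu
    · rw [abs_of_pos hu]
      exact mul_le_mul_of_nonneg_right (min_le_right _ _) hu.le
    · rw [abs_of_nonpos (not_lt.1 hu)]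
      have := mul_le_mul_of_nonneg_right (min_le_left τ (1 - τ)) (neg_nonneg.2 (not_lt.1 hu))
      linarith
  refine lt_of_le_of_lt (lintegral_mono fun y => ?_) (b := ∫⁻ y : ℝ,
    (ENNReal.ofReal |w - z| * ENNReal.ofReal (g fun _ => y) + ENNReal.ofReal c⁻¹ *
      (ENNReal.ofReal (bayesLoss τ (z - (w - y))) * ENNReal.ofReal (g fun _ => y)))) ?_
  · rw [← mul_assoc, ← ENNReal.ofReal_mul (p := c⁻¹) (by positivity), ← add_mul,
      ← ENNReal.ofReal_add (abs_nonneg _) (mul_nonneg (by positivity)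
        (bayesLoss_nonneg hτ0.le hτ1.le _))]
    gcongr
    have h3 := hloss (z - (w - y))
    have h4 : |z - (w - y)| ≤ c⁻¹ * bayesLoss τ (z - (w - y)) := by
      rw [inv_mul_eq_div, le_div_iff₀ hc0]; linarith
    calc |y| = |(w - z) + (z - (w - y))| := by congr 1; ring
      _ ≤ |w - z| + |z - (w - y)| := abs_add_le _ _
      _ ≤ _ := by linarith
  · rw [lintegral_add_left (by fun_prop), lintegral_const_mul _ (by fun_prop), hmass,
      lintegral_const_mul' _ _ ENNReal.ofReal_ne_top]
    exact ENNReal.add_lt_top.2 ⟨ENNReal.mul_lt_top ENNReal.ofReal_lt_top ENNReal.one_lt_top,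
      ENNReal.mul_lt_top ENNReal.ofReal_lt_top h⟩

/-- The limit densities form a regular family. Near the true parameters the ranks are constant, so that
only the exponent `-ξ` varies. The decay comes from `IsIIDExponential.exists_density_le`. The first
moments follow from it if `L ≥ 2`; for `L = 1` they are finite at the true parameters because the limit
risk is, and then also nearby by `IsIIDExponential.eventually_lintegral_power_ratio_lt_top`. -/
theorem isRegularFamily_of_isLimitDensity [IsProbabilityMeasure P'] (hE : IsIIDExponential P' E)
    {L ℓ : ℕ} (hL : 0 < L) {p₀ ξ₀ : ℝ} (hp₀ : 0 < p₀) (hξ₀ : ξ₀ < 0)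
    {k₀ m : ℝ} {k : Fin L → ℝ} (hk₀ : 0 < k₀) (hm : 1 < m) (hk : ∀ l, 0 < k l)
    (hk₀int : ∀ N : ℤ, k₀ * p₀ ≠ N) (hmk₀int : ∀ N : ℤ, m * k₀ * p₀ ≠ N)
    (hkint : ∀ l, ∀ N : ℤ, k l * p₀ ≠ N) (hranks : DistinctRanks k₀ m k p₀)
    {f : ℝ → ℝ → (Fin L → ℝ) → ℝ} (hf : IsLimitDensity P' E k₀ m k f)
    (hfcont : ∀ᶠ θ : ℝ × ℝ in 𝓝 (ξ₀, p₀), Continuous (f θ.1 θ.2))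
    (hfcont₀ : ∀ z : Fin L → ℝ,
      ContinuousAt (fun u : (ℝ × ℝ) × (Fin L → ℝ) => f u.1.1 u.1.2 u.2) ((ξ₀, p₀), z))
    {τ : ℝ} (hτ0 : 0 < τ) (hτ1 : τ < 1) {Z : Ω' → ℝ}
    (hZ : IsUniqueLimitArgmin P' τ (f ξ₀ p₀) (Ztilde E k₀ m k ξ₀ p₀) Z)
    {j₀ jm : Fin (ℓ + 1)} {j : Fin L → Fin (ℓ + 1)}
    (h₀ : (j₀ : ℕ) + 1 = rank k₀ p₀) (hjm : (jm : ℕ) + 1 = rank (m * k₀) p₀)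
    (hj : ∀ l, (j l : ℕ) + 1 = rank (k l) p₀) :
    IsRegularFamily (fun θ => f θ.1 θ.2) (ξ₀, p₀) := by
  set a₀ := -ξ₀ with ha₀
  have ha₀pos : 0 < a₀ := neg_pos.2 hξ₀
  have hne0m : j₀ ≠ jm := fun h => hranks.1 (by rw [← h₀, ← hjm, h])
  have h0m : j₀ < jm := by
    refine lt_of_le_of_ne (Fin.le_def.2 ?_) hne0m
    have h1 : rank k₀ p₀ ≤ rank (m * k₀) p₀ := Nat.ceil_mono (by
      have := mul_pos hk₀ hp₀
      rw [mul_assoc]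
      nlinarith)
    omega
  have hinj : Function.Injective j := fun l l' h => hranks.2.2 (by
    change rank (k l) p₀ = rank (k l') p₀
    rw [← hj, ← hj, h])
  have hj0 : ∀ l, j l ≠ j₀ := fun l h => (hranks.2.1 l).1 (by rw [← hj, ← h₀, h])
  have hjm' : ∀ l, j l ≠ jm := fun l h => (hranks.2.1 l).2 (by rw [← hj, ← hjm, h])
  have hprm : ∀ a, Measurable fun ω => powerRatio j₀ jm j a (partialSums ℓ fun i => E i ω) :=
    fun a => (measurable_powerRatio j₀ jm j a).comp (measurable_partialSums hE ℓ)
  have hnear : ∀ᶠ θ : ℝ × ℝ in 𝓝 (ξ₀, p₀), -θ.1 ∈ Icc (a₀ / 2) (2 * a₀) ∧ Measurable (f θ.1 θ.2) ∧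
      (∀ z, 0 ≤ f θ.1 θ.2 z) ∧
      P'.map (fun ω => powerRatio j₀ jm j (-θ.1) (partialSums ℓ fun i => E i ω)) =
        volume.withDensity fun z => ENNReal.ofReal (f θ.1 θ.2 z) := by
    have hp : ∀ᶠ p in 𝓝 p₀, 0 < p ∧ rank k₀ p = rank k₀ p₀ ∧ rank (m * k₀) p = rank (m * k₀) p₀ ∧
        ∀ l, rank (k l) p = rank (k l) p₀ := by
      filter_upwards [lt_mem_nhds hp₀, eventually_rank_eq hk₀ hp₀ hk₀int,
        eventually_rank_eq (by positivity) hp₀ hmk₀int,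
        eventually_all.2 fun l => eventually_rank_eq (hk l) hp₀ (hkint l)] with p h1 h2 h3 h4
      exact ⟨h1, h2, h3, h4⟩
    have hξ : ∀ᶠ ξ in 𝓝 ξ₀, -ξ ∈ Icc (a₀ / 2) (2 * a₀) := by
      have hc : ContinuousAt (fun ξ : ℝ => -ξ) ξ₀ := by fun_prop
      exact hc.eventually_mem (Icc_mem_nhds (by linarith) (by linarith))
    rw [nhds_prod_eq]
    filter_upwards [hξ.prod_mk hp] with θ hθ
    obtain ⟨h1, h2, h3, h4, h5⟩ := hθ
    have hd : DistinctRanks k₀ m k θ.2 := by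
      unfold DistinctRanks
      simp only [h3, h4, h5]
      exact hranks
    obtain ⟨h6, h7, h8⟩ := hf θ.1 θ.2 (by linarith [h1.1]) h2 hd
    refine ⟨h1, h6, h7, ?_⟩
    rw [← h8]
    refine Measure.map_congr (hE.ae_pos.mono fun ω hω => ?_)
    exact (Ztilde_eq_powerRatio h2 (by rw [h₀, h3]) (by rw [hjm, h4])
      (fun l => by rw [hj, h5]) hω).symm
  obtain ⟨C, hC0, hC⟩ := hE.exists_density_le hL h0m hinj hj0 hjm' (a₂ := 2 * a₀)
    (by positivity : 0 < a₀ / 2)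
  set κ := 1 / (2 * (1 + 2 * a₀)) with hκ
  have hκ0 : 0 < κ := by positivity
  have hzero : ∀ᶠ θ : ℝ × ℝ in 𝓝 (ξ₀, p₀), ∀ z : Fin L → ℝ, (∃ l, 0 < z l) → f θ.1 θ.2 z = 0 := by
    filter_upwards [hnear, hfcont] with θ ⟨h1, h2, h3, h4⟩ h5 z ⟨l, hl⟩
    refine eq_zero_of_ae_nonpos h5 h3 l ?_ z hl
    have hm' : MeasurableSet {z : Fin L → ℝ | 0 < z l} :=
      measurableSet_lt measurable_const (measurable_pi_apply l)
    rw [← h4, Measure.map_apply (hprm _) hm']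
    refine measure_eq_zero_iff_ae_notMem.2 ?_
    filter_upwards [hE.ae_partialSums_strictMono ℓ] with ω hω hmem
    have h6 : 0 < powerRatio j₀ jm j (-θ.1) (partialSums ℓ fun i => E i ω) l := hmem
    rw [powerRatio] at h6
    have h7 := sub_pos.2 (Real.rpow_lt_rpow (hω.1 j₀).le (hω.2 h0m)
      (lt_of_lt_of_le (by positivity) h1.1))
    have h8 := Real.rpow_pos_of_pos (hω.1 (j l)) (-θ.1)
    exact h6.not_ge (div_nonpos_of_nonpos_of_nonneg (by linarith) h7.le)
  refine ⟨hnear.mono fun θ h => h.2.2.1, hfcont, hfcont₀, hzero, ?_, ?_⟩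
  · refine ⟨C, κ, hC0, hκ0, ?_⟩
    filter_upwards [hnear, hfcont] with θ ⟨h1, h2, h3, h4⟩ h5 v hv z hz
    refine (hC _ h1 _ h5 h4 v (by linarith) z hz).trans (mul_le_mul_of_nonneg_left ?_ hC0)
    have hL1 : (1 : ℝ) ≤ L := by exact_mod_cast hL
    exact Real.rpow_le_rpow_of_exponent_le hv (by linarith)
  · rcases (show L = 1 ∨ 2 ≤ L by omega) with rfl | hL2
    · have hlin : ∀ θ : ℝ × ℝ,
          P'.map (fun ω => powerRatio j₀ jm j (-θ.1) (partialSums ℓ fun i => E i ω)) =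
            (volume.withDensity fun z => ENNReal.ofReal (f θ.1 θ.2 z)) → Measurable (f θ.1 θ.2) →
          -θ.1 ∈ Icc (a₀ / 2) (2 * a₀) →
          ∫⁻ z, ENNReal.ofReal (f θ.1 θ.2 z) = 1 ∧
          ∫⁻ z : Fin 1 → ℝ, ENNReal.ofReal |z 0| * ENNReal.ofReal (f θ.1 θ.2 z) =
            ∫⁻ ω, ENNReal.ofReal ((∑ i ∈ Finset.range (j 0 + 1), E i ω) ^ (-θ.1) /
              ((∑ i ∈ Finset.range (jm + 1), E i ω) ^ (-θ.1) -
                (∑ i ∈ Finset.range (j₀ + 1), E i ω) ^ (-θ.1))) ∂P' := by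
        intro θ h1 h2 h3
        have hp : IsProbabilityMeasure (volume.withDensity fun z => ENNReal.ofReal (f θ.1 θ.2 z)) := by
          rw [← h1]; exact Measure.isProbabilityMeasure_map (hprm _).aemeasurable
        refine ⟨?_, ?_⟩
        · have := hp.measure_univ
          rwa [withDensity_apply _ MeasurableSet.univ, setLIntegral_univ] at this
        · have hm' : Measurable fun z : Fin 1 → ℝ => ENNReal.ofReal |z 0| := by fun_prop
          have h4 := lintegral_map (μ := P') hm' (hprm (-θ.1))
          rw [h1, lintegral_withDensity_eq_lintegral_mul _ (by fun_prop) hm'] at h4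
          rw [lintegral_congr fun z => mul_comm _ _]
          refine h4.trans (lintegral_congr_ae ?_)
          filter_upwards [hE.ae_partialSums_strictMono ℓ] with ω hω
          have h7 := sub_pos.2 (Real.rpow_lt_rpow (hω.1 j₀).le (hω.2 h0m)
            (lt_of_lt_of_le (by positivity) h3.1))
          have h8 := Real.rpow_pos_of_pos (hω.1 (j 0)) (-θ.1)
          rw [powerRatio, abs_div, abs_neg, abs_of_pos h8, abs_of_pos h7]
          rfl
      obtain ⟨n1, n2, n3, n4⟩ := hnear.self_of_nhds
      obtain ⟨e1, e2⟩ := hlin (ξ₀, p₀) n4 n2 n1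
      have hfin := lintegral_abs_lt_top_of_limitRisk hτ0 hτ1 n2 e1 hZ
      rw [e2] at hfin
      have hev := hE.eventually_lintegral_power_ratio_lt_top (h := j 0 + 1) (by omega)
        (by have := Fin.lt_def.1 h0m; omega) (by omega)
        (fun h => hjm' 0 (Fin.ext (by omega))) ha₀pos hfin
      have hc : ContinuousAt (fun θ : ℝ × ℝ => -θ.1) (ξ₀, p₀) := by fun_prop
      filter_upwards [hnear, hc.eventually hev] with θ ⟨h1, h2, h3, h4⟩ h5 w
      obtain ⟨d1, d2⟩ := hlin θ h4 h2 h1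
      refine lintegral_abs_mul_comp_sub_lt_top_of_moment h2 (by rw [d1]; exact ENNReal.one_ne_top) ?_ w
      rw [d2]
      exact h5
    · filter_upwards [hnear, hfcont, hzero] with θ ⟨h1, h2, h3, h4⟩ h5 h6 w
      exact lintegral_abs_mul_comp_sub_lt_top_of_decay hL2 h5 h6 hC0 hκ0
        (fun v hv z hz => hC _ h1 _ h5 h4 v hv z hz) w

end Regular

/-! ### Uniformity of the posterior probability under the limit law -/

/-- Half of the probability integral transform: under a finite measure without atoms, the values `t` at
which the survival function is at most `c` have measure at most `c`. -/
theorem measure_survival_le (ν : Measure ℝ) [IsFiniteMeasure ν] [NullSingletonClass ν] (c : ℝ≥0∞) :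
    ν {t | ν (Ioi t) ≤ c} ≤ c := by
  have hmono : Antitone fun t => ν (Ioi t) := fun s t hst => measure_mono (Ioi_subset_Ioi hst)
  have hm : MeasurableSet {t | ν (Ioi t) ≤ c} := hmono.measurable measurableSet_Iic
  rw [hm.measure_eq_iSup_isCompact_of_ne_top (measure_ne_top _ _)]
  refine iSup₂_le fun K hK => iSup_le fun hKc => ?_
  rcases K.eq_empty_or_nonempty with rfl | hne
  · simp
  have ht := hKc.sInf_mem hne
  calc ν K ≤ ν (Ici (sInf K)) := measure_mono fun x hx => csInf_le hKc.bddBelow hx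
    _ = ν (Ioi (sInf K)) := (measure_congr Ioi_ae_eq_Ici).symm
    _ ≤ c := hK ht

/-- The other half of the probability integral transform: the values `t` at which the survival function is
at least `c` have measure at most the total mass minus `c`. -/
theorem measure_le_survival_add_le (ν : Measure ℝ) [IsFiniteMeasure ν] {c : ℝ≥0∞} (hc : c ≤ ν univ) :
    ν {t | c ≤ ν (Ioi t)} + c ≤ ν univ := by
  have hmono : Antitone fun t => ν (Ioi t) := fun s t hst => measure_mono (Ioi_subset_Ioi hst)
  have hm : MeasurableSet {t | c ≤ ν (Ioi t)} := hmono.measurable measurableSet_Ici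
  have hcfin : c ≠ ∞ := ne_top_of_le_ne_top (measure_ne_top _ _) hc
  rw [← ENNReal.le_sub_iff_add_le_right hcfin hc,
    hm.measure_eq_iSup_isCompact_of_ne_top (measure_ne_top _ _)]
  refine iSup₂_le fun K hK => iSup_le fun hKc => ?_
  rcases K.eq_empty_or_nonempty with rfl | hne
  · simp
  have ht : c ≤ ν (Ioi (sSup K)) := hK (hKc.sSup_mem hne)
  refine (measure_mono (t := Iic (sSup K)) fun x hx => le_csSup hKc.bddAbove hx).trans ?_
  rw [ENNReal.le_sub_iff_add_le_right hcfin hc]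
  calc ν (Iic (sSup K)) + c ≤ ν (Iic (sSup K)) + ν (Ioi (sSup K)) := by gcongr
    _ = ν univ := by rw [← compl_Iic, measure_add_measure_compl measurableSet_Iic]

/-- The mass that the translates of `G` along the diagonal give to a set `s` of translation
parameters. With `G` the limit density and `s = (-∞, 0)` this is the unnormalised limit posterior
probability that the parameter lies below the truth. -/
noncomputable def diagonalMass {L : ℕ} (G : (Fin L → ℝ) → ℝ≥0∞) (s : Set ℝ) (w : Fin L → ℝ) : ℝ≥0∞ :=
  ∫⁻ v in s, G fun l => w l - v

section Translation

variable {L : ℕ} {G : (Fin L → ℝ) → ℝ≥0∞}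

theorem measurable_diagonalMass (hG : Measurable G) (s : Set ℝ) :
    Measurable (diagonalMass G s) := by
  have h : Measurable fun u : (Fin L → ℝ) × ℝ => G fun l => u.1 l - u.2 := by
    refine hG.comp (measurable_pi_lambda _ fun l => ?_)
    exact ((measurable_pi_apply l).comp measurable_fst).sub measurable_snd
  exact h.lintegral_prod_right'

/-- The measure on the diagonal through `z` with density `t ↦ G (z + t)`. -/
noncomputable def diagonalMeasure (G : (Fin L → ℝ) → ℝ≥0∞) (z : Fin L → ℝ) : Measure ℝ :=
  volume.withDensity fun t => G fun l => z l + t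

theorem measurable_comp_add (hG : Measurable G) (z : Fin L → ℝ) :
    Measurable fun t : ℝ => G fun l => z l + t :=
  hG.comp (measurable_pi_lambda _ fun _ => measurable_const.add measurable_id)

theorem diagonalMass_add_Iio (z : Fin L → ℝ) (t : ℝ) :
    diagonalMass G (Iio 0) (fun l => z l + t) = diagonalMeasure G z (Ioi t) := by
  rw [diagonalMass, diagonalMeasure, withDensity_apply _ measurableSet_Ioi,
    ← lintegral_indicator measurableSet_Iio, ← lintegral_indicator measurableSet_Ioi,
    ← lintegral_sub_left_eq_self ((Ioi t).indicator fun s => G fun l => z l + s) t]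
  refine lintegral_congr fun v => ?_
  have : t < t - v ↔ v < 0 := by constructor <;> intro h <;> linarith
  simp only [indicator, mem_Iio, mem_Ioi, this, add_sub_assoc]

theorem diagonalMass_add_univ (z : Fin L → ℝ) (t : ℝ) :
    diagonalMass G univ (fun l => z l + t) = diagonalMeasure G z univ := by
  rw [diagonalMass, diagonalMeasure, withDensity_apply _ MeasurableSet.univ, setLIntegral_univ,
    setLIntegral_univ, ← lintegral_sub_left_eq_self (fun s => G fun l => z l + s) t]
  simp only [add_sub_assoc]

theorem diagonalMass_univ (z : Fin L → ℝ) : diagonalMass G univ z = diagonalMeasure G z univ := by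
  simpa using diagonalMass_add_univ (G := G) z 0

/-- Disintegration of the measure with density `G` along the diagonal: if on every line `z + ℝ (1, …, 1)`
the set `K` has at most the proportion `c` of the mass, then so it has on the whole space. The proof
inserts the ratio of `∫ G (z - t) dt` to itself, exchanges the integrals and translates `z` by `t`; the
mass of a line is invariant under this translation. -/
theorem setLIntegral_le_of_diagonal (hG : Measurable G) (hpos : ∀ z, G z ≠ 0 → diagonalMass G univ z ≠ 0)
    (hfin : ∀ z, diagonalMass G univ z ≠ ∞) {K : Set (Fin L → ℝ)} (hK : MeasurableSet K) {c : ℝ≥0∞}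
    (hle : ∀ z, diagonalMeasure G z {t | (fun l => z l + t) ∈ K} ≤ c * diagonalMass G univ z) :
    ∫⁻ z in K, G z ≤ c * ∫⁻ z, G z := by
  set M := diagonalMass G univ with hM
  have hMm : Measurable M := measurable_diagonalMass hG _
  set H : (Fin L → ℝ) → ℝ≥0∞ := K.indicator fun z => G z / M z with hH
  have hHm : Measurable H := (hG.div hMm).indicator hK
  have hsub : Measurable fun u : (Fin L → ℝ) × ℝ => G fun l => u.1 l - u.2 := by
    refine hG.comp (measurable_pi_lambda _ fun l => ?_)
    exact ((measurable_pi_apply l).comp measurable_fst).sub measurable_snd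
  have hadd : Measurable fun u : (Fin L → ℝ) × ℝ => (fun l => u.1 l + u.2 : Fin L → ℝ) :=
    measurable_pi_lambda _ fun l => ((measurable_pi_apply l).comp measurable_fst).add measurable_snd
  calc ∫⁻ z in K, G z = ∫⁻ z, H z * M z := by
        rw [← lintegral_indicator hK]
        refine lintegral_congr fun z => ?_
        by_cases hz : z ∈ K
        · rw [hH, indicator_of_mem hz, indicator_of_mem hz]
          by_cases h0 : G z = 0
          · simp [h0]
          · rw [ENNReal.div_mul_cancel (hpos z h0) (hfin z)]
        · rw [hH, indicator_of_notMem hz, indicator_of_notMem hz, zero_mul]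
    _ = ∫⁻ z, ∫⁻ t : ℝ, H z * G fun l => z l - t := by
        refine lintegral_congr fun z => ?_
        have hm : Measurable fun t : ℝ => G fun l => z l - t := hsub.comp measurable_prodMk_left
        rw [lintegral_const_mul _ hm, hM, diagonalMass, setLIntegral_univ]
    _ = ∫⁻ t : ℝ, ∫⁻ z, H z * G fun l => z l - t :=
        lintegral_lintegral_swap ((hHm.comp measurable_fst).mul hsub).aemeasurable
    _ = ∫⁻ t : ℝ, ∫⁻ z : Fin L → ℝ, H (fun l => z l + t) * G z := by
        refine lintegral_congr fun t => ?_
        rw [← lintegral_add_right_eq_self (fun z : Fin L → ℝ => H z * G fun l => z l - t) fun _ => t]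
        refine lintegral_congr fun z => ?_
        simp only [Pi.add_apply, add_sub_cancel_right]
        rfl
    _ = ∫⁻ z : Fin L → ℝ, ∫⁻ t : ℝ, H (fun l => z l + t) * G z :=
        lintegral_lintegral_swap (((hHm.comp hadd).comp measurable_swap).mul
          (hG.comp measurable_snd)).aemeasurable
    _ ≤ ∫⁻ z, c * G z := by
        refine lintegral_mono fun z => ?_
        by_cases h0 : G z = 0
        · simp [h0]
        have hS : MeasurableSet {t : ℝ | (fun l => z l + t) ∈ K} :=
          (hadd.comp measurable_prodMk_left) hK
        have hm : Measurable fun t : ℝ => H fun l => z l + t :=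
          hHm.comp (hadd.comp measurable_prodMk_left)
        rw [lintegral_mul_const _ hm]
        refine mul_le_mul_left ?_ _
        calc ∫⁻ t : ℝ, H (fun l => z l + t) =
            (∫⁻ t in {t : ℝ | (fun l => z l + t) ∈ K}, G fun l => z l + t) * (M z)⁻¹ := by
              rw [← lintegral_mul_const _ (measurable_comp_add hG z), ← lintegral_indicator hS]
              refine lintegral_congr fun t => ?_
              have hMt : M (fun l => z l + t) = M z := by
                rw [hM, diagonalMass_add_univ, ← diagonalMass_univ]
              simp only [hH, indicator, hMt, mem_ofPred_eq, div_eq_mul_inv]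
          _ ≤ c * M z * (M z)⁻¹ := by
              have := hle z
              rw [diagonalMeasure, withDensity_apply _ hS] at this
              gcongr
          _ = c := by
              rw [mul_assoc, ENNReal.mul_inv_cancel (hpos z h0) (hfin z), mul_one]
    _ = c * ∫⁻ z, G z := lintegral_const_mul _ hG

/-- Under the law with density `G`, the ratio of the masses of the diagonal below zero and of the whole
diagonal is uniformly distributed on `[0, 1]`. The stated bound for intervals determines the law, since
the bounds for complementary intervals add up to one. -/
theorem measure_diagonalMass_mem_Icc_le (hG : Measurable G)
    (hpos : ∀ z, G z ≠ 0 → diagonalMass G univ z ≠ 0) (hfin : ∀ z, diagonalMass G univ z ≠ ∞)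
    (hmass : ∫⁻ z, G z = 1) {α β : ℝ} (hα : 0 ≤ α) (hαβ : α ≤ β) (hβ : β ≤ 1) :
    (volume.withDensity G) {z | ENNReal.ofReal α * diagonalMass G univ z ≤ diagonalMass G (Iio 0) z ∧
      diagonalMass G (Iio 0) z ≤ ENNReal.ofReal β * diagonalMass G univ z} ≤
      ENNReal.ofReal (β - α) := by
  have hMm := measurable_diagonalMass hG univ
  have hAm := measurable_diagonalMass hG (Iio 0)
  have hν : ∀ z, IsFiniteMeasure (diagonalMeasure G z) := fun z =>
    ⟨by rw [← diagonalMass_univ]; exact lt_top_iff_ne_top.2 (hfin z)⟩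
  have hνa : ∀ z, NullSingletonClass (diagonalMeasure G z) := fun z => by
    unfold diagonalMeasure; infer_instance
  set K₁ := {z | diagonalMass G (Iio 0) z ≤ ENNReal.ofReal β * diagonalMass G univ z} with hK₁
  set K₂ := {z | ENNReal.ofReal α * diagonalMass G univ z ≤ diagonalMass G (Iio 0) z} with hK₂
  have hK₁m : MeasurableSet K₁ := measurableSet_le hAm (hMm.const_mul _)
  have hK₂m : MeasurableSet K₂ := measurableSet_le (hMm.const_mul _) hAm
  have h1 : (volume.withDensity G) K₁ ≤ ENNReal.ofReal β := by
    rw [withDensity_apply _ hK₁m]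
    refine (setLIntegral_le_of_diagonal hG hpos hfin hK₁m (c := ENNReal.ofReal β) fun z => ?_).trans
      (by rw [hmass, mul_one])
    simp only [hK₁, mem_ofPred_eq, diagonalMass_add_Iio, diagonalMass_add_univ]
    rw [diagonalMass_univ]
    exact measure_survival_le _ _
  have h2 : (volume.withDensity G) K₂ ≤ ENNReal.ofReal (1 - α) := by
    rw [withDensity_apply _ hK₂m]
    refine (setLIntegral_le_of_diagonal hG hpos hfin hK₂m (c := ENNReal.ofReal (1 - α)) fun z => ?_).trans
      (by rw [hmass, mul_one])
    simp only [hK₂, mem_ofPred_eq, diagonalMass_add_Iio, diagonalMass_add_univ]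
    rw [diagonalMass_univ]
    have hα1 : ENNReal.ofReal α ≤ 1 := by
      rw [← ENNReal.ofReal_one]; exact ENNReal.ofReal_le_ofReal (hαβ.trans hβ)
    have hle : ENNReal.ofReal α * diagonalMeasure G z univ ≤ diagonalMeasure G z univ :=
      mul_le_of_le_one_left' hα1
    have h3 := measure_le_survival_add_le (diagonalMeasure G z) hle
    have hfin' : ENNReal.ofReal α * diagonalMeasure G z univ ≠ ∞ := by finiteness
    refine (ENNReal.le_sub_of_add_le_right hfin' h3).trans (le_of_eq ?_)
    rw [ENNReal.ofReal_sub _ hα, ENNReal.ofReal_one, ENNReal.sub_mul fun _ _ => by finiteness, one_mul]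
  have hprob : (volume.withDensity G) univ = 1 := by
    rw [withDensity_apply _ MeasurableSet.univ, setLIntegral_univ, hmass]
  have hunion : K₂ ∪ K₁ = univ := by
    refine eq_univ_of_forall fun z => ?_
    rcases le_total (ENNReal.ofReal α * diagonalMass G univ z) (diagonalMass G (Iio 0) z) with h | h
    · exact Or.inl h
    · refine Or.inr (h.trans ?_)
      gcongr
  have h3 := measure_union_add_inter (μ := volume.withDensity G) K₂ hK₁m
  rw [hunion, hprob] at h3
  have h4 : 1 + (volume.withDensity G) (K₂ ∩ K₁) ≤ 1 + ENNReal.ofReal (β - α) := by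
    rw [h3]
    refine (add_le_add h2 h1).trans (le_of_eq ?_)
    rw [← ENNReal.ofReal_add (by linarith) (by linarith), ← ENNReal.ofReal_one,
      ← ENNReal.ofReal_add zero_le_one (by linarith)]
    congr 1; ring
  exact (ENNReal.add_le_add_iff_left ENNReal.one_ne_top).1 h4

end Translation

/-! ### Convergence of the posterior masses -/

section Posterior

variable {L : ℕ} {g : ℝ × ℝ → (Fin L → ℝ) → ℝ} {θ₀ : ℝ × ℝ}

/-- One integrable function dominates the translates along the diagonal for all parameters and base points
near `(w, θ₀)`. -/
theorem IsRegularFamily.exists_envelope (h : IsRegularFamily g θ₀) (hL : 0 < L) (w : Fin L → ℝ) :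
    ∃ V c C κ : ℝ, 0 < V ∧ 0 < κ ∧ ∀ᶠ u : (Fin L → ℝ) × (ℝ × ℝ) in 𝓝 (w, θ₀), ∀ v : ℝ,
      ENNReal.ofReal (g u.2 fun l => u.1 l - v) ≤ envelope V c C κ v := by
  obtain ⟨C, κ, hC, hκ, hdecay⟩ := h.decay
  set W := ‖w‖ + 1 with hW
  set V := 2 * W + 1 with hV
  have hW0 : 0 < W := by positivity
  have hcont : Continuous fun v : ℝ => g θ₀ fun l => w l - v :=
    h.cont.self_of_nhds.comp (by fun_prop)
  obtain ⟨c, hc⟩ := (isCompact_Icc (a := -V) (b := V)).bddAbove_image hcont.continuousOn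
  have hloc : ∀ᶠ u : (Fin L → ℝ) × (ℝ × ℝ) in 𝓝 (w, θ₀), ∀ v ∈ Icc (-V) V,
      (g u.2 fun l => u.1 l - v) < c + 1 := by
    refine (isCompact_Icc (a := -V) (b := V)).eventually_forall_of_forall_eventually fun v hv => ?_
    have h1 : ContinuousAt (fun y : ((Fin L → ℝ) × (ℝ × ℝ)) × ℝ =>
        ((y.1.2, fun l => y.1.1 l - y.2) : (ℝ × ℝ) × (Fin L → ℝ))) ((w, θ₀), v) := by fun_prop
    have h2 := ContinuousAt.comp (f := fun y : ((Fin L → ℝ) × (ℝ × ℝ)) × ℝ =>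
        ((y.1.2, fun l => y.1.1 l - y.2) : (ℝ × ℝ) × (Fin L → ℝ))) (h.continuousAt fun l => w l - v) h1
    refine h2.eventually_lt_const ?_
    have := hc (mem_image_of_mem _ hv)
    simp only [Function.comp]
    linarith
  refine ⟨V, c + 1, C, κ, by positivity, hκ, ?_⟩
  have hfst : Tendsto (fun u : (Fin L → ℝ) × (ℝ × ℝ) => u.1) (𝓝 (w, θ₀)) (𝓝 w) :=
    continuousAt_fst
  have hsnd : Tendsto (fun u : (Fin L → ℝ) × (ℝ × ℝ) => u.2) (𝓝 (w, θ₀)) (𝓝 θ₀) :=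
    continuousAt_snd
  have hnorm : ∀ᶠ w' in 𝓝 w, ‖w'‖ < W := continuousAt_id.norm.eventually_lt_const (by simp [hW])
  filter_upwards [hloc, hfst.eventually hnorm, hsnd.eventually h.eq_zero, hsnd.eventually hdecay]
    with u h1 h2 h3 h4 v
  have hw : ∀ l, |u.1 l| ≤ W := fun l => (norm_le_pi_norm u.1 l).trans h2.le
  refine le_envelope (fun hv => ENNReal.ofReal_le_ofReal (h1 v (abs_le.1 hv)).le)
    (fun hv => ENNReal.ofReal_le_ofReal ?_) fun hv => ?_
  · exact h4 v (by linarith) _ (sub_mem_Icc_of_abs_le hw hv)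
  · have := (abs_le.1 (hw ⟨0, hL⟩)).1
    rw [h3 _ ⟨⟨0, hL⟩, by linarith⟩, ENNReal.ofReal_zero]

theorem IsRegularFamily.diagonalMass_ne_top (h : IsRegularFamily g θ₀) (hL : 0 < L) (s : Set ℝ)
    (w : Fin L → ℝ) : diagonalMass (fun z => ENNReal.ofReal (g θ₀ z)) s w ≠ ∞ := by
  obtain ⟨V, c, C, κ, hV, hκ, hle⟩ := h.exists_envelope hL w
  refine (lt_of_le_of_lt ((setLIntegral_le_lintegral _ _).trans
    (lintegral_mono hle.self_of_nhds)) (lintegral_envelope_lt_top hV hκ)).ne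

theorem IsRegularFamily.diagonalMass_ne_zero (h : IsRegularFamily g θ₀) {w : Fin L → ℝ}
    (hw : ENNReal.ofReal (g θ₀ w) ≠ 0) :
    diagonalMass (fun z => ENNReal.ofReal (g θ₀ z)) univ w ≠ 0 := by
  have hcont : Continuous fun v : ℝ => ENNReal.ofReal (g θ₀ fun l => w l - v) :=
    ENNReal.continuous_ofReal.comp (h.cont.self_of_nhds.comp (by fun_prop))
  rw [diagonalMass, setLIntegral_univ]
  intro h0
  rw [lintegral_eq_zero_iff hcont.measurable] at h0
  have := (hcont.ae_eq_iff_eq volume continuous_const).1 h0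
  exact hw (by simpa using congrFun this 0)

/-- The likelihood-prior integrand in the local parameter `v`, with `r = φ + δ v`. -/
noncomputable def localDensity (g : (Fin L → ℝ) → ℝ) (π : ℝ → ℝ) (φ : ℝ) (w : Fin L → ℝ) (δ v : ℝ) :
    ℝ≥0∞ :=
  ENNReal.ofReal ((g fun l => w l - v) * π (φ + δ * v))

variable {π : ℝ → ℝ} {φ : ℝ}

theorem measurable_localDensity {g : (Fin L → ℝ) → ℝ} (hg : Measurable g) (hπ : Measurable π)
    (w : Fin L → ℝ) (δ : ℝ) : Measurable (localDensity g π φ w δ) := by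
  unfold localDensity
  have : Measurable fun v : ℝ => g fun l => w l - v :=
    hg.comp (measurable_pi_lambda _ fun _ => measurable_const.sub measurable_id)
  fun_prop

/-- As the scale `δ` of the posterior tends to zero, the prior becomes flat and the posterior masses
converge to those of the limit experiment. -/
theorem IsRegularFamily.tendsto_lintegral_localDensity (h : IsRegularFamily g θ₀) (hL : 0 < L)
    (hπm : Measurable π) (hπ0 : ∀ q, 0 ≤ π q) {B : ℝ} (hπB : ∀ q, π q ≤ B) (hπc : ContinuousAt π φ)
    (s : Set ℝ) (w : Fin L → ℝ) :
    Tendsto (fun u : (Fin L → ℝ) × ℝ × (ℝ × ℝ) =>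
      ∫⁻ v in s, localDensity (g u.2.2) π φ u.1 u.2.1 v) (𝓝 (w, 0, θ₀))
      (𝓝 (ENNReal.ofReal (π φ) * diagonalMass (fun z => ENNReal.ofReal (g θ₀ z)) s w)) := by
  obtain ⟨V, c, C, κ, hV, hκ, hle⟩ := h.exists_envelope hL w
  have hg₀ := h.cont.self_of_nhds
  have hlim : ENNReal.ofReal (π φ) * diagonalMass (fun z => ENNReal.ofReal (g θ₀ z)) s w =
      ∫⁻ v in s, ENNReal.ofReal ((g θ₀ fun l => w l - v) * π φ) := by
    have hm : Measurable fun v : ℝ => ENNReal.ofReal (g θ₀ fun l => w l - v) :=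
      (ENNReal.continuous_ofReal.comp (hg₀.comp (by fun_prop))).measurable
    rw [diagonalMass, ← lintegral_const_mul _ hm]
    refine lintegral_congr fun v => ?_
    rw [← ENNReal.ofReal_mul (hπ0 φ), mul_comm]
  rw [hlim]
  have hθ : Tendsto (fun u : (Fin L → ℝ) × ℝ × (ℝ × ℝ) => u.2.2) (𝓝 (w, 0, θ₀)) (𝓝 θ₀) :=
    (by fun_prop : ContinuousAt (fun u : (Fin L → ℝ) × ℝ × (ℝ × ℝ) => u.2.2) (w, 0, θ₀))
  have hwθ : Tendsto (fun u : (Fin L → ℝ) × ℝ × (ℝ × ℝ) => (u.1, u.2.2)) (𝓝 (w, 0, θ₀))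
      (𝓝 (w, θ₀)) :=
    (by fun_prop : ContinuousAt (fun u : (Fin L → ℝ) × ℝ × (ℝ × ℝ) => (u.1, u.2.2)) (w, 0, θ₀))
  refine tendsto_lintegral_filter_of_dominated_convergence
    (fun v => ENNReal.ofReal B * envelope V c C κ v) ?_ ?_ ?_ ?_
  · filter_upwards [hθ.eventually h.cont] with u hu
    exact (measurable_localDensity hu.measurable hπm _ _)
  · filter_upwards [hwθ.eventually hle, hθ.eventually h.nonneg] with u hu hu'
    refine Eventually.of_forall fun v => ?_
    rw [localDensity, ENNReal.ofReal_mul (hu' _), mul_comm]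
    exact mul_le_mul' (ENNReal.ofReal_le_ofReal (hπB _)) (hu v)
  · rw [lintegral_const_mul' _ _ ENNReal.ofReal_ne_top]
    exact ENNReal.mul_ne_top ENNReal.ofReal_ne_top (ne_top_of_le_ne_top
      (lintegral_envelope_lt_top hV hκ).ne (setLIntegral_le_lintegral _ _))
  · refine Eventually.of_forall fun v => ?_
    refine (ENNReal.continuous_ofReal.tendsto _).comp (Tendsto.mul ?_ ?_)
    · have h1 : ContinuousAt (fun u : (Fin L → ℝ) × ℝ × (ℝ × ℝ) =>
          ((u.2.2, fun l => u.1 l - v) : (ℝ × ℝ) × (Fin L → ℝ))) (w, 0, θ₀) := by fun_prop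
      exact (h.continuousAt fun l => w l - v).tendsto.comp h1
    · have h1 : Tendsto (fun u : (Fin L → ℝ) × ℝ × (ℝ × ℝ) => φ + u.2.1 * v) (𝓝 (w, 0, θ₀))
          (𝓝 (φ + 0 * v)) :=
        (by fun_prop : ContinuousAt (fun u : (Fin L → ℝ) × ℝ × (ℝ × ℝ) => φ + u.2.1 * v) (w, 0, θ₀))
      rw [zero_mul, add_zero] at h1
      exact hπc.tendsto.comp h1

/-! ### Minimisers of the average risk -/

theorem lintegral_eq_lintegral_comp_affine {δ : ℝ} (hδ : 0 < δ) (φ : ℝ) {h : ℝ → ℝ≥0∞}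
    (hh : Measurable h) : ∫⁻ r, h r = ENNReal.ofReal δ * ∫⁻ v, h (φ + δ * v) := by
  rw [← lintegral_add_left_eq_self h φ]
  conv_lhs => rw [← Real.smul_map_volume_mul_left hδ.ne']
  have hm : Measurable fun a => h (φ + a) := hh.comp (measurable_const_add φ)
  rw [lintegral_smul_measure, lintegral_map hm (measurable_const_mul δ), abs_of_pos hδ, smul_eq_mul]

/-- In the local parameter the average risk is a normalised integral of the loss. -/
theorem averageRisk_affine {g : (Fin L → ℝ) → ℝ} (hg : Measurable g) (hπm : Measurable π) {τ a : ℝ}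
    (ha : 0 < a) (w : Fin L → ℝ) (φ s : ℝ) :
    averageRisk τ a w g π (φ + a⁻¹ * s) =
      (∫⁻ v, ENNReal.ofReal (bayesLoss τ (1 * (s - v))) ∂(volume.withDensity
        (localDensity g π φ (fun l => a * (w l - φ)) a⁻¹))) /
      ∫⁻ v, localDensity g π φ (fun l => a * (w l - φ)) a⁻¹ v := by
  have hδ : 0 < a⁻¹ := inv_pos.2 ha
  have hloss := measurable_bayesLoss τ
  have hd : Measurable fun r : ℝ => ENNReal.ofReal (g (fun l => a * (w l - r)) * π r) := by fun_prop
  have hden : ∀ v, ENNReal.ofReal (g (fun l => a * (w l - (φ + a⁻¹ * v))) * π (φ + a⁻¹ * v)) =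
      localDensity g π φ (fun l => a * (w l - φ)) a⁻¹ v := by
    intro v
    rw [localDensity]
    congr 3
    funext l
    field_simp
    ring
  have hsupp : ∀ F : ℝ → ℝ≥0∞, (∀ r, π r = 0 → F r = 0) →
      ∫⁻ r in Function.support π, F r = ∫⁻ r, F r := by
    intro F hF
    rw [← lintegral_indicator (measurableSet_support hπm)]
    refine lintegral_congr fun r => ?_
    by_cases hr : r ∈ Function.support π
    · rw [indicator_of_mem hr]
    · rw [indicator_of_notMem hr, hF r (by simpa using hr)]
  have hD : ∫⁻ r in Function.support π, ENNReal.ofReal (g (fun l => a * (w l - r)) * π r) =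
      ENNReal.ofReal a⁻¹ * ∫⁻ v, localDensity g π φ (fun l => a * (w l - φ)) a⁻¹ v := by
    rw [hsupp _ fun r hr => by rw [hr, mul_zero, ENNReal.ofReal_zero],
      lintegral_eq_lintegral_comp_affine hδ φ hd]
    simp_rw [hden]
  have hldm := measurable_localDensity (φ := φ) hg hπm (fun l => a * (w l - φ)) a⁻¹
  rw [averageRisk, hD, hsupp _ fun r hr => by rw [hr, mul_zero, ENNReal.ofReal_zero, ENNReal.zero_div,
    mul_zero], lintegral_eq_lintegral_comp_affine hδ φ (by fun_prop),
    lintegral_withDensity_eq_lintegral_mul _ hldm (by fun_prop)]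
  set D := ∫⁻ v, localDensity g π φ (fun l => a * (w l - φ)) a⁻¹ v with hDdef
  have hδ0 : ENNReal.ofReal a⁻¹ ≠ 0 := by simpa using ha
  calc ENNReal.ofReal a⁻¹ * ∫⁻ v, ENNReal.ofReal (bayesLoss τ (a * (φ + a⁻¹ * s - (φ + a⁻¹ * v)))) *
        (ENNReal.ofReal (g (fun l => a * (w l - (φ + a⁻¹ * v))) * π (φ + a⁻¹ * v)) /
          (ENNReal.ofReal a⁻¹ * D)) =
      ENNReal.ofReal a⁻¹ * ∫⁻ v, (ENNReal.ofReal a⁻¹ * D)⁻¹ *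
        ((localDensity g π φ (fun l => a * (w l - φ)) a⁻¹ *
          fun v => ENNReal.ofReal (bayesLoss τ (1 * (s - v)))) v) := by
        congr 1
        refine lintegral_congr fun v => ?_
        rw [hden, show a * (φ + a⁻¹ * s - (φ + a⁻¹ * v)) = 1 * (s - v) by field_simp; ring,
          Pi.mul_apply, div_eq_mul_inv]
        ring
    _ = _ := by
        rw [lintegral_const_mul _ (hldm.mul (by fun_prop)), ENNReal.mul_inv (Or.inl hδ0)
          (Or.inl ENNReal.ofReal_ne_top), ← mul_assoc, ← mul_assoc,
          ENNReal.mul_inv_cancel hδ0 ENNReal.ofReal_ne_top, one_mul, div_eq_mul_inv, mul_comm]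

/-- A minimiser of the average risk is a posterior quantile: its position relative to `φ` is
determined by the posterior mass below `φ`. -/
theorem averageRisk_minimiser {g : (Fin L → ℝ) → ℝ} (hg : Measurable g) (hg0 : ∀ z, 0 ≤ g z)
    (hπm : Measurable π) {B : ℝ} (hπB : ∀ q, π q ≤ B) {τ a : ℝ} (hτ0 : 0 ≤ τ)
    (hτ1 : τ ≤ 1) (ha : 0 < a) {w : Fin L → ℝ} {φ q : ℝ}
    (hD0 : ∫⁻ v, localDensity g π φ (fun l => a * (w l - φ)) a⁻¹ v ≠ 0)
    (hDtop : ∫⁻ v, localDensity g π φ (fun l => a * (w l - φ)) a⁻¹ v ≠ ∞)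
    (hmom : ∫⁻ v : ℝ, ENNReal.ofReal |v| * ENNReal.ofReal (g fun l => a * (w l - φ) - v) < ∞)
    (hmin : ∀ q', averageRisk τ a w g π q ≤ averageRisk τ a w g π q') :
    (φ ≤ q → ∫⁻ v in Iio 0, localDensity g π φ (fun l => a * (w l - φ)) a⁻¹ v ≤
      ENNReal.ofReal τ * ∫⁻ v, localDensity g π φ (fun l => a * (w l - φ)) a⁻¹ v) ∧
    (q ≤ φ → ENNReal.ofReal τ * ∫⁻ v, localDensity g π φ (fun l => a * (w l - φ)) a⁻¹ v ≤
      ∫⁻ v in Iio 0, localDensity g π φ (fun l => a * (w l - φ)) a⁻¹ v) := by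
  set W : Fin L → ℝ := fun l => a * (w l - φ) with hW
  set μ := volume.withDensity (localDensity g π φ W a⁻¹) with hμ
  have hldm := measurable_localDensity (φ := φ) hg hπm W a⁻¹
  have hloss := measurable_bayesLoss τ
  have huniv : μ univ = ∫⁻ v, localDensity g π φ W a⁻¹ v := by
    rw [hμ, withDensity_apply _ MeasurableSet.univ, setLIntegral_univ]
  have : IsFiniteMeasure μ := ⟨by rw [huniv]; exact lt_top_iff_ne_top.2 hDtop⟩
  have hmin' : ∀ s', ∫⁻ v, ENNReal.ofReal (bayesLoss τ (1 * (a * (q - φ) - v))) ∂μ ≤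
      ∫⁻ v, ENNReal.ofReal (bayesLoss τ (1 * (s' - v))) ∂μ := by
    intro s'
    have h := hmin (φ + a⁻¹ * s')
    have hq : q = φ + a⁻¹ * (a * (q - φ)) := by field_simp; ring
    conv_lhs at h => rw [hq]
    rw [averageRisk_affine hg hπm ha, averageRisk_affine hg hπm ha] at h
    have h2 := mul_le_mul_left h (∫⁻ v, localDensity g π φ W a⁻¹ v)
    rwa [ENNReal.div_mul_cancel hD0 hDtop, ENNReal.div_mul_cancel hD0 hDtop] at h2
  have hfin : ∫⁻ v, ENNReal.ofReal (bayesLoss τ (1 * (a * (q - φ) - v))) ∂μ ≠ ∞ := by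
    refine ne_top_of_le_ne_top ?_ (hmin' 0)
    rw [hμ, lintegral_withDensity_eq_lintegral_mul _ hldm (by fun_prop)]
    have hB : ∫⁻ v : ℝ, ENNReal.ofReal B *
        (ENNReal.ofReal |v| * ENNReal.ofReal (g fun l => W l - v)) ≠ ∞ := by
      rw [lintegral_const_mul' _ _ ENNReal.ofReal_ne_top]
      exact ENNReal.mul_ne_top ENNReal.ofReal_ne_top hmom.ne
    refine ne_top_of_le_ne_top hB (lintegral_mono fun v => ?_)
    have hle : bayesLoss τ (1 * (0 - v)) ≤ |v| := by
      rw [one_mul, zero_sub, ← abs_neg v]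
      unfold bayesLoss
      split_ifs with hv
      · rw [abs_of_pos hv]; nlinarith
      · rw [abs_of_nonpos (not_lt.1 hv)]; nlinarith [not_lt.1 hv]
    rw [Pi.mul_apply, localDensity, ENNReal.ofReal_mul (hg0 _)]
    calc ENNReal.ofReal (g fun l => W l - v) * ENNReal.ofReal (π (φ + a⁻¹ * v)) *
          ENNReal.ofReal (bayesLoss τ (1 * (0 - v))) ≤
        ENNReal.ofReal (g fun l => W l - v) * ENNReal.ofReal B * ENNReal.ofReal |v| := by
          gcongr
          exact hπB _
      _ = _ := by ring
  have hIio : μ (Iio 0) = ∫⁻ v in Iio 0, localDensity g π φ W a⁻¹ v :=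
    withDensity_apply _ measurableSet_Iio
  have hIic : μ (Iic 0) = μ (Iio 0) := by
    rw [hIio, hμ, withDensity_apply _ measurableSet_Iic, setLIntegral_congr Iio_ae_eq_Iic]
  rw [← huniv, ← hIio]
  refine ⟨fun h => ?_, fun h => ?_⟩
  · exact (measure_mono (Iio_subset_Iio (mul_nonneg ha.le (sub_nonneg.2 h)))).trans
      (measure_Iio_minimiser_le hτ0 hτ1 one_pos hfin hmin')
  · rw [← hIic]
    exact (le_measure_Iic_minimiser hτ0 hτ1 one_pos hfin hmin').trans (measure_mono
      (Iic_subset_Iic.2 (mul_nonpos_of_nonneg_of_nonpos ha.le (sub_nonpos.2 h))))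

end Posterior

/-! ### The portmanteau argument -/

/-- Events that are asymptotically contained in `{S n ∈ C}` have asymptotic probability at most
`P' {S ∈ closure C}`. -/
theorem eventually_measure_lt_of_tendstoInDistribution {Ω Ω' S : Type*} [MeasurableSpace Ω]
    [MeasurableSpace Ω'] [TopologicalSpace S] [MeasurableSpace S] [BorelSpace S]
    [HasOuterApproxClosed S]
    {P : Measure Ω} [IsProbabilityMeasure P] {P' : Measure Ω'} [IsProbabilityMeasure P']
    {X : ℕ → Ω → S} {Z : Ω' → S} (hXZ : TendstoInDistribution X atTop Z (fun _ => P) P')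
    {C : Set S} {D N : ℕ → Set Ω} (hN : Tendsto (fun n => P (N n)) atTop (𝓝 0))
    (hD : ∀ᶠ n in atTop, ∀ᵐ ω ∂P, ω ∈ D n → ω ∉ N n → X n ω ∈ C) {K : Set Ω'}
    (hK : ∀ᵐ ω ∂P', Z ω ∈ closure C → ω ∈ K) {c : ℝ≥0∞} (hc : P' K < c) :
    ∀ᶠ n in atTop, P (D n) < c := by
  have h1 : limsup (fun n => P.map (X n) (closure C)) atTop ≤ P'.map Z (closure C) :=
    ProbabilityMeasure.limsup_measure_closed_le_of_tendsto hXZ.tendsto isClosed_closure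
  have h2 : P'.map Z (closure C) ≤ P' K := by
    rw [Measure.map_apply_of_aemeasurable hXZ.aemeasurable_limit isClosed_closure.measurableSet]
    exact measure_mono_ae hK
  obtain ⟨c', hc1, hc2⟩ := exists_between hc
  have h3 : ∀ᶠ n in atTop, P.map (X n) (closure C) < c' :=
    eventually_lt_of_limsup_lt ((h1.trans h2).trans_lt hc1)
  have h4 : ∀ᶠ n in atTop, P (N n) < c - c' := hN.eventually_lt_const (tsub_pos_of_lt hc2)
  filter_upwards [h3, h4, hD] with n hn3 hn4 hn5
  have h5 : P (D n) ≤ P (X n ⁻¹' closure C) + P (N n) := by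
    refine le_trans (measure_mono_ae ?_) (measure_union_le _ _)
    filter_upwards [hn5] with ω hω hωD
    by_cases hωN : ω ∈ N n
    · exact Or.inr hωN
    · exact Or.inl (subset_closure (hω hωD hωN))
  rw [← Measure.map_apply_of_aemeasurable (hXZ.forall_aemeasurable n)
    isClosed_closure.measurableSet] at h5
  refine h5.trans_lt ?_
  calc P.map (X n) (closure C) + P (N n) < c' + (c - c') := ENNReal.add_lt_add hn3 hn4
    _ = c := add_tsub_cancel_of_le hc2.le

section State

variable {L ℓ : ℕ}

/-- The quantities that determine the posterior distribution: the scaled extreme order statistics,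
the deterministic scale of the gaps to the frontier, and the estimates of `(ξ, p)`. -/
abbrev State (ℓ : ℕ) : Type := (((Fin (ℓ + 1) → ℝ) × ℝ) × ℝ) × ℝ

/-- The scale of the posterior, the inverse of the normalising factor `α̂`. -/
noncomputable def State.scale (j₀ jm : Fin (ℓ + 1)) (a p₀ : ℝ) (s : State ℓ) : ℝ :=
  s.1.1.2 * ((s.1.1.1 jm ^ a - s.1.1.1 j₀ ^ a) / p₀ ^ a)

/-- Unnormalised posterior mass of a set of local parameters. -/
noncomputable def State.mass (f : ℝ → ℝ → (Fin L → ℝ) → ℝ) (π : ℝ → ℝ) (φ : ℝ) (j₀ jm : Fin (ℓ + 1))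
    (j : Fin L → Fin (ℓ + 1)) (a p₀ : ℝ) (A : Set ℝ) (s : State ℓ) : ℝ≥0∞ :=
  ∫⁻ v in A, localDensity (f s.1.2 s.2) π φ (powerRatio j₀ jm j a s.1.1.1) (s.scale j₀ jm a p₀) v

/-- The states at which the posterior is a probability distribution with finite first moment. -/
def State.IsGood (f : ℝ → ℝ → (Fin L → ℝ) → ℝ) (π : ℝ → ℝ) (φ : ℝ) (j₀ jm : Fin (ℓ + 1))
    (j : Fin L → Fin (ℓ + 1)) (a p₀ : ℝ) (s : State ℓ) : Prop :=
  Measurable (f s.1.2 s.2) ∧ (∀ z, 0 ≤ f s.1.2 s.2 z) ∧ (∀ i, 0 < s.1.1.1 i) ∧ 0 < s.1.1.1 jm ^ a - s.1.1.1 j₀ ^ a ∧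
    s.mass f π φ j₀ jm j a p₀ univ ≠ 0 ∧ s.mass f π φ j₀ jm j a p₀ univ ≠ ∞ ∧
    ∫⁻ v : ℝ, ENNReal.ofReal |v| *
      ENNReal.ofReal (f s.1.2 s.2 fun l => powerRatio j₀ jm j a s.1.1.1 l - v) < ∞

variable {f : ℝ → ℝ → (Fin L → ℝ) → ℝ} {π : ℝ → ℝ} {φ : ℝ} {j₀ jm : Fin (ℓ + 1)}
  {j : Fin L → Fin (ℓ + 1)} {a p₀ ξ₀ : ℝ}

theorem tendsto_state_mass (hreg : IsRegularFamily (fun θ => f θ.1 θ.2) (ξ₀, p₀)) (hL : 0 < L)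
    (hπm : Measurable π) (hπ0 : ∀ q, 0 ≤ π q) {B : ℝ} (hπB : ∀ q, π q ≤ B) (hπc : ContinuousAt π φ)
    (ha : 0 < a) {γ : Fin (ℓ + 1) → ℝ} (hγ : 0 < γ jm ^ a - γ j₀ ^ a) (A : Set ℝ) :
    Tendsto (State.mass f π φ j₀ jm j a p₀ A) (𝓝 (((γ, 0), ξ₀), p₀))
      (𝓝 (ENNReal.ofReal (π φ) * diagonalMass (fun z => ENNReal.ofReal (f ξ₀ p₀ z)) A
        (powerRatio j₀ jm j a γ))) := by
  have h := hreg.tendsto_lintegral_localDensity hL hπm hπ0 hπB hπc A (powerRatio j₀ jm j a γ)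
  have hcoord : ∀ i, ContinuousAt (fun s : State ℓ => s.1.1.1 i ^ a) (((γ, 0), ξ₀), p₀) := fun i =>
    ContinuousAt.rpow_const (by fun_prop) (Or.inr ha.le)
  have hmap : ContinuousAt (fun s : State ℓ => ((powerRatio j₀ jm j a s.1.1.1,
      s.scale j₀ jm a p₀, (s.1.2, s.2)) : (Fin L → ℝ) × ℝ × (ℝ × ℝ))) (((γ, 0), ξ₀), p₀) := by
    refine ContinuousAt.prodMk ?_ (ContinuousAt.prodMk ?_ (by fun_prop))
    · refine continuousAt_pi.2 fun l => ?_
      exact (hcoord (j l)).neg.div ((hcoord jm).sub (hcoord j₀)) hγ.ne'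
    · exact ContinuousAt.mul (by fun_prop) (((hcoord jm).sub (hcoord j₀)).div_const _)
  have h0 : State.scale j₀ jm a p₀ (((γ, 0), ξ₀), p₀) = 0 := by simp [State.scale]
  have hmap' := hmap.tendsto
  simp only [h0] at hmap'
  exact h.comp hmap'

/-- All states near a limit state of positive likelihood are good. -/
theorem eventually_state_isGood (hreg : IsRegularFamily (fun θ => f θ.1 θ.2) (ξ₀, p₀)) (hL : 0 < L)
    (hπm : Measurable π) (hπ0 : ∀ q, 0 ≤ π q) {B : ℝ} (hπB : ∀ q, π q ≤ B) (hπc : ContinuousAt π φ)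
    (hπφ : 0 < π φ) (ha : 0 < a) {γ : Fin (ℓ + 1) → ℝ} (hγpos : ∀ i, 0 < γ i) (hγ : 0 < γ jm ^ a - γ j₀ ^ a)
    (hf0 : ENNReal.ofReal (f ξ₀ p₀ (powerRatio j₀ jm j a γ)) ≠ 0) :
    ∀ᶠ s in 𝓝 ((((γ, 0), ξ₀), p₀) : State ℓ), State.IsGood f π φ j₀ jm j a p₀ s := by
  have hcoord : ∀ i, ContinuousAt (fun s : State ℓ => s.1.1.1 i ^ a) (((γ, 0), ξ₀), p₀) := fun i =>
    ContinuousAt.rpow_const (by fun_prop) (Or.inr ha.le)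
  have hθ : Tendsto (fun s : State ℓ => (s.1.2, s.2)) (𝓝 (((γ, 0), ξ₀), p₀)) (𝓝 (ξ₀, p₀)) :=
    (by fun_prop : ContinuousAt (fun s : State ℓ => (s.1.2, s.2)) (((γ, 0), ξ₀), p₀))
  have hD := tendsto_state_mass (j := j) hreg hL hπm hπ0 hπB hπc ha hγ univ
  have hM0 := hreg.diagonalMass_ne_zero hf0
  have hMtop := hreg.diagonalMass_ne_top hL univ (powerRatio j₀ jm j a γ)
  have hπ' : ENNReal.ofReal (π φ) ≠ 0 := by simpa using hπφ
  have hΔ : ∀ᶠ s in 𝓝 ((((γ, 0), ξ₀), p₀) : State ℓ), 0 < s.1.1.1 jm ^ a - s.1.1.1 j₀ ^ a :=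
    ((hcoord jm).sub (hcoord j₀)).eventually_const_lt hγ
  have hpos : ∀ i, ∀ᶠ s in 𝓝 ((((γ, 0), ξ₀), p₀) : State ℓ), 0 < s.1.1.1 i := fun i =>
    (by fun_prop : ContinuousAt (fun s : State ℓ => s.1.1.1 i) (((γ, 0), ξ₀), p₀)).eventually_const_lt
      (hγpos i)
  filter_upwards [hθ.eventually hreg.cont, hθ.eventually hreg.nonneg, eventually_all.2 hpos, hΔ,
    hD.eventually_ne (mul_ne_zero hπ' hM0),
    hD.eventually_ne (ENNReal.mul_ne_top ENNReal.ofReal_ne_top hMtop), hθ.eventually hreg.moment]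
    with s h1 h2 h2' h3 h4 h5 h6
  exact ⟨h1.measurable, h2, h2', h3, h4, h5, h6 _⟩

/-- The states that are not good, or whose posterior probability of the parameters below the
truth lies in `[α, β]`. -/
def exceptionalStates (f : ℝ → ℝ → (Fin L → ℝ) → ℝ) (π : ℝ → ℝ) (φ : ℝ) (j₀ jm : Fin (ℓ + 1))
    (j : Fin L → Fin (ℓ + 1)) (a p₀ α β : ℝ) : Set (State ℓ) :=
  {s | s.IsGood f π φ j₀ jm j a p₀ →
    ENNReal.ofReal α * s.mass f π φ j₀ jm j a p₀ univ ≤ s.mass f π φ j₀ jm j a p₀ (Iio 0) ∧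
      s.mass f π φ j₀ jm j a p₀ (Iio 0) ≤ ENNReal.ofReal β * s.mass f π φ j₀ jm j a p₀ univ}

/-- A limit state in the closure of the exceptional states has a limit posterior probability in `[α, β]`:
nearby states are good and their posterior masses converge, so that the inequalities pass to the limit. -/
theorem diagonalMass_mem_of_mem_closure (hreg : IsRegularFamily (fun θ => f θ.1 θ.2) (ξ₀, p₀))
    (hL : 0 < L) (hπm : Measurable π) (hπ0 : ∀ q, 0 ≤ π q) {B : ℝ} (hπB : ∀ q, π q ≤ B)
    (hπc : ContinuousAt π φ) (hπφ : 0 < π φ) (ha : 0 < a) {γ : Fin (ℓ + 1) → ℝ}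
    (hγpos : ∀ i, 0 < γ i) (hγ : 0 < γ jm ^ a - γ j₀ ^ a) (hf0 : ENNReal.ofReal (f ξ₀ p₀ (powerRatio j₀ jm j a γ)) ≠ 0)
    {α β : ℝ} (hmem : (((γ, 0), ξ₀), p₀) ∈ closure (exceptionalStates f π φ j₀ jm j a p₀ α β)) :
    ENNReal.ofReal α * diagonalMass (fun z => ENNReal.ofReal (f ξ₀ p₀ z)) univ (powerRatio j₀ jm j a γ) ≤
        diagonalMass (fun z => ENNReal.ofReal (f ξ₀ p₀ z)) (Iio 0) (powerRatio j₀ jm j a γ) ∧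
      diagonalMass (fun z => ENNReal.ofReal (f ξ₀ p₀ z)) (Iio 0) (powerRatio j₀ jm j a γ) ≤
        ENNReal.ofReal β *
          diagonalMass (fun z => ENNReal.ofReal (f ξ₀ p₀ z)) univ (powerRatio j₀ jm j a γ) := by
  have hfreq := (mem_closure_iff_frequently.1 hmem).and_eventually
    (eventually_state_isGood hreg hL hπm hπ0 hπB hπc hπφ ha hγpos hγ hf0)
  have hA := tendsto_state_mass (j := j) hreg hL hπm hπ0 hπB hπc ha hγ (Iio 0)
  have hD := tendsto_state_mass (j := j) hreg hL hπm hπ0 hπB hπc ha hγ univ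
  set Q : Set (ℝ≥0∞ × ℝ≥0∞) :=
    {x | ENNReal.ofReal α * x.2 ≤ x.1 ∧ x.1 ≤ ENNReal.ofReal β * x.2} with hQ
  have hQc : IsClosed Q := by
    have hc : ∀ c : ℝ, Continuous fun x : ℝ≥0∞ × ℝ≥0∞ => ENNReal.ofReal c * x.2 := fun c =>
      (ENNReal.continuous_const_mul ENNReal.ofReal_ne_top).comp continuous_snd
    exact (isClosed_le (hc α) continuous_fst).inter (isClosed_le continuous_fst (hc β))
  have hlim := hQc.mem_of_frequently_of_tendsto (hfreq.mono fun s hs => hs.1 hs.2)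
    (hA.prodMk_nhds hD)
  have hπ' : ENNReal.ofReal (π φ) ≠ 0 := by simpa using hπφ
  obtain ⟨h1, h2⟩ := hlim
  simp only [mul_left_comm _ (ENNReal.ofReal (π φ))] at h1 h2
  exact ⟨(ENNReal.mul_le_mul_iff_right hπ' ENNReal.ofReal_ne_top).1 h1,
    (ENNReal.mul_le_mul_iff_right hπ' ENNReal.ofReal_ne_top).1 h2⟩

/-- At a good state, the position of a Bayesian estimate relative to the frontier is determined by
the posterior mass of the parameters below the frontier. -/
theorem State.IsGood.minimiser {s : State ℓ} (hs : s.IsGood f π φ j₀ jm j a p₀) (hπm : Measurable π)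
    {B : ℝ} (hπB : ∀ q, π q ≤ B) (hp₀ : 0 < p₀) (he : 0 < s.1.1.2) {τ α : ℝ} (hτ0 : 0 ≤ τ)
    (hτ1 : τ ≤ 1) {w : Fin L → ℝ} (hw : ∀ l, w l = φ - s.1.1.2 * (s.1.1.1 (j l) / p₀) ^ a)
    (hα : α = ((φ - s.1.1.2 * (s.1.1.1 j₀ / p₀) ^ a) - (φ - s.1.1.2 * (s.1.1.1 jm / p₀) ^ a))⁻¹)
    {q : ℝ} (hmin : ∀ q', averageRisk τ α w (f s.1.2 s.2) π q ≤ averageRisk τ α w (f s.1.2 s.2) π q') :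
    (φ ≤ q → s.mass f π φ j₀ jm j a p₀ (Iio 0) ≤
      ENNReal.ofReal τ * s.mass f π φ j₀ jm j a p₀ univ) ∧
    (q ≤ φ → ENNReal.ofReal τ * s.mass f π φ j₀ jm j a p₀ univ ≤
      s.mass f π φ j₀ jm j a p₀ (Iio 0)) := by
  obtain ⟨h1, h2, h3, h4, h5, h6, h7⟩ := hs
  have hpa : 0 < p₀ ^ a := Real.rpow_pos_of_pos hp₀ a
  have hscale : α⁻¹ = s.scale j₀ jm a p₀ := by
    rw [hα, inv_inv, State.scale, Real.div_rpow (h3 _).le hp₀.le, Real.div_rpow (h3 _).le hp₀.le]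
    ring
  have hδ : 0 < s.scale j₀ jm a p₀ := mul_pos he (div_pos h4 hpa)
  have hαpos : 0 < α := by rw [← inv_pos, hscale]; exact hδ
  have hW : (fun l => α * (w l - φ)) = powerRatio j₀ jm j a s.1.1.1 := by
    funext l
    rw [← inv_inv α, hscale, hw, powerRatio, State.scale, Real.div_rpow (h3 _).le hp₀.le]
    field_simp
    ring
  have hmass : ∫⁻ v, localDensity (f s.1.2 s.2) π φ (powerRatio j₀ jm j a s.1.1.1)
      (s.scale j₀ jm a p₀) v = s.mass f π φ j₀ jm j a p₀ univ := by
    rw [State.mass, setLIntegral_univ]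
  have h := averageRisk_minimiser (φ := φ) (w := w) h1 h2 hπm hπB hτ0 hτ1 hαpos
    (by rw [hW, hscale, hmass]; exact h5) (by rw [hW, hscale, hmass]; exact h6)
    (by have := h7; rw [← hW] at this; exact this) hmin
  rw [hW, hscale, hmass] at h
  exact h

/-- Events whose occurrence forces the posterior probability of the parameters below the frontier into
`[α, β]` have asymptotic probability at most `β - α`. -/
theorem eventually_measureReal_lt_of_posterior {Ω Ω' : Type*} [MeasurableSpace Ω]
    [MeasurableSpace Ω'] {P : Measure Ω} [IsProbabilityMeasure P] {P' : Measure Ω'}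
    [IsProbabilityMeasure P'] {E : ℕ → Ω' → ℝ} (hE : IsIIDExponential P' E)
    (hreg : IsRegularFamily (fun θ => f θ.1 θ.2) (ξ₀, p₀)) (hL : 0 < L)
    (hmap : P'.map (fun ω => powerRatio j₀ jm j a (partialSums ℓ fun i => E i ω)) =
      volume.withDensity fun z => ENNReal.ofReal (f ξ₀ p₀ z))
    (hπm : Measurable π) (hπ0 : ∀ q, 0 ≤ π q) {B : ℝ} (hπB : ∀ q, π q ≤ B)
    (hπc : ContinuousAt π φ) (hπφ : 0 < π φ) (ha : 0 < a) (h0m : j₀ < jm)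
    {S : ℕ → Ω → State ℓ}
    (hS : TendstoInDistribution S atTop
      (fun ω => (((partialSums ℓ fun i => E i ω, 0), ξ₀), p₀)) (fun _ => P) P')
    {D N : ℕ → Set Ω} (hN : Tendsto (fun n => P (N n)) atTop (𝓝 0)) {α β : ℝ} (hα : 0 ≤ α)
    (hαβ : α ≤ β) (hβ : β ≤ 1)
    (hD : ∀ᶠ n in atTop, ∀ᵐ ω ∂P, ω ∈ D n → ω ∉ N n →
      S n ω ∈ exceptionalStates f π φ j₀ jm j a p₀ α β) {c : ℝ} (hc : β - α < c) :
    ∀ᶠ n in atTop, P.real (D n) < c := by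
  set G : (Fin L → ℝ) → ℝ≥0∞ := fun z => ENNReal.ofReal (f ξ₀ p₀ z) with hG
  have hGm : Measurable G := hreg.cont.self_of_nhds.measurable.ennreal_ofReal
  have hprm : Measurable fun ω => powerRatio j₀ jm j a (partialSums ℓ fun i => E i ω) :=
    (measurable_powerRatio j₀ jm j a).comp (measurable_partialSums hE ℓ)
  have hmass : ∫⁻ z, G z = 1 := by
    have hp : IsProbabilityMeasure (volume.withDensity G) := by
      rw [← hmap]; exact Measure.isProbabilityMeasure_map hprm.aemeasurable
    have := hp.measure_univ
    rwa [withDensity_apply _ MeasurableSet.univ, setLIntegral_univ] at this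
  -- the limit posterior probability of the parameters below the truth lies in `[α, β]`
  set Q : Set (Fin L → ℝ) := {z | ENNReal.ofReal α * diagonalMass G univ z ≤ diagonalMass G (Iio 0) z ∧
      diagonalMass G (Iio 0) z ≤ ENNReal.ofReal β * diagonalMass G univ z} with hQ
  have hQm : MeasurableSet Q :=
    (measurableSet_le ((measurable_diagonalMass hGm _).const_mul _) (measurable_diagonalMass hGm _)).inter
      (measurableSet_le (measurable_diagonalMass hGm _) ((measurable_diagonalMass hGm _).const_mul _))
  have hunif : P' ((fun ω => powerRatio j₀ jm j a (partialSums ℓ fun i => E i ω)) ⁻¹' Q) ≤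
      ENNReal.ofReal (β - α) := by
    rw [← Measure.map_apply hprm hQm, hmap]
    exact measure_diagonalMass_mem_Icc_le hGm (fun z hz => hreg.diagonalMass_ne_zero hz)
      (fun z => hreg.diagonalMass_ne_top hL univ z) hmass hα hαβ hβ
  have hne : ∀ᵐ ω ∂P', G (powerRatio j₀ jm j a (partialSums ℓ fun i => E i ω)) ≠ 0 := by
    have h1 : ∀ᵐ z ∂(volume.withDensity G), G z ≠ 0 := by
      rw [ae_withDensity_iff hGm]
      exact Eventually.of_forall fun z hz => hz
    rw [← hmap] at h1
    exact ae_of_ae_map hprm.aemeasurable h1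
  have hc0 : 0 < c := by linarith
  have key := eventually_measure_lt_of_tendstoInDistribution hS hN hD
    (K := (fun ω => powerRatio j₀ jm j a (partialSums ℓ fun i => E i ω)) ⁻¹' Q) (by
      filter_upwards [hE.ae_partialSums_strictMono ℓ, hne] with ω hω hω' hmem
      exact diagonalMass_mem_of_mem_closure hreg hL hπm hπ0 hπB hπc hπφ ha hω.1
        (sub_pos.2 (Real.rpow_lt_rpow (hω.1 j₀).le (hω.2 h0m) ha)) hω' hmem)
    (c := ENNReal.ofReal c) (hunif.trans_lt ((ENNReal.ofReal_lt_ofReal_iff hc0).2 hc))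
  filter_upwards [key] with n hn
  exact ENNReal.toReal_lt_of_lt_ofReal hn

end State

end FrontierABC

open FrontierABC in
theorem mainTheorem6
    {d L : ℕ} (hL : 0 < L)
    -- data, technology and the input level of interest
    {Ω : Type*} [MeasurableSpace Ω] (P : Measure Ω) [IsProbabilityMeasure P]
    (X : ℕ → Ω → Fin d → ℝ) (Y : ℕ → Ω → ℝ)
    (hX : ∀ i, Measurable (X i)) (hY : ∀ i, Measurable (Y i))
    (T : Set ((Fin d → ℝ) × ℝ)) (hTnonneg : ∀ z ∈ T, 0 ≤ z.1 ∧ 0 ≤ z.2)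
    (hdisposal : FrontierABC.FreeDisposal T)
    (hdata : ∀ i, ∀ᵐ ω ∂P, (X i ω, Y i ω) ∈ T)
    (x : Fin d → ℝ) (p₀ : ℝ) (hp₀ : p₀ = P.real {ω | X 0 ω ≤ x}) (hp₀pos : 0 < p₀)
    -- feasible outputs at the input level are approached by the observable ones
    (hreach : ∀ y : ℝ, (x, y) ∈ T → ∀ y' < y, 0 < P {ω | X 0 ω ≤ x ∧ y' < Y 0 ω})
    (hindep : ProbabilityTheory.iIndepFun (fun i ω => (X i ω, Y i ω)) P)
    (hident : ∀ i, ProbabilityTheory.IdentDistrib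
      (fun ω => (X i ω, Y i ω)) (fun ω => (X 0 ω, Y 0 ω)) P P)
    -- extreme value index
    (ξ₀ : ℝ) (hev : FrontierABC.InTypeIIIDomain (FrontierABC.condDist P (X 0) (Y 0) x) ξ₀)
    -- tuning constants
    (k₀ m : ℝ) (k : Fin L → ℝ) (hk₀ : 0 < k₀) (hm : 1 < m) (hk : ∀ l, 0 < k l)
    (hk₀int : ∀ N : ℤ, k₀ * p₀ ≠ N) (hmk₀int : ∀ N : ℤ, m * k₀ * p₀ ≠ N)
    (hkint : ∀ l, ∀ N : ℤ, k l * p₀ ≠ N) (hmk₀ : k₀ * p₀ + 1 < m * k₀ * p₀)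
    (hranks : FrontierABC.DistinctRanks k₀ m k p₀)
    -- first-stage estimators
    (qhat : ℕ → ℝ → Ω → ℝ) (hqhat : FrontierABC.IsQuantileEstimator P X Y x qhat)
    (ξhat phat : ℕ → Ω → ℝ) (hξmeas : ∀ n, Measurable (ξhat n)) (hpmeas : ∀ n, Measurable (phat n))
    (hξhat : TendstoInMeasure P ξhat atTop fun _ => ξ₀)
    (hphat : TendstoInMeasure P phat atTop fun _ => p₀)
    -- limit experiment and its density
    {Ω' : Type*} [MeasurableSpace Ω'] (P' : Measure Ω') [IsProbabilityMeasure P']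
    (E : ℕ → Ω' → ℝ) (hE : FrontierABC.IsIIDExponential P' E)
    (f : ℝ → ℝ → (Fin L → ℝ) → ℝ) (hf : FrontierABC.IsLimitDensity P' E k₀ m k f)
    (hfcont : ∀ᶠ θ : ℝ × ℝ in 𝓝 (ξ₀, p₀), Continuous (f θ.1 θ.2))
    (hfcont₀ : ∀ z : Fin L → ℝ,
      ContinuousAt (fun u : (ℝ × ℝ) × (Fin L → ℝ) => f u.1.1 u.1.2 u.2) ((ξ₀, p₀), z))
    -- prior
    (π : ℝ → ℝ) (hπmeas : Measurable π) (hπnonneg : ∀ q, 0 ≤ π q) (hπbdd : ∃ C, ∀ q, π q ≤ C)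
    (hπcont : ContinuousAt π (FrontierABC.prodFrontier T x))
    (hπsupp : FrontierABC.prodFrontier T x ∈ interior (Function.support π))
    -- Bayesian estimators at the three levels, and their limits
    (τ' τ'' : ℝ) (hτ' : 0 < τ') (hτ : τ' < τ'') (hτ'' : τ'' < 1)
    (qBE : ℝ → ℕ → Ω → ℝ) (Zinf : ℝ → Ω' → ℝ)
    (hqBE : ∀ τ ∈ ({1 / 2, τ', τ''} : Set ℝ),
      FrontierABC.IsBayesEstimator P qhat k₀ m k f ξhat phat π τ (qBE τ))
    (hZinf : ∀ τ ∈ ({1 / 2, τ', τ''} : Set ℝ),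
      FrontierABC.IsUniqueLimitArgmin P' τ (f ξ₀ p₀) (FrontierABC.Ztilde E k₀ m k ξ₀ p₀) (Zinf τ))
    (hZcont : ∀ τ ∈ ({1 / 2, τ', τ''} : Set ℝ), P' {ω | Zinf τ ω = 0} = 0) :
    Tendsto (fun n => P.real {ω | FrontierABC.prodFrontier T x ≤ qBE (1 / 2) n ω}) atTop (𝓝 (1 / 2)) ∧
      Tendsto (fun n => P.real {ω | FrontierABC.prodFrontier T x ∈ Set.Icc (qBE τ' n ω) (qBE τ'' n ω)})
        atTop (𝓝 (τ'' - τ')) := by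
  obtain ⟨B, hπB⟩ := hπbdd
  set φ := prodFrontier T x with hφ
  have hπφ : 0 < π φ := lt_of_le_of_ne (hπnonneg φ) (Ne.symm (interior_subset hπsupp))
  have hξ₀ : ξ₀ < 0 := hev.1
  have ha : 0 < -ξ₀ := neg_pos.2 hξ₀
  have hmk₀pos : 0 < m * k₀ := by positivity
  have hrank : ∀ κ : ℝ, 0 < κ → 0 < rank κ p₀ := fun κ hκ => Nat.ceil_pos.2 (mul_pos hκ hp₀pos)
  -- enough order statistics to cover all ranks
  set ℓ : ℕ := rank k₀ p₀ + rank (m * k₀) p₀ + ∑ l, rank (k l) p₀ with hℓ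
  have hle : ∀ l, rank (k l) p₀ ≤ ∑ l, rank (k l) p₀ := fun l =>
    Finset.single_le_sum (f := fun l => rank (k l) p₀) (fun _ _ => Nat.zero_le _) (Finset.mem_univ l)
  set j₀ : Fin (ℓ + 1) := ⟨rank k₀ p₀ - 1, by omega⟩ with hj₀
  set jm : Fin (ℓ + 1) := ⟨rank (m * k₀) p₀ - 1, by omega⟩ with hjm
  set j : Fin L → Fin (ℓ + 1) := fun l => ⟨rank (k l) p₀ - 1, by have := hle l; omega⟩ with hj
  have hj₀' : (j₀ : ℕ) + 1 = rank k₀ p₀ := Nat.sub_add_cancel (hrank _ hk₀)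
  have hjm' : (jm : ℕ) + 1 = rank (m * k₀) p₀ := Nat.sub_add_cancel (hrank _ hmk₀pos)
  have hj' : ∀ l, (j l : ℕ) + 1 = rank (k l) p₀ := fun l => Nat.sub_add_cancel (hrank _ (hk l))
  have h0m : j₀ < jm := by
    have h1 : rank k₀ p₀ ≤ rank (m * k₀) p₀ := Nat.ceil_mono (by linarith)
    have h2 := hranks.1
    exact Fin.lt_def.2 (by omega)
  obtain ⟨e, O, he0, helim, hO, hq⟩ := exists_tendstoInDistribution_firstStage hX hY hTnonneg hdisposal
    hdata hp₀ hp₀pos hreach hindep hident hev hqhat hE ℓ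
  have hreg : IsRegularFamily (fun θ => f θ.1 θ.2) (ξ₀, p₀) :=
    isRegularFamily_of_isLimitDensity hE hL hp₀pos hξ₀ hk₀ hm hk hk₀int hmk₀int hkint hranks hf hfcont
      hfcont₀ (by norm_num) (by norm_num) (hZinf (1 / 2) (by simp)) hj₀' hjm' hj'
  have hmap : P'.map (fun ω => powerRatio j₀ jm j (-ξ₀) (partialSums ℓ fun i => E i ω)) =
      volume.withDensity fun z => ENNReal.ofReal (f ξ₀ p₀ z) := by
    rw [← (hf ξ₀ p₀ hξ₀ hp₀pos hranks).2.2]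
    exact Measure.map_congr (hE.ae_pos.mono fun ω hω =>
      (Ztilde_eq_powerRatio hp₀pos hj₀' hjm' hj' hω).symm)
  -- the state of the posterior
  set S : ℕ → Ω → State ℓ := fun n ω => (((O n ω, e n), ξhat n ω), phat n ω) with hS
  have hSlim : TendstoInDistribution S atTop
      (fun ω => (((partialSums ℓ fun i => E i ω, 0), ξ₀), p₀)) (fun _ => P) P' := by
    have he : TendstoInMeasure P (fun n (_ : Ω) => e n) atTop fun _ => 0 :=
      tendstoInMeasure_of_tendsto_ae (fun n => aestronglyMeasurable_const)
        (Eventually.of_forall fun _ => helim)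
    exact ((hO.prodMk_of_tendstoInMeasure_const _ _ _ he fun n => aemeasurable_const)
      |>.prodMk_of_tendstoInMeasure_const _ _ _ hξhat fun n => (hξmeas n).aemeasurable)
      |>.prodMk_of_tendstoInMeasure_const _ _ _ hphat fun n => (hpmeas n).aemeasurable
  -- the event on which some first-stage estimate is not the corresponding order statistic
  set bad : ℝ → Fin (ℓ + 1) → ℕ → Set Ω := fun κ i n =>
    {ω | ¬ (qhat n (1 - κ / n) ω = φ - e n * (O n ω i / p₀) ^ (-ξ₀))} with hbad
  set N : ℕ → Set Ω := fun n => (bad k₀ j₀ n ∪ bad (m * k₀) jm n) ∪ ⋃ l, bad (k l) (j l) n with hN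
  have hNlim : Tendsto (fun n => P (N n)) atTop (𝓝 0) := by
    have h0 : Tendsto (fun n => P (bad k₀ j₀ n) + P (bad (m * k₀) jm n) +
        ∑ l, P (bad (k l) (j l) n)) atTop (𝓝 (0 + 0 + ∑ _l : Fin L, 0)) :=
      ((hq k₀ hk₀ hk₀int j₀ hj₀').add (hq _ hmk₀pos hmk₀int jm hjm')).add
        (tendsto_finsetSum _ fun l _ => hq (k l) (hk l) (hkint l) (j l) (hj' l))
    simp only [add_zero, Finset.sum_const_zero] at h0
    refine tendsto_of_tendsto_of_tendsto_of_le_of_le tendsto_const_nhds h0 (fun n => zero_le)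
      fun n => ?_
    refine (measure_union_le _ _).trans (add_le_add (measure_union_le _ _) ?_)
    exact measure_iUnion_fintype_le P _
  have hquant : ∀ τ ∈ ({1 / 2, τ', τ''} : Set ℝ), 0 ≤ τ → τ ≤ 1 → ∀ᶠ n in atTop, ∀ᵐ ω ∂P, ω ∉ N n →
      (S n ω).IsGood f π φ j₀ jm j (-ξ₀) p₀ →
      (φ ≤ qBE τ n ω → (S n ω).mass f π φ j₀ jm j (-ξ₀) p₀ (Iio 0) ≤
        ENNReal.ofReal τ * (S n ω).mass f π φ j₀ jm j (-ξ₀) p₀ univ) ∧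
      (qBE τ n ω ≤ φ → ENNReal.ofReal τ * (S n ω).mass f π φ j₀ jm j (-ξ₀) p₀ univ ≤
        (S n ω).mass f π φ j₀ jm j (-ξ₀) p₀ (Iio 0)) := by
    intro τ hτmem hτ0 hτ1
    filter_upwards [(hqBE τ hτmem).2] with n hn
    filter_upwards [hn] with ω hω hωN hgood
    simp only [hN, hbad, mem_union, mem_iUnion, mem_ofPred_eq, not_or, not_exists, not_not] at hωN
    obtain ⟨⟨h1, h2⟩, h3⟩ := hωN
    exact hgood.minimiser hπmeas hπB hp₀pos (he0 n) hτ0 hτ1 h3 (by rw [alphaHat, h1, h2]) hω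
  have hmassle : ∀ s : State ℓ, s.mass f π φ j₀ jm j (-ξ₀) p₀ (Iio 0) ≤
      ENNReal.ofReal 1 * s.mass f π φ j₀ jm j (-ξ₀) p₀ univ := fun s => by
    rw [ENNReal.ofReal_one, one_mul]
    exact lintegral_mono_set (subset_univ _)
  have core : ∀ (D : ℕ → Set Ω) (α β : ℝ), 0 ≤ α → α ≤ β → β ≤ 1 →
      (∀ᶠ n in atTop, ∀ᵐ ω ∂P, ω ∈ D n → ω ∉ N n →
        S n ω ∈ exceptionalStates f π φ j₀ jm j (-ξ₀) p₀ α β) →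
      ∀ c, β - α < c → ∀ᶠ n in atTop, P.real (D n) < c := fun D α β h1 h2 h3 h4 c hc =>
    eventually_measureReal_lt_of_posterior hE hreg hL hmap hπmeas hπnonneg hπB hπcont hπφ ha h0m hSlim
      hNlim h1 h2 h3 h4 hc
  have hupper : ∀ τ ∈ ({1 / 2, τ', τ''} : Set ℝ), 0 ≤ τ → τ ≤ 1 → ∀ c, τ < c →
      ∀ᶠ n in atTop, P.real {ω | φ ≤ qBE τ n ω} < c := by
    intro τ hτmem hτ0 hτ1 c hc
    refine core _ 0 τ le_rfl hτ0 hτ1 ?_ c (by linarith)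
    filter_upwards [hquant τ hτmem hτ0 hτ1] with n hn
    filter_upwards [hn] with ω hω hωD hωN hgood
    refine ⟨?_, (hω hωN hgood).1 hωD⟩
    rw [ENNReal.ofReal_zero, zero_mul]
    exact zero_le
  have hlower : ∀ τ ∈ ({1 / 2, τ', τ''} : Set ℝ), 0 ≤ τ → τ ≤ 1 → ∀ c, 1 - τ < c →
      ∀ᶠ n in atTop, P.real {ω | qBE τ n ω ≤ φ} < c := by
    intro τ hτmem hτ0 hτ1 c hc
    refine core _ τ 1 hτ0 hτ1 le_rfl ?_ c hc
    filter_upwards [hquant τ hτmem hτ0 hτ1] with n hn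
    filter_upwards [hn] with ω hω hωD hωN hgood
    exact ⟨(hω hωN hgood).2 hωD, hmassle _⟩
  constructor
  · refine tendsto_order.2 ⟨fun c hc => ?_, fun c hc => ?_⟩
    · filter_upwards [hlower (1 / 2) (by simp) (by norm_num) (by norm_num) (1 - c) (by linarith)] with n hn
      have h1 : (1 : ℝ) ≤ P.real {ω | φ ≤ qBE (1 / 2) n ω} + P.real {ω | qBE (1 / 2) n ω ≤ φ} := by
        refine (probReal_univ (μ := P)).symm.le.trans (le_trans (measureReal_mono fun ω _ => ?_)
          (measureReal_union_le _ _))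
        exact le_total φ (qBE (1 / 2) n ω)
      linarith
    · exact hupper (1 / 2) (by simp) (by norm_num) (by norm_num) c hc
  · refine tendsto_order.2 ⟨fun c hc => ?_, fun c hc => ?_⟩
    · have hε : 0 < (τ'' - τ' - c) / 2 := by linarith
      filter_upwards [hupper τ' (by simp) hτ'.le (by linarith) (τ' + (τ'' - τ' - c) / 2) (by linarith),
        hlower τ'' (by simp) (by linarith) hτ''.le (1 - τ'' + (τ'' - τ' - c) / 2) (by linarith)]
        with n h1 h2
      have h3 : (1 : ℝ) ≤ P.real {ω | φ ≤ qBE τ' n ω} + P.real {ω | qBE τ'' n ω ≤ φ} +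
          P.real {ω | φ ∈ Set.Icc (qBE τ' n ω) (qBE τ'' n ω)} := by
        refine (probReal_univ (μ := P)).symm.le.trans ?_
        refine (measureReal_mono (s₂ := ({ω | φ ≤ qBE τ' n ω} ∪ {ω | qBE τ'' n ω ≤ φ}) ∪
          {ω | φ ∈ Set.Icc (qBE τ' n ω) (qBE τ'' n ω)}) fun ω _ => ?_).trans
            ((measureReal_union_le _ _).trans (add_le_add (measureReal_union_le _ _) le_rfl))
        rcases le_total φ (qBE τ' n ω) with h | h
        · exact Or.inl (Or.inl h)
        · rcases le_total (qBE τ'' n ω) φ with h' | h'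
          · exact Or.inl (Or.inr h')
          · exact Or.inr ⟨h, h'⟩
      linarith
    · refine core _ τ' τ'' hτ'.le hτ.le hτ''.le ?_ c hc
      filter_upwards [hquant τ' (by simp) hτ'.le (by linarith),
        hquant τ'' (by simp) (by linarith) hτ''.le] with n hn1 hn2
      filter_upwards [hn1, hn2] with ω h1 h2 hωD hωN hgood
      exact ⟨(h1 hωN hgood).2 hωD.1, (h2 hωN hgood).1 hωD.2⟩
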